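/- Let $X_1,X_2,\dots$ be i.i.d. random vectors in $\mathbb{R}^k$ with law $F$, let $g:\mathbb{R}^k\times\mathbb{R}^p\to\mathbb{R}^p$ ($p$ estimating functions for a $p$-dimensional parameter) and let $\theta_0\in\mathbb{R}^p$ be the true parameter value, $E_F[g(X,\theta_0)]=0$. For $\theta\in\mathbb{R}^p$ let $\mathbf{p}(\theta)=(p_1(\theta),\dots,p_n(\theta))$ be the probability vector which maximizes $\prod_{i=1}^n p_i$ subject to $p_i\ge 0$, $\sum_i p_i=1$, $\sum_i p_i\,g(X_i,\theta)=0$, and let $\ell_{E,n}(\theta)=\sum_i\log(n\,p_i(\theta))$ be the empirical log-likelihood ($-\infty$ if there is no such vector with positive entries). Let $c:\mathbb{R}^p\to\mathbb{R}^q$ and let $H_0: c(\theta_0)=0$ hold. Assume that (i) $S_{11}=E_F[g(X,\theta_0)g(X,\theta_0)^T]$ is positive definite and $S_{12}=E_F[\partial g(X,\theta_0)/\partial\theta^T]$ has rank $p$; (ii) near $\theta_0$, $\|g(x,\theta)\|^3$ is bounded by an $F$-integrable function of $x$; (iii), (iv) near $\theta_0$, the first and the second derivative of $\theta\mapsto g(x,\theta)$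 exist, are continuous, and are bounded in norm by $F$-integrable functions of $x$; (v) near $\theta_0$, $c$ is continuously differentiable, $C(\theta)=\partial c(\theta)/\partial\theta^T$ has rank $q$ at $\theta_0$, and $\partial C(\theta)/\partial\theta$ exists and is bounded near $\theta_0$. Let $\phi:(0,\infty)\to\mathbb{R}$ be convex and twice differentiable at $1$, with $\phi(1)=\phi'(1)=0$ and $\phi''(1)>0$. Put $D_\phi(a,b)=\sum_i b_i\,\phi(a_i/b_i)$, $u=(1/n,\dots,1/n)$, and $$T_n^\phi(\theta_1,\theta_2)=\frac{2n}{\phi''(1)}\bigl(D_\phi(u,\mathbf{p}(\theta_2))-D_\phi(u,\mathbf{p}(\theta_1))\bigr),\qquad S_n^\phi(\theta_1,\theta_2)=\frac{2n}{\phi''(1)}D_\phi(\mathbf{p}(\theta_1),\mathbf{p}(\theta_2)).$$ Then there is $\rho_0>0$ such that the following holds. (a) For every $0<\rho\le\rho_0$, almost surely, for all large $n$, $\ell_{E,n}$ attains a finite maximum over the closed ball $\bar B(\theta_0,\rho)$ and over $\bar B(\theta_0,\rho)\cap\{c=0\}$. (b) Let $\Theta$ be any neighbourhood of $\theta_0$,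 and let $\widehat\theta_{E,n}$, $\widetilde\theta_{E,n}$ be such that, with probability tending to one, $\widehat\theta_{E,n}$ maximizes $\ell_{E,n}$ over $\Theta$, $\widetilde\theta_{E,n}$ maximizes $\ell_{E,n}$ over $\{\theta\in\Theta: c(\theta)=0\}$ (both with finite maximum), and $\widetilde\theta_{E,n}\in\bar B(\theta_0,\rho_0)$. Then $T_n^\phi(\widehat\theta_{E,n},\widetilde\theta_{E,n})=S_n^\phi(\widehat\theta_{E,n},\widetilde\theta_{E,n})$ with probability tending to one, and both statistics converge in law to the chi-squared distribution $\chi^2_q$ with $q$ degrees of freedom. -/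

import Mathlib

open MeasureTheory ProbabilityTheory Filter Topology

noncomputable section

namespace EmpiricalPhi

/-- The space `ℝᵐ` of column vectors, with the Euclidean norm. -/
abbrev E (m : ℕ) : Type := EuclideanSpace ℝ (Fin m)

/-- The Jacobian matrix `∂f/∂θᵀ` of `f : ℝᵖ → ℝᵐ` at `θ`. -/
def jacobian {m p : ℕ} (f : E p → E m) (θ : E p) : Matrix (Fin m) (Fin p) ℝ :=
  Matrix.of fun i j => fderiv ℝ f θ (EuclideanSpace.single j 1) i

/-! ### Empirical likelihood -/

/-- The probability vectors `(w₁, …, wₙ)` which satisfy the estimating equations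
`∑ wᵢ g(xᵢ, θ) = 0` at the parameter value `θ`. -/
def feasibleWeights {k p r n : ℕ} (g : E k → E p → E r) (x : Fin n → E k) (θ : E p) :
    Set (Fin n → ℝ) :=
  {w | (∀ i, 0 ≤ w i) ∧ ∑ i, w i = 1 ∧ ∑ i, w i • g (x i) θ = 0}

/-- `w` maximizes the empirical likelihood `∏ wᵢ` among the feasible weights at `θ`. -/
def IsELWeights {k p r n : ℕ} (g : E k → E p → E r) (x : Fin n → E k) (θ : E p)
    (w : Fin n → ℝ) : Prop :=
  w ∈ feasibleWeights g x θ ∧ ∀ v ∈ feasibleWeights g x θ, ∏ i, v i ≤ ∏ i, w i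

open Classical in
/-- The vector `p(θ) = (p₁(θ), …, pₙ(θ))` of maximum empirical likelihood weights at `θ`.
It is unique as soon as some feasible weight vector has positive entries; it is set
to `0` if there are no feasible weights at all, so that the likelihood of `θ` is then `0`
(for `n ≥ 1`). -/
def elWeights {k p r n : ℕ} (g : E k → E p → E r) (x : Fin n → E k) (θ : E p) : Fin n → ℝ :=
  if h : ∃ w, IsELWeights g x θ w then h.choose else 0

/-- The empirical likelihood `∏ pᵢ(θ)` of the parameter value `θ`; the empirical log-likelihood
is its logarithm. -/
def empLik {k p r n : ℕ} (g : E k → E p → E r) (x : Fin n → E k) (θ : E p) : ℝ :=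
  ∏ i, elWeights g x θ i

/-- `θ` is a maximum empirical likelihood estimate over the parameter set `A`: its empirical
log-likelihood is finite (its likelihood is positive), and maximal over `A`. For
`A = Θ` this is the unrestricted estimate, for `A = {θ ∈ Θ | c θ = 0}` the restricted one. -/
def IsMELE {k p r n : ℕ} (g : E k → E p → E r) (x : Fin n → E k) (A : Set (E p))
    (θ : E p) : Prop :=
  θ ∈ A ∧ 0 < empLik g x θ ∧ ∀ θ' ∈ A, empLik g x θ' ≤ empLik g x θ

/-! ### Phi-divergence statistics -/

/-- The class `Φ`: convex functions `φ` on `(0, ∞)`, twice differentiable at `1`, with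
`φ(1) = φ'(1) = 0` and `φ''(1) > 0`. -/
structure IsPhi (φ : ℝ → ℝ) : Prop where
  convex : ConvexOn ℝ (Set.Ioi 0) φ
  map_one : φ 1 = 0
  differentiable_near : ∀ᶠ u in 𝓝 (1 : ℝ), DifferentiableAt ℝ φ u
  deriv_one : deriv φ 1 = 0
  differentiable_deriv : DifferentiableAt ℝ (deriv φ) 1
  deriv_deriv_pos : 0 < deriv (deriv φ) 1

/-- The `φ`-divergence `D_φ(a, b) = ∑ bᵢ φ(aᵢ / bᵢ)` between vectors with positive entries. -/
def phiDiv {n : ℕ} (φ : ℝ → ℝ) (a b : Fin n → ℝ) : ℝ :=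
  ∑ i, b i * φ (a i / b i)

/-- The discrete uniform probability vector `u = (1/n, …, 1/n)`. -/
def uniformWeights (n : ℕ) : Fin n → ℝ := fun _ => 1 / (n : ℝ)

/-- `T_n^φ(θ₁, θ₂) = (2n / φ''(1)) (D_φ(u, p(θ₂)) - D_φ(u, p(θ₁)))`. -/
def statT {k p r n : ℕ} (φ : ℝ → ℝ) (g : E k → E p → E r) (x : Fin n → E k) (θ₁ θ₂ : E p) : ℝ :=
  2 * (n : ℝ) / deriv (deriv φ) 1 *
    (phiDiv φ (uniformWeights n) (elWeights g x θ₂)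
      - phiDiv φ (uniformWeights n) (elWeights g x θ₁))

/-- `S_n^φ(θ₁, θ₂) = (2n / φ''(1)) D_φ(p(θ₁), p(θ₂))`. -/
def statS {k p r n : ℕ} (φ : ℝ → ℝ) (g : E k → E p → E r) (x : Fin n → E k) (θ₁ θ₂ : E p) : ℝ :=
  2 * (n : ℝ) / deriv (deriv φ) 1 * phiDiv φ (elWeights g x θ₁) (elWeights g x θ₂)

/-- The first `n` observations. -/
def sample {Ω : Type*} {k : ℕ} (X : ℕ → Ω → E k) (n : ℕ) (ω : Ω) : Fin n → E k :=
  fun i => X i ω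

/-! ### Regularity conditions -/

/-- `S₁₁(θ) = E_F[g(X, θ) g(X, θ)ᵀ]`. -/
def S11 {k p r : ℕ} (F : Measure (E k)) (g : E k → E p → E r) (θ : E p) :
    Matrix (Fin r) (Fin r) ℝ :=
  Matrix.of fun i j => ∫ x, g x θ i * g x θ j ∂F

/-- `S₁₂(θ) = E_F[∂g(X, θ)/∂θᵀ]`. -/
def S12 {k p r : ℕ} (F : Measure (E k)) (g : E k → E p → E r) (θ : E p) :
    Matrix (Fin r) (Fin p) ℝ :=
  Matrix.of fun i j => ∫ x, jacobian (g x) θ i j ∂F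

/-- The regularity conditions on the estimating functions `g` at `θ₀`, where `F` is the law of
one observation. -/
structure RegularAt {k p r : ℕ} (F : Measure (E k)) (g : E k → E p → E r) (θ₀ : E p) : Prop where
  posDef_S11 : (S11 F g θ₀).PosDef
  rank_S12 : (S12 F g θ₀).rank = p
  cube_bound : ∃ U ∈ 𝓝 θ₀, ∃ H : E k → ℝ, Integrable H F ∧
    ∀ᵐ x ∂F, ∀ θ ∈ U, ‖g x θ‖ ^ 3 ≤ H x
  deriv_bound : ∃ U ∈ 𝓝 θ₀, ∃ H : E k → ℝ, Integrable H F ∧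
    ∀ᵐ x ∂F, (∀ θ ∈ U, DifferentiableAt ℝ (g x) θ) ∧ ContinuousOn (fderiv ℝ (g x)) U ∧
      ∀ θ ∈ U, ‖fderiv ℝ (g x) θ‖ ≤ H x
  deriv_two_bound : ∃ U ∈ 𝓝 θ₀, ∃ H : E k → ℝ, Integrable H F ∧
    ∀ᵐ x ∂F, (∀ θ ∈ U, DifferentiableAt ℝ (fderiv ℝ (g x)) θ) ∧
      ContinuousOn (fderiv ℝ (fderiv ℝ (g x))) U ∧
      ∀ θ ∈ U, ‖fderiv ℝ (fderiv ℝ (g x)) θ‖ ≤ H x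

/-- The conditions on the constraint `c` at `θ₀`: it is continuously differentiable near `θ₀`,
its Jacobian matrix at `θ₀` has rank `q`, and the derivative of the Jacobian exists and is bounded
near `θ₀`. -/
structure ConstraintRegularAt {p q : ℕ} (c : E p → E q) (θ₀ : E p) : Prop where
  cont_diff : ∃ U ∈ 𝓝 θ₀, (∀ θ ∈ U, DifferentiableAt ℝ c θ) ∧ ContinuousOn (fderiv ℝ c) U
  rank_jacobian : (jacobian c θ₀).rank = q
  deriv_two_bound : ∃ U ∈ 𝓝 θ₀, ∃ K : ℝ, ∀ θ ∈ U,
    DifferentiableAt ℝ (fderiv ℝ c) θ ∧ ‖fderiv ℝ (fderiv ℝ c) θ‖ ≤ K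

/-! ### The chi-squared law -/

/-- The chi-squared distribution with `q` degrees of freedom: the law of the sum of the squares
of `q` independent standard normal variables. -/
def chiSquared (q : ℕ) : Measure ℝ :=
  (Measure.pi fun _ : Fin q => gaussianReal 0 1).map fun z => ∑ i, z i ^ 2

instance isProbabilityMeasure_chiSquared (q : ℕ) : IsProbabilityMeasure (chiSquared q) :=
  Measure.isProbabilityMeasure_map (Measurable.aemeasurable (by fun_prop))

end EmpiricalPhi

end

noncomputable section

namespace EmpiricalPhi

open Asymptotics
open scoped InnerProductSpace

/-! ### Duality for empirical likelihood weights -/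

/-! There are as many estimating equations as parameters, so with probability tending to one they
have an exact root in `Θ` (`eventually_exists_root`, an inverse function argument). At a root the
equal weights are feasible, and by AM–GM they alone maximize the product among probability vectors.
Hence the unrestricted estimate has uniform weights wherever it lies in `Θ`, and both statistics
collapse to `(2n/φ''(1)) D_φ(u, p(θ̃))` at the restricted estimate `θ̃`.

To analyse this quantity, duality writes the weights as `pᵢ = 1 / (n (1 + tᵢ))` with `tᵢ = ⟪l, g(xᵢ,
θ)⟫` for a multiplier `l`. If `θ - θ₀` is of order `n^(-1/2)`, the `tᵢ` are uniformly small with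
bounded sum of squares. A second order expansion then shows that the `φ`-statistic and twice the
log-likelihood ratio are both `∑ tᵢ² + o(1)`, whatever `φ` is. This sum is `‖W √n ḡ(θ)‖² + o(1)`,
where `ḡ` is the sample mean and `W` is the inverse square root of `S` (`exists_multiplier`,
`tendsto_logRatio_and_phiDiv`).

The restricted estimate minimizes the log-likelihood ratio over `c = 0` within `Θ`. Comparison with
`θ₀` bounds its ratio, and weak duality turns this bound into the rate `n^(-1/2)`
(`exists_rate_of_logRatio_le`). With `Z = √n ḡ(θ₀)` the ratio becomes the quadratic form `‖W (Z + D
v)‖²`, where `v` is asymptotically tangent to the constraint; conversely the implicit function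
theorem supplies constrained points in the optimal tangent direction. So the statistic is
asymptotically the squared distance of `W Z` from a subspace of codimension `q`. This distance is
`‖A Z‖` with `A Z` standardized in `ℝ^q` (`exists_minimizer`), and the central limit theorem gives
`χ²_q`.

The asymptotics are deterministic statements along `probFilter`, whose members are the sequences of
events with probability tending to one. Since `Z` is only tight, one works on `‖Z‖ ≤ M` and removes
`M` at the end (`eventually_probFilter_of_tight`).

Existence of maxima is separate: it is compactness in the pair (parameter, weights), together with
strictly positive weights at `θ₀` from the almost sure law of large numbers. -/

theorem sum_dual_sub_one {k p r n : ℕ} {g : E k → E p → E r} {x : Fin n → E k} {θ : E p}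
    {w : Fin n → ℝ} (hw : w ∈ feasibleWeights g x θ) (l : E r) :
    ∑ i, (w i * (n * (1 + ⟪l, g (x i) θ⟫_ℝ)) - 1) = 0 := by
  obtain ⟨-, h1, h2⟩ := hw
  have h3 : ∑ i, w i * ⟪l, g (x i) θ⟫_ℝ = 0 := by
    have := congrArg (fun z => ⟪l, z⟫_ℝ) h2
    simpa [inner_sum, real_inner_smul_right] using this
  have h4 : ∀ i, w i * (n * (1 + ⟪l, g (x i) θ⟫_ℝ)) - 1
      = n * w i + n * (w i * ⟪l, g (x i) θ⟫_ℝ) - 1 := fun i => by ring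
  simp_rw [h4]
  rw [Finset.sum_sub_distrib, Finset.sum_add_distrib, ← Finset.mul_sum, ← Finset.mul_sum, h1, h3]
  simp

/-- Weak duality: a dual vector bounds the empirical likelihood from above. -/
theorem prod_mul_le_one_of_feasible {k p r n : ℕ} {g : E k → E p → E r} {x : Fin n → E k}
    {θ : E p} {w : Fin n → ℝ} (hw : w ∈ feasibleWeights g x θ) {l : E r}
    (hl : ∀ i, 0 ≤ 1 + ⟪l, g (x i) θ⟫_ℝ) :
    ∏ i, (w i * (n * (1 + ⟪l, g (x i) θ⟫_ℝ))) ≤ 1 := by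
  -- AM–GM in the form `y ≤ exp (y - 1)`, which also covers zero weights; the exponents sum to zero.
  calc ∏ i, (w i * (n * (1 + ⟪l, g (x i) θ⟫_ℝ)))
      ≤ ∏ i, Real.exp (w i * (n * (1 + ⟪l, g (x i) θ⟫_ℝ)) - 1) := by
        refine Finset.prod_le_prod (fun i _ => ?_) fun i _ => ?_
        · exact mul_nonneg (hw.1 i) (mul_nonneg (Nat.cast_nonneg _) (hl i))
        · linarith [Real.add_one_le_exp (w i * (n * (1 + ⟪l, g (x i) θ⟫_ℝ)) - 1)]
    _ = 1 := by rw [← Real.exp_sum, sum_dual_sub_one hw, Real.exp_zero]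

/-- The equality case of weak duality. -/
theorem eq_of_one_le_prod_mul {k p r n : ℕ} {g : E k → E p → E r} {x : Fin n → E k}
    {θ : E p} {w : Fin n → ℝ} (hw : w ∈ feasibleWeights g x θ) {l : E r}
    (hl : ∀ i, 0 < 1 + ⟪l, g (x i) θ⟫_ℝ)
    (h : 1 ≤ ∏ i, (w i * (n * (1 + ⟪l, g (x i) θ⟫_ℝ)))) (i : Fin n) :
    w i = (n * (1 + ⟪l, g (x i) θ⟫_ℝ))⁻¹ := by
  set y : Fin n → ℝ := fun i => w i * (n * (1 + ⟪l, g (x i) θ⟫_ℝ)) with hy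
  have hy0 : ∀ i, 0 ≤ y i := fun i =>
    mul_nonneg (hw.1 i) (mul_nonneg (Nat.cast_nonneg _) (hl i).le)
  have hpos : ∀ i, 0 < y i := by
    intro i
    refine (hy0 i).lt_of_ne fun hi => ?_
    rw [Finset.prod_eq_zero (Finset.mem_univ i) hi.symm] at h
    linarith
  -- `y < exp (y - 1)` is strict unless `y = 1`, so a single factor other than `1` would push the
  -- product below `1`.
  have key : y i = 1 := by
    by_contra hne
    have hlt : ∏ i, y i < ∏ i, Real.exp (y i - 1) := by
      refine Finset.prod_lt_prod (fun j _ => hpos j) (fun j _ => ?_) ⟨i, Finset.mem_univ i, ?_⟩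
      · linarith [Real.add_one_le_exp (y j - 1)]
      · have := Real.add_one_lt_exp (sub_ne_zero.mpr hne)
        linarith
    rw [← Real.exp_sum, sum_dual_sub_one hw, Real.exp_zero] at hlt
    linarith
  exact eq_inv_of_mul_eq_one_left key

/-- `l` is a Lagrange multiplier for the estimating equations at `θ`. -/
def IsMultiplier {k p r n : ℕ} (g : E k → E p → E r) (x : Fin n → E k) (θ : E p) (l : E r) :
    Prop :=
  (∀ i, 0 < 1 + ⟪l, g (x i) θ⟫_ℝ) ∧ ∑ i, (1 + ⟪l, g (x i) θ⟫_ℝ)⁻¹ • g (x i) θ = 0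

/-- The total mass comes for free: pairing the multiplier equation with `l` gives `∑ tᵢ/(1 + tᵢ) =
0`, and `1/(1 + t) = 1 - t/(1 + t)`. -/
theorem IsMultiplier.feasible {k p r n : ℕ} {g : E k → E p → E r} {x : Fin n → E k} {θ : E p}
    {l : E r} (h : IsMultiplier g x θ l) (hn : 0 < n) :
    (fun i => (n * (1 + ⟪l, g (x i) θ⟫_ℝ))⁻¹) ∈ feasibleWeights g x θ := by
  have hn' : (n : ℝ) ≠ 0 := by positivity
  refine ⟨fun i => inv_nonneg.2 (mul_nonneg (Nat.cast_nonneg _) (h.1 i).le), ?_, ?_⟩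
  · have h3 : ∑ i, (1 + ⟪l, g (x i) θ⟫_ℝ)⁻¹ * ⟪l, g (x i) θ⟫_ℝ = 0 := by
      have := congrArg (fun z => ⟪l, z⟫_ℝ) h.2
      simpa [inner_sum, real_inner_smul_right] using this
    have h4 : ∀ i, (n * (1 + ⟪l, g (x i) θ⟫_ℝ))⁻¹
        = (n : ℝ)⁻¹ * (1 - (1 + ⟪l, g (x i) θ⟫_ℝ)⁻¹ * ⟪l, g (x i) θ⟫_ℝ) := by
      intro i
      have := (h.1 i).ne'
      field_simp
      ring
    simp_rw [h4]
    rw [← Finset.mul_sum, Finset.sum_sub_distrib, h3]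
    simp [hn']
  · simp_rw [mul_inv, mul_smul]
    rw [← Finset.smul_sum, h.2, smul_zero]

theorem IsMultiplier.isELWeights {k p r n : ℕ} {g : E k → E p → E r} {x : Fin n → E k} {θ : E p}
    {l : E r} (h : IsMultiplier g x θ l) (hn : 0 < n) :
    IsELWeights g x θ (fun i => (n * (1 + ⟪l, g (x i) θ⟫_ℝ))⁻¹) := by
  refine ⟨h.feasible hn, fun v hv => ?_⟩
  have hpos : 0 < ∏ i, ((n : ℝ) * (1 + ⟪l, g (x i) θ⟫_ℝ)) :=
    Finset.prod_pos fun i _ => mul_pos (by exact_mod_cast hn) (h.1 i)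
  have := prod_mul_le_one_of_feasible hv fun i => (h.1 i).le
  rw [Finset.prod_mul_distrib] at this
  rw [Finset.prod_inv_distrib, ← one_div, le_div_iff₀ hpos]
  exact this

theorem elWeights_spec {k p r n : ℕ} {g : E k → E p → E r} {x : Fin n → E k} {θ : E p}
    {w : Fin n → ℝ} (h : IsELWeights g x θ w) : IsELWeights g x θ (elWeights g x θ) := by
  have hex : ∃ w, IsELWeights g x θ w := ⟨w, h⟩
  rw [elWeights, dif_pos hex]
  exact hex.choose_spec

theorem empLik_eq_of_isELWeights {k p r n : ℕ} {g : E k → E p → E r} {x : Fin n → E k} {θ : E p}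
    {w : Fin n → ℝ} (h : IsELWeights g x θ w) : empLik g x θ = ∏ i, w i :=
  le_antisymm (h.2 _ (elWeights_spec h).1) ((elWeights_spec h).2 _ h.1)

/-- `elWeights` is an arbitrary choice among maximizers; the equality case of weak duality shows
that there is only one. -/
theorem IsMultiplier.elWeights_eq {k p r n : ℕ} {g : E k → E p → E r} {x : Fin n → E k} {θ : E p}
    {l : E r} (h : IsMultiplier g x θ l) (hn : 0 < n) :
    elWeights g x θ = fun i => (n * (1 + ⟪l, g (x i) θ⟫_ℝ))⁻¹ := by
  have hs := elWeights_spec (h.isELWeights hn)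
  funext i
  refine eq_of_one_le_prod_mul hs.1 h.1 ?_ i
  rw [Finset.prod_mul_distrib]
  have hpos : 0 < ∏ i, ((n : ℝ) * (1 + ⟪l, g (x i) θ⟫_ℝ)) :=
    Finset.prod_pos fun i _ => mul_pos (by exact_mod_cast hn) (h.1 i)
  have := hs.2 _ (h.feasible hn)
  rw [Finset.prod_inv_distrib, ← one_div, div_le_iff₀ hpos] at this
  exact this

/-- A positive empirical likelihood is attained by feasible weights. -/
theorem elWeights_feasible_of_pos {k p r n : ℕ} {g : E k → E p → E r} {x : Fin n → E k} {θ : E p}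
    (hn : 0 < n) (h : 0 < empLik g x θ) : IsELWeights g x θ (elWeights g x θ) := by
  by_cases hex : ∃ w, IsELWeights g x θ w
  · exact elWeights_spec hex.choose_spec
  · rw [empLik, elWeights, dif_neg hex] at h
    have : Nonempty (Fin n) := ⟨⟨0, hn⟩⟩
    simp [hn.ne'] at h

/-- The empirical log-likelihood ratio `-∑ log (n pᵢ(θ))`. -/
def logRatio {k p r n : ℕ} (g : E k → E p → E r) (x : Fin n → E k) (θ : E p) : ℝ :=
  -Real.log ((n : ℝ) ^ n * empLik g x θ)

theorem logRatio_le_logRatio {k p r n : ℕ} {g : E k → E p → E r} {x : Fin n → E k} {θ θ' : E p}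
    (hn : 0 < n) (h0 : 0 < empLik g x θ') (h : empLik g x θ' ≤ empLik g x θ) :
    logRatio g x θ ≤ logRatio g x θ' := by
  have : (0 : ℝ) < (n : ℝ) ^ n := by positivity
  exact neg_le_neg (Real.log_le_log (by positivity) (by gcongr))

/-- Weak duality in logarithmic form. Any admissible `l` gives a lower bound, so it applies to
parameters at which no multiplier is known yet; the rate of the restricted estimate rests on it. -/
theorem sum_log_le_logRatio {k p r n : ℕ} {g : E k → E p → E r} {x : Fin n → E k} {θ : E p}
    (hn : 0 < n) (h0 : 0 < empLik g x θ) {l : E r} (hl : ∀ i, 0 < 1 + ⟪l, g (x i) θ⟫_ℝ) :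
    ∑ i, Real.log (1 + ⟪l, g (x i) θ⟫_ℝ) ≤ logRatio g x θ := by
  have hw := elWeights_feasible_of_pos hn h0
  have h1 := prod_mul_le_one_of_feasible hw.1 fun i => (hl i).le
  have hpos : 0 < ∏ i, (1 + ⟪l, g (x i) θ⟫_ℝ) := Finset.prod_pos fun i _ => hl i
  have hn' : (0 : ℝ) < (n : ℝ) ^ n := by positivity
  rw [← Real.log_prod (fun i _ => (hl i).ne'), logRatio, ← Real.log_inv]
  refine Real.log_le_log hpos ?_
  rw [Finset.prod_mul_distrib, Finset.prod_mul_distrib] at h1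
  rw [← one_div, le_div_iff₀ (by positivity)]
  simp only [Finset.prod_const, Finset.card_univ, Fintype.card_fin] at h1
  calc _ = (∏ i, elWeights g x θ i) * ((n : ℝ) ^ n * ∏ i, (1 + ⟪l, g (x i) θ⟫_ℝ)) := by
        rw [empLik]; ring
    _ ≤ 1 := h1

theorem IsMultiplier.empLik_pos {k p r n : ℕ} {g : E k → E p → E r} {x : Fin n → E k} {θ : E p}
    {l : E r} (h : IsMultiplier g x θ l) (hn : 0 < n) : 0 < empLik g x θ := by
  rw [empLik, h.elWeights_eq hn]
  exact Finset.prod_pos fun i _ => inv_pos.2 (mul_pos (by exact_mod_cast hn) (h.1 i))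

theorem IsMultiplier.logRatio_eq {k p r n : ℕ} {g : E k → E p → E r} {x : Fin n → E k} {θ : E p}
    {l : E r} (h : IsMultiplier g x θ l) (hn : 0 < n) :
    logRatio g x θ = ∑ i, Real.log (1 + ⟪l, g (x i) θ⟫_ℝ) := by
  have hn' : (n : ℝ) ^ n ≠ 0 := by positivity
  rw [← Real.log_prod (fun i _ => (h.1 i).ne'), logRatio, ← Real.log_inv, empLik, h.elWeights_eq hn]
  simp only [mul_inv, Finset.prod_mul_distrib, Finset.prod_const, Finset.card_univ,
    Fintype.card_fin, Finset.prod_inv_distrib]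
  rw [inv_pow, inv_inv, inv_inv, ← mul_assoc, inv_mul_cancel₀ hn', one_mul]

theorem isMultiplier_zero {k p r n : ℕ} {g : E k → E p → E r} {x : Fin n → E k} {θ : E p}
    (h : ∑ i, g (x i) θ = 0) : IsMultiplier g x θ 0 := by
  simp [IsMultiplier, h]

/-- If the estimating equations have a root in `A`, then all weights are equal at every maximum
empirical likelihood estimate over `A`. -/
theorem IsMELE.elWeights_eq_uniform {k p r n : ℕ} {g : E k → E p → E r} {x : Fin n → E k}
    {A : Set (E p)} {θ θ' : E p} (h : IsMELE g x A θ) (hn : 0 < n) (hA : θ' ∈ A)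
    (h0 : ∑ i, g (x i) θ' = 0) : elWeights g x θ = uniformWeights n := by
  have hs := elWeights_feasible_of_pos hn h.2.1
  have hle := h.2.2 θ' hA
  rw [empLik, (isMultiplier_zero h0).elWeights_eq hn] at hle
  funext i
  have hn' : (n : ℝ) ≠ 0 := by positivity
  have := eq_of_one_le_prod_mul (l := 0) hs.1 (by simp) (by
    rw [Finset.prod_mul_distrib]
    simp only [inner_zero_left, add_zero, mul_one, Finset.prod_const, Finset.card_univ,
      Fintype.card_fin, empLik] at hle ⊢
    calc (1 : ℝ) = ((n : ℝ)⁻¹) ^ n * (n : ℝ) ^ n := by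
          rw [← mul_pow, inv_mul_cancel₀ hn', one_pow]
      _ ≤ _ := by gcongr) i
  simpa [uniformWeights] using this

/-- The Taylor remainder `|t|³/(1 - |t|)` is at most `t²/4` on this range, so half of the quadratic
term `t²/2` survives. -/
theorem log_one_add_le {t : ℝ} (ht : |t| ≤ 1 / 8) : Real.log (1 + t) ≤ t - t ^ 2 / 4 := by
  have h := Real.abs_log_sub_add_sum_range_le (x := -t) (by rw [abs_neg]; linarith) 2
  simp only [Finset.sum_range_succ, Finset.sum_range_zero, abs_neg, sub_neg_eq_add] at h
  have h1 : |t| ^ (2 + 1) / (1 - |t|) ≤ t ^ 2 / 4 := by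
    rw [div_le_iff₀ (by linarith), ← sq_abs t]
    nlinarith [abs_nonneg t, mul_nonneg (sq_nonneg |t|) (abs_nonneg t), sq_nonneg |t|]
  have h2 := (le_abs_self _).trans (h.trans h1)
  norm_num at h2
  linarith

theorem sub_sq_le_log_one_add {t : ℝ} (ht : |t| ≤ 1 / 8) : t - 2 * t ^ 2 ≤ Real.log (1 + t) := by
  have h := Real.abs_log_sub_add_sum_range_le (x := -t) (by rw [abs_neg]; linarith) 1
  simp only [Finset.sum_range_succ, Finset.sum_range_zero, abs_neg, sub_neg_eq_add] at h
  have h1 : |t| ^ (1 + 1) / (1 - |t|) ≤ 2 * t ^ 2 := by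
    rw [div_le_iff₀ (by linarith), ← sq_abs t, one_add_one_eq_two]
    nlinarith [sq_nonneg |t|, mul_nonneg (sq_nonneg |t|) (sub_nonneg.2 ht)]
  have h2 := (neg_le_of_abs_le (h.trans h1))
  norm_num at h2
  linarith

/-- A multiplier exists in a small ball if the sum of the estimating functions is small in
comparison with their second moments. -/
theorem exists_isMultiplier {k p r n : ℕ} {g : E k → E p → E r} {x : Fin n → E k} {θ : E p}
    {R κ : ℝ} (hR : 0 < R) (hmax : ∀ i, R * ‖g (x i) θ‖ ≤ 1 / 8)
    (hκ : ∀ u, κ * ‖u‖ ^ 2 ≤ ∑ i, ⟪u, g (x i) θ⟫_ℝ ^ 2)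
    (hsum : 4 * ‖∑ i, g (x i) θ‖ < κ * R) :
    ∃ l, ‖l‖ ≤ R ∧ IsMultiplier g x θ l := by
  have ht : ∀ l : E r, ‖l‖ ≤ R → ∀ i, |⟪l, g (x i) θ⟫_ℝ| ≤ 1 / 8 := fun l hl i =>
    (abs_real_inner_le_norm _ _).trans ((by gcongr : _ ≤ R * ‖g (x i) θ‖).trans (hmax i))
  have hpos : ∀ l : E r, ‖l‖ ≤ R → ∀ i, 0 < 1 + ⟪l, g (x i) θ⟫_ℝ := fun l hl i => by
    linarith [(abs_le.1 (ht l hl i)).1]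
  -- The multiplier equation says that the gradient of this dual function vanishes, so an interior
  -- maximum over the ball suffices.
  let f : E r → ℝ := fun l => ∑ i, Real.log (1 + ⟪l, g (x i) θ⟫_ℝ)
  have hf : ∀ l : E r, ‖l‖ ≤ R → HasFDerivAt f
      (∑ i, (1 + ⟪l, g (x i) θ⟫_ℝ)⁻¹ • innerSL ℝ (g (x i) θ)) l := by
    intro l hl
    refine HasFDerivAt.fun_sum fun i _ => HasFDerivAt.log ?_ (hpos l hl i).ne'
    have h1 : HasFDerivAt (fun l => ⟪g (x i) θ, l⟫_ℝ) (innerSL ℝ (g (x i) θ)) l :=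
      (innerSL ℝ (g (x i) θ)).hasFDerivAt
    simp_rw [real_inner_comm (g (x i) θ)] at h1 ⊢
    exact h1.const_add 1
  obtain ⟨l, hlR, hl⟩ := (isCompact_closedBall (0 : E r) R).exists_isMaxOn
    ⟨0, Metric.mem_closedBall_self hR.le⟩
    (f := f) fun l hl => ((hf l (by simpa using hl)).continuousAt).continuousWithinAt
  have hlR' : ‖l‖ ≤ R := by simpa using hlR
  -- On the sphere `f l ≤ R ‖∑ g‖ - κ R²/4`, which `hsum` makes negative, whereas `f 0 = 0`.
  have hlt : ‖l‖ < R := by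
    refine hlR'.lt_of_ne fun heq => ?_
    have h0 : f 0 ≤ f l := hl (Metric.mem_closedBall_self hR.le)
    have h1 : f l ≤ ⟪l, ∑ i, g (x i) θ⟫_ℝ - (∑ i, ⟪l, g (x i) θ⟫_ℝ ^ 2) / 4 := by
      rw [inner_sum, Finset.sum_div, ← Finset.sum_sub_distrib]
      exact Finset.sum_le_sum fun i _ => log_one_add_le (ht l hlR' i)
    have h2 : f 0 = 0 := by simp [f]
    have h3 := real_inner_le_norm l (∑ i, g (x i) θ)
    have h4 := hκ l
    rw [heq] at h3 h4
    nlinarith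
  refine ⟨l, hlR', hpos l hlR', ?_⟩
  have hloc : IsLocalMax f l := by
    have : Metric.closedBall (0 : E r) R ∈ 𝓝 l :=
      Filter.mem_of_superset (Metric.isOpen_ball.mem_nhds (by simpa using hlt))
        Metric.ball_subset_closedBall
    exact hl.isLocalMax this
  have hz := hloc.hasFDerivAt_eq_zero (hf l hlR')
  refine ext_inner_right ℝ fun u => ?_
  have := congrArg (fun T => T u) hz
  simpa [sum_inner, real_inner_smul_left] using this

/-! ### Sums of functions of order two over arrays of small numbers -/

/-- Uniform smallness of the entries gives `|ψ(tᵢ)| ≤ ε tᵢ²` for all `i` at once, and the sum of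
squares is bounded. Every remainder of a second order expansion is discarded this way. -/
theorem tendsto_sum_of_isLittleO {ι : Type*} {L : Filter ι} {n : ι → ℕ}
    {t : ∀ a, Fin (n a) → ℝ} {ψ : ℝ → ℝ} {C : ℝ}
    (hψ : ψ =o[𝓝 0] fun s => s ^ 2)
    (ht : ∀ ε > 0, ∀ᶠ a in L, ∀ i, |t a i| ≤ ε)
    (hC : ∀ᶠ a in L, ∑ i, t a i ^ 2 ≤ C) :
    Tendsto (fun a => ∑ i, ψ (t a i)) L (𝓝 0) := by
  rw [Metric.tendsto_nhds]
  intro ε hε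
  have hC' : 0 < |C| + 1 := by positivity
  have h1 := hψ.def (c := ε / 2 / (|C| + 1)) (by positivity)
  obtain ⟨δ, hδ, h2⟩ := Metric.eventually_nhds_iff.1 h1
  filter_upwards [ht (δ / 2) (by positivity), hC] with a ha hCa
  rw [Real.dist_eq, sub_zero]
  calc |∑ i, ψ (t a i)| ≤ ∑ i, |ψ (t a i)| := Finset.abs_sum_le_sum_abs _ _
    _ ≤ ∑ i, ε / 2 / (|C| + 1) * t a i ^ 2 := by
        refine Finset.sum_le_sum fun i _ => ?_
        have := h2 (y := t a i) (by rw [Real.dist_eq, sub_zero]; linarith [ha i])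
        simpa using this
    _ = ε / 2 / (|C| + 1) * ∑ i, t a i ^ 2 := by rw [Finset.mul_sum]
    _ ≤ ε / 2 / (|C| + 1) * (|C| + 1) := by
        gcongr
        linarith [le_abs_self C]
    _ = ε / 2 := by field_simp
    _ < ε := by linarith

/-- The term `t (1 + t)⁻¹` sums to zero at a multiplier, so it may be subtracted freely; it cancels
the linear term of the logarithm and turns `-t²/2` into `t²/2`. -/
theorem log_expansion_isLittleO :
    (fun t : ℝ => 2 * (Real.log (1 + t) - t * (1 + t)⁻¹) - t ^ 2) =o[𝓝 0] fun t => t ^ 2 := by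
  refine IsBigO.trans_isLittleO (g := fun t : ℝ => t ^ 3) ?_ ?_
  · refine IsBigO.of_bound 16 ?_
    have : ∀ᶠ t : ℝ in 𝓝 0, |t| < 1 / 2 := by
      have := Metric.ball_mem_nhds (0 : ℝ) (by norm_num : (0 : ℝ) < 1 / 2)
      filter_upwards [this] with t ht
      simpa using ht
    filter_upwards [this] with t ht
    have h := Real.abs_log_sub_add_sum_range_le (x := -t) (by rw [abs_neg]; linarith) 2
    simp only [Finset.sum_range_succ, Finset.sum_range_zero, abs_neg, sub_neg_eq_add] at h
    have h1 : |t| ^ (2 + 1) / (1 - |t|) ≤ 2 * |t| ^ 3 := by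
      rw [div_le_iff₀ (by linarith)]
      have : 0 ≤ |t| ^ 3 := by positivity
      norm_num
      nlinarith
    have hpos : 1 / 2 < 1 + t := by linarith [(abs_lt.1 ht).1]
    have h2 : t * (1 + t)⁻¹ = t - t ^ 2 + t ^ 3 * (1 + t)⁻¹ := by
      field_simp
      ring
    have h3 : |t ^ 3 * (1 + t)⁻¹| ≤ 2 * |t| ^ 3 := by
      rw [abs_mul, abs_pow, abs_of_pos (inv_pos.2 (by linarith : 0 < 1 + t)), mul_comm]
      have : (1 + t)⁻¹ ≤ 2 := by
        rw [inv_le_comm₀ (by linarith) (by norm_num)]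
        linarith
      gcongr
    have h4 := h.trans h1
    norm_num at h4
    rw [h2, Real.norm_eq_abs, Real.norm_eq_abs, abs_pow]
    have h5 : 2 * (Real.log (1 + t) - (t - t ^ 2 + t ^ 3 * (1 + t)⁻¹)) - t ^ 2
      = 2 * (-t + t ^ 2 / 2 + Real.log (1 + t)) - 2 * (t ^ 3 * (1 + t)⁻¹) := by ring
    rw [h5]
    obtain ⟨a1, a2⟩ := abs_le.1 h4
    obtain ⟨b1, b2⟩ := abs_le.1 h3
    have : 0 ≤ |t| ^ 3 := by positivity
    rw [abs_le]
    constructor <;> linarith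
  · exact isLittleO_pow_pow (by norm_num)

/-- The second order expansion of a function of class `Φ` at `1`. -/
theorem IsPhi.expansion_isLittleO {φ : ℝ → ℝ} (hφ : IsPhi φ) :
    (fun t : ℝ => φ (1 + t) - deriv (deriv φ) 1 / 2 * t ^ 2) =o[𝓝 0] fun t => t ^ 2 := by
  rw [isLittleO_iff]
  intro ε hε
  have h1 := hφ.differentiable_deriv.hasDerivAt.isLittleO.def hε
  obtain ⟨δ, hδ, h2⟩ := Metric.eventually_nhds_iff.1 (h1.and hφ.differentiable_near)
  filter_upwards [Metric.ball_mem_nhds (0 : ℝ) hδ] with t ht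
  have ht' : |t| < δ := by simpa using ht
  have hs : ∀ s ∈ Metric.closedBall (0 : ℝ) |t|, dist (1 + s) 1 < δ := fun s hs => by
    have : |s| ≤ |t| := by simpa using hs
    simpa [Real.dist_eq] using this.trans_lt ht'
  -- `φ` is twice differentiable only at `1`, so the mean value inequality replaces Taylor's
  -- formula: the derivative of the remainder is at most `ε |s| ≤ ε |t|` on the ball.
  have key := (convex_closedBall (0 : ℝ) |t|).norm_image_sub_le_of_norm_hasDerivWithin_le
    (f := fun s => φ (1 + s) - deriv (deriv φ) 1 / 2 * s ^ 2)
    (f' := fun s => deriv φ (1 + s) - deriv (deriv φ) 1 * s) (C := ε * |t|) (x := 0) (y := t)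
    (fun s hs' => by
      have hd := (h2 (hs s hs')).2.hasDerivAt
      have hd' : HasDerivAt (fun s => φ (1 + s)) (deriv φ (1 + s)) s := by
        simpa using hd.comp_const_add 1 s
      have hq : HasDerivAt (fun s : ℝ => deriv (deriv φ) 1 / 2 * s ^ 2)
          (deriv (deriv φ) 1 * s) s := by
        have := ((hasDerivAt_id s).pow 2).const_mul (deriv (deriv φ) 1 / 2)
        convert! this using 1
        simp
        ring
      exact (hd'.sub hq).hasDerivWithinAt)
    (fun s hs' => by
      have := (h2 (hs s hs')).1
      rw [hφ.deriv_one] at this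
      have hst : |s| ≤ |t| := by simpa using hs'
      simp only [add_sub_cancel_left, sub_zero, smul_eq_mul, Real.norm_eq_abs] at this ⊢
      rw [mul_comm]
      rw [mul_comm] at this
      calc _ ≤ ε * |s| := by convert! this using 2; ring
        _ ≤ _ := by gcongr)
    (by simp) (by simp)
  simp only [add_zero, hφ.map_one, sub_zero, Real.norm_eq_abs] at key
  simp only [Real.norm_eq_abs, abs_pow]
  calc _ ≤ ε * |t| * |t| := by simpa using key
    _ = _ := by ring

/-- This is the summand of the `φ`-statistic: `(1 + t)⁻¹` is `n` times the weight, and `1 + t` is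
the ratio of the uniform weight to it. -/
theorem IsPhi.stat_isLittleO {φ : ℝ → ℝ} (hφ : IsPhi φ) :
    (fun t : ℝ => 2 / deriv (deriv φ) 1 * ((1 + t)⁻¹ * φ (1 + t)) - t ^ 2) =o[𝓝 0]
      fun t => t ^ 2 := by
  have hd := hφ.deriv_deriv_pos
  have h1 : (fun t : ℝ => (1 + t)⁻¹) =O[𝓝 0] fun _ => (1 : ℝ) := by
    have : ContinuousAt (fun t : ℝ => (1 + t)⁻¹) 0 :=
      ContinuousAt.inv₀ (by fun_prop) (by norm_num)
    exact this.isBigO_one ℝ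
  have h2 := (h1.mul_isLittleO hφ.expansion_isLittleO).const_mul_left (2 / deriv (deriv φ) 1)
  have h3 : (fun t : ℝ => t ^ 2 * ((1 + t)⁻¹ - 1)) =o[𝓝 0] fun t : ℝ => t ^ 2 * 1 := by
    refine (isBigO_refl _ _).mul_isLittleO ((isLittleO_one_iff ℝ).2 ?_)
    have : ContinuousAt (fun t : ℝ => (1 + t)⁻¹ - 1) 0 :=
      (ContinuousAt.inv₀ (by fun_prop) (by norm_num)).sub continuousAt_const
    simpa [ContinuousAt] using this
  simp only [one_mul, mul_one] at h2 h3
  refine (h2.add h3).congr_left fun t => ?_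
  field_simp
  ring

/-! ### Regular arrays of observations -/

/-- The sample mean of the estimating functions. -/
def estMean {k p r n : ℕ} (g : E k → E p → E r) (x : Fin n → E k) (θ : E p) : E r :=
  (n : ℝ)⁻¹ • ∑ i, g (x i) θ

/-- The asymptotic behaviour, along a filter `L`, of an array of samples which is needed for the
analysis of the empirical likelihood near `θ₀`: laws of large numbers with limits `S` and `D` for
the second moments of the estimating functions and for their derivatives. The map `W` is a square
root of the inverse of `S`. -/
structure RegularArray {ι : Type*} (L : Filter ι) {n : ι → ℕ} {k p : ℕ}
    (x : ∀ a, Fin (n a) → E k) (g : E k → E p → E p) (θ₀ : E p) (S D W : E p →L[ℝ] E p)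
    (ρ K σ κ : ℝ) : Prop where
  tendsto_size : Tendsto n L atTop
  rho_pos : 0 < ρ
  K_pos : 0 < K
  sigma_pos : 0 < σ
  kappa_pos : 0 < κ
  -- On the whole ball the nonlinearity of the sample mean stays below the invertibility margin `κ`
  -- of `D`; existence of a root and the rate both need this.
  small : K * ρ ≤ κ / 4
  max_le : ∀ ε > 0, ∀ᶠ a in L, ∀ θ ∈ Metric.closedBall θ₀ ρ, ∀ i,
    ‖g (x a i) θ‖ ≤ ε * √(n a)
  sum_sq_le : ∀ᶠ a in L, ∀ θ ∈ Metric.closedBall θ₀ ρ, ∑ i, ‖g (x a i) θ‖ ^ 2 ≤ K * n a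
  sum_lip : ∀ᶠ a in L, ∀ θ ∈ Metric.closedBall θ₀ ρ,
    ∑ i, ‖g (x a i) θ - g (x a i) θ₀‖ ≤ K * n a * ‖θ - θ₀‖
  second_moment : ∀ ε > 0, ∀ᶠ a in L, ∀ u,
    ‖(n a : ℝ)⁻¹ • ∑ i, ⟪u, g (x a i) θ₀⟫_ℝ • g (x a i) θ₀ - S u‖ ≤ ε * ‖u‖
  -- The radius is free: `r = ρ` serves global estimates, while a shrinking `r` makes the
  -- linearization error negligible.
  approx : ∀ ε > 0, ∀ᶠ a in L, ∀ r ≤ ρ, ∀ θ ∈ Metric.closedBall θ₀ r,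
    ∀ θ' ∈ Metric.closedBall θ₀ r,
      ‖estMean g (x a) θ - estMean g (x a) θ' - D (θ - θ')‖ ≤ (ε + K * r) * ‖θ - θ'‖
  S_pos : ∀ u, σ * ‖u‖ ^ 2 ≤ ⟪u, S u⟫_ℝ
  D_inj : ∀ u, κ * ‖u‖ ≤ ‖D u‖
  W_sq : ∀ u, ‖W (S u)‖ ^ 2 = ⟪u, S u⟫_ℝ

theorem norm_sq_sub_norm_sq_le {V : Type*} [SeminormedAddCommGroup V] (a b : V) :
    |‖a‖ ^ 2 - ‖b‖ ^ 2| ≤ ‖a - b‖ * (‖a - b‖ + 2 * ‖b‖) := by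
  have h1 := abs_norm_sub_norm_le a b
  have h2 : ‖a‖ ≤ ‖a - b‖ + ‖b‖ := by simpa using norm_add_le (a - b) b
  rw [sq_sub_sq, abs_mul, abs_of_nonneg (by positivity), mul_comm]
  exact mul_le_mul h1 (by linarith) (by positivity) (by positivity)

theorem tendsto_norm_sq_sub {ι V : Type*} [SeminormedAddCommGroup V] {L : Filter ι} {u v : ι → V}
    {C : ℝ} (h : Tendsto (fun a => u a - v a) L (𝓝 0)) (hv : ∀ᶠ a in L, ‖v a‖ ≤ C) :
    Tendsto (fun a => ‖u a‖ ^ 2 - ‖v a‖ ^ 2) L (𝓝 0) := by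
  have h' : Tendsto (fun a => ‖u a - v a‖ * (‖u a - v a‖ + 2 * C)) L (𝓝 0) := by
    have := h.norm.mul (h.norm.add_const (2 * C))
    simpa using this
  refine squeeze_zero_norm' ?_ h'
  filter_upwards [hv] with a ha
  refine (norm_sq_sub_norm_sq_le _ _).trans ?_
  gcongr

namespace RegularArray

variable {ι : Type*} {L : Filter ι} {n : ι → ℕ} {k p : ℕ} {x : ∀ a, Fin (n a) → E k}
  {g : E k → E p → E p} {θ₀ : E p} {S D W : E p →L[ℝ] E p} {ρ K σ κ : ℝ}

/-- Needed to restrict to the events on which the rescaled sample mean at `θ₀` is bounded. -/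
theorem mono (h : RegularArray L x g θ₀ S D W ρ K σ κ) {L' : Filter ι} (hL : L' ≤ L) :
    RegularArray L' x g θ₀ S D W ρ K σ κ where
  tendsto_size := h.tendsto_size.mono_left hL
  rho_pos := h.rho_pos
  K_pos := h.K_pos
  sigma_pos := h.sigma_pos
  kappa_pos := h.kappa_pos
  small := h.small
  max_le ε hε := hL (h.max_le ε hε)
  sum_sq_le := hL h.sum_sq_le
  sum_lip := hL h.sum_lip
  second_moment ε hε := hL (h.second_moment ε hε)
  approx ε hε := hL (h.approx ε hε)
  S_pos := h.S_pos
  D_inj := h.D_inj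
  W_sq := h.W_sq

theorem eventually_pos (h : RegularArray L x g θ₀ S D W ρ K σ κ) : ∀ᶠ a in L, 0 < n a :=
  h.tendsto_size.eventually_gt_atTop 0

theorem tendsto_sqrt (h : RegularArray L x g θ₀ S D W ρ K σ κ) :
    Tendsto (fun a => √(n a : ℝ)) L atTop :=
  Real.tendsto_sqrt_atTop.comp (tendsto_natCast_atTop_atTop.comp h.tendsto_size)

theorem tendsto_of_sqrt_mul_le (h : RegularArray L x g θ₀ S D W ρ K σ κ) {θ : ι → E p} {M : ℝ}
    (hθ : ∀ᶠ a in L, √(n a : ℝ) * ‖θ a - θ₀‖ ≤ M) : Tendsto θ L (𝓝 θ₀) := by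
  rw [tendsto_iff_norm_sub_tendsto_zero]
  refine squeeze_zero' (Eventually.of_forall fun a => norm_nonneg _) ?_
    (h.tendsto_sqrt.const_div_atTop M)
  filter_upwards [hθ, h.tendsto_sqrt.eventually_gt_atTop 0] with a ha hpos
  rw [le_div_iff₀ hpos, mul_comm]
  exact ha

theorem eventually_mem_closedBall (h : RegularArray L x g θ₀ S D W ρ K σ κ) {θ : ι → E p} {M : ℝ}
    (hθ : ∀ᶠ a in L, √(n a : ℝ) * ‖θ a - θ₀‖ ≤ M) :
    ∀ᶠ a in L, θ a ∈ Metric.closedBall θ₀ ρ :=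
  (h.tendsto_of_sqrt_mul_le hθ).eventually (Metric.closedBall_mem_nhds θ₀ h.rho_pos)

/-- Linearization of the sample mean at rate `n^(-1/2)`. -/
theorem tendsto_linearization (h : RegularArray L x g θ₀ S D W ρ K σ κ) {θ : ι → E p} {M : ℝ}
    (hθ : ∀ᶠ a in L, √(n a : ℝ) * ‖θ a - θ₀‖ ≤ M) :
    Tendsto (fun a => √(n a : ℝ) • estMean g (x a) (θ a)
      - (√(n a : ℝ) • estMean g (x a) θ₀ + D (√(n a : ℝ) • (θ a - θ₀)))) L (𝓝 0) := by
  rw [Metric.tendsto_nhds]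
  intro ε hε
  have hM : 0 < |M| + 1 := by positivity
  have hev : ∀ᶠ a in L, ‖θ a - θ₀‖ < ε / 4 / (|M| + 1) / K := by
    have := tendsto_iff_norm_sub_tendsto_zero.1 (h.tendsto_of_sqrt_mul_le hθ)
    have hK := h.K_pos
    exact this.eventually_lt_const (by positivity)
  filter_upwards [hθ, h.eventually_mem_closedBall hθ, h.approx (ε / 4 / (|M| + 1)) (by positivity),
    hev] with a h1 h2 h3 h4
  have h5 := h3 ‖θ a - θ₀‖ (by simpa [dist_eq_norm] using h2) (θ a)
    (by simp [dist_eq_norm]) θ₀ (by simp)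
  rw [dist_zero_right]
  have h6 : √(n a : ℝ) • estMean g (x a) (θ a)
      - (√(n a : ℝ) • estMean g (x a) θ₀ + D (√(n a : ℝ) • (θ a - θ₀)))
      = √(n a : ℝ) • (estMean g (x a) (θ a) - estMean g (x a) θ₀ - D (θ a - θ₀)) := by
    rw [map_smul]; module
  rw [h6, norm_smul, Real.norm_of_nonneg (Real.sqrt_nonneg _)]
  have hK := h.K_pos
  rw [lt_div_iff₀ hK] at h4
  calc _ ≤ √(n a : ℝ) * ((ε / 4 / (|M| + 1) + K * ‖θ a - θ₀‖) * ‖θ a - θ₀‖) := by gcongr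
    _ = (ε / 4 / (|M| + 1) + K * ‖θ a - θ₀‖) * (√(n a : ℝ) * ‖θ a - θ₀‖) := by ring
    _ ≤ (ε / 4 / (|M| + 1) + ε / 4 / (|M| + 1)) * (|M| + 1) := by
        gcongr
        · linarith
        · linarith [le_abs_self M]
    _ = ε / 2 := by field_simp; ring
    _ < ε := by linarith

theorem exists_bound_estMean (h : RegularArray L x g θ₀ S D W ρ K σ κ) {θ : ι → E p} {M M' : ℝ}
    (hZ : ∀ᶠ a in L, √(n a : ℝ) * ‖estMean g (x a) θ₀‖ ≤ M)
    (hθ : ∀ᶠ a in L, √(n a : ℝ) * ‖θ a - θ₀‖ ≤ M') :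
    ∃ C, 0 ≤ C ∧ ∀ᶠ a in L, √(n a : ℝ) * ‖estMean g (x a) (θ a)‖ ≤ C := by
  refine ⟨1 + |M| + ‖D‖ * |M'|, by positivity, ?_⟩
  filter_upwards [hZ, hθ, (h.tendsto_linearization hθ).norm.eventually_lt_const
    (by simp : ‖(0 : E p)‖ < 1)] with a h1 h2 h3
  have hs : ∀ v : E p, ‖√(n a : ℝ) • v‖ = √(n a : ℝ) * ‖v‖ := fun v => by
    rw [norm_smul, Real.norm_of_nonneg (Real.sqrt_nonneg _)]
  have h4 := norm_add_le (√(n a : ℝ) • estMean g (x a) (θ a)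
      - (√(n a : ℝ) • estMean g (x a) θ₀ + D (√(n a : ℝ) • (θ a - θ₀))))
      (√(n a : ℝ) • estMean g (x a) θ₀ + D (√(n a : ℝ) • (θ a - θ₀)))
  rw [sub_add_cancel, hs] at h4
  have h5 := norm_add_le (√(n a : ℝ) • estMean g (x a) θ₀) (D (√(n a : ℝ) • (θ a - θ₀)))
  have h6 := D.le_opNorm (√(n a : ℝ) • (θ a - θ₀))
  rw [hs] at h5 h6
  have h7 : ‖D‖ * (√(n a : ℝ) * ‖θ a - θ₀‖) ≤ ‖D‖ * |M'| := by
    gcongr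
    exact h2.trans (le_abs_self _)
  linarith [le_abs_self M]

/-- The second moments at parameter values which approach `θ₀` at rate `n^(-1/2)`. -/
theorem second_moment_of_rate (h : RegularArray L x g θ₀ S D W ρ K σ κ) {θ : ι → E p} {M : ℝ}
    (hθ : ∀ᶠ a in L, √(n a : ℝ) * ‖θ a - θ₀‖ ≤ M) {ε : ℝ} (hε : 0 < ε) :
    ∀ᶠ a in L, ∀ u,
      ‖(n a : ℝ)⁻¹ • ∑ i, ⟪u, g (x a i) (θ a)⟫_ℝ • g (x a i) (θ a) - S u‖ ≤ ε * ‖u‖ := by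
  have hK := h.K_pos
  have hM : 0 < |M| + 1 := by positivity
  set δ := ε / 4 / (K * (|M| + 1)) with hδ
  filter_upwards [hθ, h.eventually_mem_closedBall hθ, h.second_moment (ε / 2) (by positivity),
    h.max_le δ (by positivity), h.sum_lip, h.eventually_pos] with a h1 h2 h3 h4 h5 hn u
  have hθ₀ : θ₀ ∈ Metric.closedBall θ₀ ρ := Metric.mem_closedBall_self h.rho_pos.le
  have hn' : (0 : ℝ) < n a := by exact_mod_cast hn
  -- The factors `g` are at most `δ √n`, and the increments of `g` sum to at most `K n ‖θ - θ₀‖ ≤ K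
  -- M √n`, so the total is a small multiple of `n`.
  have h6 : ‖∑ i, ⟪u, g (x a i) (θ a)⟫_ℝ • g (x a i) (θ a)
      - ∑ i, ⟪u, g (x a i) θ₀⟫_ℝ • g (x a i) θ₀‖ ≤ n a * (ε / 2 * ‖u‖) := by
    rw [← Finset.sum_sub_distrib]
    calc _ ≤ ∑ i, ‖⟪u, g (x a i) (θ a)⟫_ℝ • g (x a i) (θ a)
              - ⟪u, g (x a i) θ₀⟫_ℝ • g (x a i) θ₀‖ := norm_sum_le _ _
      _ ≤ ∑ i, 2 * δ * √(n a : ℝ) * ‖u‖ * ‖g (x a i) (θ a) - g (x a i) θ₀‖ := by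
          refine Finset.sum_le_sum fun i _ => ?_
          have e : ⟪u, g (x a i) (θ a)⟫_ℝ • g (x a i) (θ a) - ⟪u, g (x a i) θ₀⟫_ℝ • g (x a i) θ₀
              = ⟪u, g (x a i) (θ a) - g (x a i) θ₀⟫_ℝ • g (x a i) (θ a)
                + ⟪u, g (x a i) θ₀⟫_ℝ • (g (x a i) (θ a) - g (x a i) θ₀) := by
            rw [inner_sub_right]; module
          rw [e]
          refine (norm_add_le _ _).trans ?_
          rw [norm_smul, norm_smul]
          have e1 := norm_inner_le_norm (𝕜 := ℝ) u (g (x a i) (θ a) - g (x a i) θ₀)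
          have e2 := norm_inner_le_norm (𝕜 := ℝ) u (g (x a i) θ₀)
          have e3 := h4 _ h2 i
          have e4 := h4 _ hθ₀ i
          calc _ ≤ ‖u‖ * ‖g (x a i) (θ a) - g (x a i) θ₀‖ * (δ * √(n a : ℝ))
                + ‖u‖ * (δ * √(n a : ℝ)) * ‖g (x a i) (θ a) - g (x a i) θ₀‖ := by
                  gcongr
                  exact e2.trans (by gcongr)
            _ = _ := by ring
      _ = 2 * δ * √(n a : ℝ) * ‖u‖ * ∑ i, ‖g (x a i) (θ a) - g (x a i) θ₀‖ := by
          rw [Finset.mul_sum]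
      _ ≤ 2 * δ * √(n a : ℝ) * ‖u‖ * (K * n a * ‖θ a - θ₀‖) := by
          gcongr
          exact h5 _ h2
      _ = 2 * δ * ‖u‖ * (K * n a) * (√(n a : ℝ) * ‖θ a - θ₀‖) := by ring
      _ ≤ 2 * δ * ‖u‖ * (K * n a) * (|M| + 1) := by
          gcongr
          linarith [le_abs_self M]
      _ = n a * (ε / 2 * ‖u‖) := by
          rw [hδ]; field_simp; ring
  have h7 : (n a : ℝ)⁻¹ • ∑ i, ⟪u, g (x a i) (θ a)⟫_ℝ • g (x a i) (θ a) - S u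
      = (n a : ℝ)⁻¹ • (∑ i, ⟪u, g (x a i) (θ a)⟫_ℝ • g (x a i) (θ a)
        - ∑ i, ⟪u, g (x a i) θ₀⟫_ℝ • g (x a i) θ₀)
        + ((n a : ℝ)⁻¹ • ∑ i, ⟪u, g (x a i) θ₀⟫_ℝ • g (x a i) θ₀ - S u) := by module
  rw [h7]
  refine (norm_add_le _ _).trans ?_
  rw [norm_smul, Real.norm_of_nonneg (by positivity)]
  calc _ ≤ (n a : ℝ)⁻¹ * (n a * (ε / 2 * ‖u‖)) + ε / 2 * ‖u‖ := by
        gcongr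
        exact h3 u
    _ = ε * ‖u‖ := by field_simp; ring

/-- The multipliers at parameter values which approach `θ₀` at rate `n^(-1/2)`, and the
quadratic approximation of the sum of squares they generate. -/
theorem exists_multiplier (h : RegularArray L x g θ₀ S D W ρ K σ κ) {θ : ι → E p} {M M' : ℝ}
    (hZ : ∀ᶠ a in L, √(n a : ℝ) * ‖estMean g (x a) θ₀‖ ≤ M)
    (hθ : ∀ᶠ a in L, √(n a : ℝ) * ‖θ a - θ₀‖ ≤ M') :
    ∃ l : ι → E p, (∀ᶠ a in L, IsMultiplier g (x a) (θ a) (l a)) ∧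
      (∀ ε > 0, ∀ᶠ a in L, ∀ i, |⟪l a, g (x a i) (θ a)⟫_ℝ| ≤ ε) ∧
      (∃ C, ∀ᶠ a in L, ∑ i, ⟪l a, g (x a i) (θ a)⟫_ℝ ^ 2 ≤ C) ∧
      Tendsto (fun a => ∑ i, ⟪l a, g (x a i) (θ a)⟫_ℝ ^ 2
        - ‖W (√(n a : ℝ) • estMean g (x a) (θ a))‖ ^ 2) L (𝓝 0) := by
  obtain ⟨M₁, hM₁, hm⟩ := h.exists_bound_estMean hZ hθ
  have hσ := h.sigma_pos
  have hK := h.K_pos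
  -- The multiplier is sought in the ball of radius `C/√n`, with half of `σ` given up to the sample
  -- second moments. The smallness condition then reads `8 M₁ < σ C`; the summand `1` makes it
  -- strict.
  set C := 8 * M₁ / σ + 1 with hCdef
  have hC : 0 < C := by positivity
  have hball := h.eventually_mem_closedBall hθ
  have hex : ∀ᶠ a in L, ∃ l, √(n a : ℝ) * ‖l‖ ≤ C ∧ IsMultiplier g (x a) (θ a) l := by
    filter_upwards [hm, hball, h.eventually_pos, h.max_le (1 / (8 * C)) (by positivity),
      h.second_moment_of_rate hθ (half_pos hσ)] with a h1 h2 hn h3 h4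
    have hn' : (0 : ℝ) < n a := by exact_mod_cast hn
    have hs : 0 < √(n a : ℝ) := Real.sqrt_pos.2 hn'
    have hss : √(n a : ℝ) * √(n a : ℝ) = n a := Real.mul_self_sqrt hn'.le
    obtain ⟨l, hl, hl'⟩ := exists_isMultiplier (g := g) (x := x a) (θ := θ a)
      (R := C / √(n a : ℝ)) (κ := σ / 2 * n a) (by positivity)
      (fun i => by
        calc C / √(n a : ℝ) * ‖g (x a i) (θ a)‖
            ≤ C / √(n a : ℝ) * (1 / (8 * C) * √(n a : ℝ)) := by
              gcongr
              exact h3 _ h2 i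
          _ = 1 / 8 := by field_simp)
      (fun u => by
        have e1 : ∑ i, ⟪u, g (x a i) (θ a)⟫_ℝ ^ 2 = n a * ⟪u, (n a : ℝ)⁻¹ •
            ∑ i, ⟪u, g (x a i) (θ a)⟫_ℝ • g (x a i) (θ a)⟫_ℝ := by
          rw [real_inner_smul_right, inner_sum, ← mul_assoc, mul_inv_cancel₀ hn'.ne', one_mul]
          exact Finset.sum_congr rfl fun i _ => by rw [real_inner_smul_right, sq]
        have e2 := h4 u
        have e3 := h.S_pos u
        have e4 := real_inner_le_norm u (-((n a : ℝ)⁻¹ •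
            ∑ i, ⟪u, g (x a i) (θ a)⟫_ℝ • g (x a i) (θ a) - S u))
        rw [norm_neg, inner_neg_right, inner_sub_right] at e4
        have e5 : ‖u‖ * ‖(n a : ℝ)⁻¹ • ∑ i, ⟪u, g (x a i) (θ a)⟫_ℝ • g (x a i) (θ a) - S u‖
            ≤ ‖u‖ * (σ / 2 * ‖u‖) := by gcongr
        rw [e1]
        have e6 : σ / 2 * ‖u‖ ^ 2 ≤ ⟪u, (n a : ℝ)⁻¹ •
            ∑ i, ⟪u, g (x a i) (θ a)⟫_ℝ • g (x a i) (θ a)⟫_ℝ := by nlinarith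
        calc _ = n a * (σ / 2 * ‖u‖ ^ 2) := by ring
          _ ≤ _ := by gcongr)
      (by
        have e1 : ‖∑ i, g (x a i) (θ a)‖ = √(n a : ℝ) * (√(n a : ℝ) * ‖estMean g (x a) (θ a)‖) := by
          rw [estMean, norm_smul, norm_inv, Real.norm_of_nonneg hn'.le, ← mul_assoc, hss,
            ← mul_assoc, mul_inv_cancel₀ hn'.ne', one_mul]
        rw [e1]
        have e2 : σ / 2 * n a * (C / √(n a : ℝ)) = √(n a : ℝ) * (σ * C / 2) := by
          calc _ = σ / 2 * (√(n a : ℝ) * √(n a : ℝ)) * (C / √(n a : ℝ)) := by rw [hss]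
            _ = _ := by field_simp
        rw [e2]
        have e3 : 8 * M₁ < σ * C := by
          rw [hCdef, mul_add, mul_div_cancel₀ _ hσ.ne']
          linarith
        nlinarith)
    refine ⟨l, ?_, hl'⟩
    rw [le_div_iff₀ hs] at hl
    linarith
  obtain ⟨l, hl⟩ : ∃ l : ι → E p, ∀ᶠ a in L, √(n a : ℝ) * ‖l a‖ ≤ C ∧
      IsMultiplier g (x a) (θ a) (l a) := by
    refine ⟨fun a => Classical.epsilon fun l => √(n a : ℝ) * ‖l‖ ≤ C ∧
      IsMultiplier g (x a) (θ a) l, ?_⟩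
    filter_upwards [hex] with a ha
    exact Classical.epsilon_spec ha
  have hmax : ∀ ε > 0, ∀ᶠ a in L, ∀ i, |⟪l a, g (x a i) (θ a)⟫_ℝ| ≤ ε := by
    intro ε hε
    filter_upwards [hl, hball, h.max_le (ε / C) (by positivity)] with a h1 h2 h3 i
    calc |⟪l a, g (x a i) (θ a)⟫_ℝ| ≤ ‖l a‖ * ‖g (x a i) (θ a)‖ := abs_real_inner_le_norm _ _
      _ ≤ ‖l a‖ * (ε / C * √(n a : ℝ)) := by
          gcongr
          exact h3 _ h2 i
      _ = ε / C * (√(n a : ℝ) * ‖l a‖) := by ring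
      _ ≤ ε / C * C := by
          gcongr
          exact h1.1
      _ = ε := by field_simp
  have hsq : ∀ᶠ a in L, ∑ i, ⟪l a, g (x a i) (θ a)⟫_ℝ ^ 2 ≤ C ^ 2 * K := by
    filter_upwards [hl, hball, h.sum_sq_le] with a h1 h2 h3
    calc ∑ i, ⟪l a, g (x a i) (θ a)⟫_ℝ ^ 2
        ≤ ∑ i, ‖l a‖ ^ 2 * ‖g (x a i) (θ a)‖ ^ 2 := by
          refine Finset.sum_le_sum fun i _ => ?_
          rw [← sq_abs, ← mul_pow]
          gcongr
          exact abs_real_inner_le_norm _ _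
      _ = ‖l a‖ ^ 2 * ∑ i, ‖g (x a i) (θ a)‖ ^ 2 := by rw [Finset.mul_sum]
      _ ≤ ‖l a‖ ^ 2 * (K * (√(n a : ℝ)) ^ 2) := by
          rw [Real.sq_sqrt (Nat.cast_nonneg _)]
          gcongr
          exact h3 _ h2
      _ = (√(n a : ℝ) * ‖l a‖) ^ 2 * K := by ring
      _ ≤ C ^ 2 * K := by
          gcongr
          exact h1.1
  refine ⟨l, hl.mono fun a ha => ha.2, hmax, ⟨_, hsq⟩, ?_⟩
  -- Insert `1/(1 + t) = 1 - t + t²/(1 + t)` into the multiplier equation: `∑ g` equals `∑ t g` up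
  -- to `2 max ‖g‖ ∑ t² = o(√n)`. Thus `l` is to first order `S⁻¹ ḡ`.
  have hdiff : Tendsto (fun a => √(n a : ℝ) • estMean g (x a) (θ a) - S (√(n a : ℝ) • l a)) L
      (𝓝 0) := by
    rw [Metric.tendsto_nhds]
    intro ε hε
    filter_upwards [hl, hball, h.eventually_pos, hmax (1 / 2) (by norm_num), hsq,
      h.second_moment_of_rate hθ (ε := ε / (4 * C)) (by positivity),
      h.max_le (ε / (8 * (C ^ 2 * K))) (by positivity)] with a h1 h2 hn h3 h4 h5 h6
    have hn' : (0 : ℝ) < n a := by exact_mod_cast hn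
    have hss : √(n a : ℝ) * √(n a : ℝ) = n a := Real.mul_self_sqrt hn'.le
    set t : Fin (n a) → ℝ := fun i => ⟪l a, g (x a i) (θ a)⟫_ℝ with ht
    have e1 : ∑ i, g (x a i) (θ a) - ∑ i, t i • g (x a i) (θ a)
        = - ∑ i, (t i ^ 2 * (1 + t i)⁻¹) • g (x a i) (θ a) := by
      have := h1.2.2
      rw [← Finset.sum_sub_distrib, eq_neg_iff_add_eq_zero, ← Finset.sum_add_distrib, ← this]
      refine Finset.sum_congr rfl fun i _ => ?_
      have hpos : (1 + t i) ≠ 0 := (h1.2.1 i).ne'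
      have : (1 + t i)⁻¹ = 1 - t i + t i ^ 2 * (1 + t i)⁻¹ := by
        field_simp; ring
      change _ = (1 + t i)⁻¹ • g (x a i) (θ a)
      conv_rhs => rw [this]
      module
    have e2 : ‖∑ i, (t i ^ 2 * (1 + t i)⁻¹) • g (x a i) (θ a)‖ ≤ ε / 4 * √(n a : ℝ) := by
      calc _ ≤ ∑ i, ‖(t i ^ 2 * (1 + t i)⁻¹) • g (x a i) (θ a)‖ := norm_sum_le _ _
        _ ≤ ∑ i, t i ^ 2 * (2 * (ε / (8 * (C ^ 2 * K)) * √(n a : ℝ))) := by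
            refine Finset.sum_le_sum fun i _ => ?_
            have hpos : 1 / 2 ≤ 1 + t i := by linarith [(abs_le.1 (h3 i)).1]
            have : (1 + t i)⁻¹ ≤ 2 := by
              rw [inv_le_comm₀ (by linarith) (by norm_num)]
              linarith
            rw [norm_smul, norm_mul, Real.norm_of_nonneg (sq_nonneg _),
              Real.norm_of_nonneg (inv_nonneg.2 (by linarith)), mul_assoc]
            gcongr
            exact h6 _ h2 i
        _ = (∑ i, t i ^ 2) * (2 * (ε / (8 * (C ^ 2 * K)) * √(n a : ℝ))) := by
            rw [Finset.sum_mul]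
        _ ≤ C ^ 2 * K * (2 * (ε / (8 * (C ^ 2 * K)) * √(n a : ℝ))) := by gcongr
        _ = ε / 4 * √(n a : ℝ) := by field_simp; ring
    have e3 : √(n a : ℝ) • estMean g (x a) (θ a) - S (√(n a : ℝ) • l a)
        = √(n a : ℝ) • ((n a : ℝ)⁻¹ • ∑ i, t i • g (x a i) (θ a) - S (l a))
          + (√(n a : ℝ) * (n a : ℝ)⁻¹) •
            (∑ i, g (x a i) (θ a) - ∑ i, t i • g (x a i) (θ a)) := by
      rw [estMean, map_smul]; module
    rw [dist_zero_right, e3, e1]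
    refine (norm_add_le _ _).trans_lt ?_
    rw [norm_smul, norm_smul, norm_neg, Real.norm_of_nonneg (Real.sqrt_nonneg _),
      Real.norm_of_nonneg (by positivity)]
    calc _ ≤ √(n a : ℝ) * (ε / (4 * C) * ‖l a‖)
          + √(n a : ℝ) * (n a : ℝ)⁻¹ * (ε / 4 * √(n a : ℝ)) := by
            gcongr
            exact h5 _
      _ = ε / (4 * C) * (√(n a : ℝ) * ‖l a‖)
          + ε / 4 * ((√(n a : ℝ) * √(n a : ℝ)) * (n a : ℝ)⁻¹) := by ring
      _ ≤ ε / (4 * C) * C + ε / 4 * 1 := by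
          gcongr
          · exact h1.1
          · rw [hss, mul_inv_cancel₀ hn'.ne']
      _ = ε / 2 := by field_simp; ring
      _ < ε := by linarith
  -- Both quantities are compared with `‖W S (√n l)‖² = n ⟪l, S l⟫`: the quadratic form by `hdiff`,
  -- the sum of squares by the law of large numbers for second moments.
  have hWd : Tendsto (fun a => ‖W (√(n a : ℝ) • estMean g (x a) (θ a))‖ ^ 2
      - ‖W (S (√(n a : ℝ) • l a))‖ ^ 2) L (𝓝 0) := by
    refine tendsto_norm_sq_sub (C := ‖W‖ * (‖S‖ * C)) ?_ ?_
    · have := (W.continuous.tendsto 0).comp hdiff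
      simpa [Function.comp_def] using this
    · filter_upwards [hl] with a ha
      refine (W.le_opNorm _).trans ?_
      gcongr
      refine (S.le_opNorm _).trans ?_
      gcongr
      rw [norm_smul, Real.norm_of_nonneg (Real.sqrt_nonneg _)]
      exact ha.1
  have hquad : Tendsto (fun a => ∑ i, ⟪l a, g (x a i) (θ a)⟫_ℝ ^ 2
      - ‖W (S (√(n a : ℝ) • l a))‖ ^ 2) L (𝓝 0) := by
    rw [Metric.tendsto_nhds]
    intro ε hε
    filter_upwards [hl, h.eventually_pos,
      h.second_moment_of_rate hθ (ε := ε / (2 * C ^ 2)) (by positivity)] with a h1 hn h5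
    have hn' : (0 : ℝ) < n a := by exact_mod_cast hn
    have hss : √(n a : ℝ) * √(n a : ℝ) = n a := Real.mul_self_sqrt hn'.le
    have e1 : ∑ i, ⟪l a, g (x a i) (θ a)⟫_ℝ ^ 2 - ‖W (S (√(n a : ℝ) • l a))‖ ^ 2
        = n a * ⟪l a, (n a : ℝ)⁻¹ • ∑ i, ⟪l a, g (x a i) (θ a)⟫_ℝ • g (x a i) (θ a)
          - S (l a)⟫_ℝ := by
      rw [h.W_sq, map_smul, inner_sub_right, real_inner_smul_left, real_inner_smul_right,
        real_inner_smul_right, inner_sum, ← mul_assoc, hss, mul_sub, ← mul_assoc,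
        mul_inv_cancel₀ hn'.ne', one_mul]
      congr 1
      exact Finset.sum_congr rfl fun i _ => by rw [real_inner_smul_right, sq]
    rw [dist_zero_right, e1, norm_mul, Real.norm_of_nonneg hn'.le]
    calc _ ≤ n a * (‖l a‖ * (ε / (2 * C ^ 2) * ‖l a‖)) := by
          gcongr
          exact (norm_inner_le_norm _ _).trans (by gcongr; exact h5 _)
      _ = (√(n a : ℝ) * √(n a : ℝ)) * (‖l a‖ * (ε / (2 * C ^ 2) * ‖l a‖)) := by rw [hss]
      _ = ε / (2 * C ^ 2) * (√(n a : ℝ) * ‖l a‖) ^ 2 := by ring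
      _ ≤ ε / (2 * C ^ 2) * C ^ 2 := by
          gcongr
          exact h1.1
      _ = ε / 2 := by field_simp
      _ < ε := by linarith
  have := hquad.sub hWd
  simpa using this

/-- The `φ`-divergence statistic of the weights at `θ` with respect to the uniform weights. -/
theorem tendsto_logRatio_and_phiDiv (h : RegularArray L x g θ₀ S D W ρ K σ κ) {φ : ℝ → ℝ}
    (hφ : IsPhi φ) {θ : ι → E p} {M M' : ℝ}
    (hZ : ∀ᶠ a in L, √(n a : ℝ) * ‖estMean g (x a) θ₀‖ ≤ M)
    (hθ : ∀ᶠ a in L, √(n a : ℝ) * ‖θ a - θ₀‖ ≤ M') :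
    (∀ᶠ a in L, 0 < empLik g (x a) (θ a)) ∧
    Tendsto (fun a => 2 * logRatio g (x a) (θ a)
      - ‖W (√(n a : ℝ) • estMean g (x a) (θ a))‖ ^ 2) L (𝓝 0) ∧
    Tendsto (fun a => 2 * (n a : ℝ) / deriv (deriv φ) 1 *
        phiDiv φ (uniformWeights (n a)) (elWeights g (x a) (θ a))
      - ‖W (√(n a : ℝ) • estMean g (x a) (θ a))‖ ^ 2) L (𝓝 0) := by
  obtain ⟨l, hl, hmax, ⟨C, hC⟩, hq⟩ := h.exists_multiplier hZ hθ
  refine ⟨?_, ?_, ?_⟩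
  · filter_upwards [hl, h.eventually_pos] with a ha hn using ha.empLik_pos hn
  · have h1 := tendsto_sum_of_isLittleO log_expansion_isLittleO hmax hC
    have h2 := h1.add hq
    rw [add_zero] at h2
    refine h2.congr' ?_
    filter_upwards [hl, h.eventually_pos] with a ha hn
    have h3 : ∑ i, ⟪l a, g (x a i) (θ a)⟫_ℝ * (1 + ⟪l a, g (x a i) (θ a)⟫_ℝ)⁻¹ = 0 := by
      have := congrArg (fun z => ⟪l a, z⟫_ℝ) ha.2
      simpa [inner_sum, real_inner_smul_right, mul_comm] using this
    rw [ha.logRatio_eq hn]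
    simp only [mul_sub, Finset.sum_sub_distrib, ← Finset.mul_sum, h3]
    ring
  · have h1 := tendsto_sum_of_isLittleO hφ.stat_isLittleO hmax hC
    have h2 := h1.add hq
    rw [add_zero] at h2
    refine h2.congr' ?_
    filter_upwards [hl, h.eventually_pos] with a ha hn
    have hn' : (n a : ℝ) ≠ 0 := by positivity
    have h3 : phiDiv φ (uniformWeights (n a)) (elWeights g (x a) (θ a))
        = (n a : ℝ)⁻¹ * ∑ i, (1 + ⟪l a, g (x a i) (θ a)⟫_ℝ)⁻¹
          * φ (1 + ⟪l a, g (x a i) (θ a)⟫_ℝ) := by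
      rw [phiDiv, ha.elWeights_eq hn, Finset.mul_sum]
      refine Finset.sum_congr rfl fun i _ => ?_
      rw [uniformWeights, div_inv_eq_mul, ← mul_assoc, one_div, inv_mul_cancel₀ hn', one_mul]
      simp only [mul_inv]
      ring
    rw [h3]
    simp only [Finset.sum_sub_distrib, ← Finset.mul_sum]
    field_simp
    ring

end RegularArray

/-! ### The constrained estimate -/

/-- The implicit function theorem: the constraint set is parametrized near `θ₀` by its tangent
space, with the inclusion as derivative. This supplies the competitors for the restricted estimate.
-/
theorem exists_tangent_curve {p q : ℕ} {c : E p → E q} {C₀ : E p →L[ℝ] E q} {θ₀ : E p}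
    (hc : HasStrictFDerivAt c C₀ θ₀) (hsurj : C₀.range = ⊤) (h0 : c θ₀ = 0) :
    ∃ γ : C₀.ker → E p, γ 0 = θ₀ ∧ HasFDerivAt γ C₀.ker.subtypeL 0 ∧
      ∀ᶠ v in 𝓝 0, c (γ v) = 0 := by
  refine ⟨hc.implicitFunction c C₀ hsurj (c θ₀), hc.implicitFunction_apply_image hsurj,
    (hc.to_implicitFunction hsurj).hasFDerivAt, ?_⟩
  have h1 := hc.map_implicitFunction_eq hsurj
  have h2 : Tendsto (fun v : C₀.ker => (c θ₀, v)) (𝓝 0) (𝓝 (c θ₀, 0)) :=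
    (by fun_prop : Continuous fun v : C₀.ker => (c θ₀, v)).tendsto 0
  filter_upwards [h2.eventually h1] with v hv
  rw [← h0]
  exact hv

theorem tendsto_smul_of_isLittleO {ι V V' : Type*} [NormedAddCommGroup V]
    [NormedAddCommGroup V'] [NormedSpace ℝ V'] {L : Filter ι} {s : ι → ℝ} {y : ι → V} {y₀ : V}
    {f : V → V'} {M : ℝ} (hs : ∀ a, 0 ≤ s a) (hf : f =o[𝓝 y₀] fun z => z - y₀)
    (hy : Tendsto y L (𝓝 y₀)) (hM : ∀ᶠ a in L, s a * ‖y a - y₀‖ ≤ M) :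
    Tendsto (fun a => s a • f (y a)) L (𝓝 0) := by
  rw [Metric.tendsto_nhds]
  intro ε hε
  have hM' : 0 < |M| + 1 := by positivity
  filter_upwards [hM, hy.eventually (hf.def (c := ε / 2 / (|M| + 1)) (by positivity))] with a h1 h2
  rw [dist_zero_right, norm_smul, Real.norm_of_nonneg (hs a)]
  calc _ ≤ s a * (ε / 2 / (|M| + 1) * ‖y a - y₀‖) := mul_le_mul_of_nonneg_left h2 (hs a)
    _ = ε / 2 / (|M| + 1) * (s a * ‖y a - y₀‖) := by ring
    _ ≤ ε / 2 / (|M| + 1) * (|M| + 1) := by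
        gcongr
        linarith [le_abs_self M]
    _ = ε / 2 := by field_simp
    _ < ε := by linarith

/-! ### Roots, rates and the restricted statistic along a regular array -/

namespace RegularArray

variable {ι : Type*} {L : Filter ι} {n : ι → ℕ} {k p q : ℕ} {x : ∀ a, Fin (n a) → E k}
  {g : E k → E p → E p} {θ₀ : E p} {S D W : E p →L[ℝ] E p} {ρ K σ κ : ℝ}

/-- The estimating equations have a root near `θ₀`. -/
theorem eventually_exists_root (h : RegularArray L x g θ₀ S D W ρ K σ κ) {M : ℝ}
    (hZ : ∀ᶠ a in L, √(n a : ℝ) * ‖estMean g (x a) θ₀‖ ≤ M) {Θ : Set (E p)} (hΘ : Θ ∈ 𝓝 θ₀) :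
    ∀ᶠ a in L, ∃ θ ∈ Θ, ∑ i, g (x a i) θ = 0 := by
  have hκ := h.kappa_pos
  have hK := h.K_pos
  obtain ⟨r₀, hr₀, hr₀Θ⟩ := Metric.nhds_basis_closedBall.mem_iff.1 hΘ
  set r := min r₀ ρ with hr
  have hrpos : 0 < r := lt_min hr₀ h.rho_pos
  have hinj : Function.Injective D := by
    refine (injective_iff_map_eq_zero D).2 fun u hu => ?_
    have := h.D_inj u
    rw [hu, norm_zero] at this
    exact norm_eq_zero.1 (le_antisymm (by nlinarith [norm_nonneg u]) (norm_nonneg u))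
  -- Here it matters that there are as many equations as parameters: an injective `D` is invertible,
  -- with inverse bounded by `κ⁻¹`.
  let e : E p ≃ₗ[ℝ] E p := LinearEquiv.ofInjectiveEndo (D : E p →ₗ[ℝ] E p) hinj
  have he : ∀ v, D (e.symm v) = v := fun v => e.apply_symm_apply v
  let Dinv : D.NonlinearRightInverse :=
    { toFun := e.symm
      nnnorm := ⟨κ⁻¹, by positivity⟩
      bound' := fun y => by
        have := h.D_inj (e.symm y)
        rw [he] at this
        change _ ≤ κ⁻¹ * _
        rw [inv_mul_eq_div, le_div_iff₀ hκ]
        linarith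
      right_inv' := he }
  have hsmall : ∀ᶠ a in L, ‖estMean g (x a) θ₀‖ ≤ κ / 2 * r := by
    filter_upwards [hZ, h.tendsto_sqrt.eventually_gt_atTop 0,
      (h.tendsto_sqrt.const_div_atTop M).eventually_le_const (by positivity : 0 < κ / 2 * r)]
      with a h1 h2 h3
    rw [mul_comm, ← le_div_iff₀ h2] at h1
    exact h1.trans h3
  filter_upwards [hsmall, h.approx (κ / 4) (by positivity), h.eventually_pos] with a h1 h2 hn
  -- The error `κ/2` is `κ/4` from the law of large numbers plus `κ/4` from `small`. The image of
  -- the ball then contains the ball of radius `(κ - κ/2) r` around the value at `θ₀`, hence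
  -- contains `0`.
  have happ : ApproximatesLinearOn (estMean g (x a)) D (Metric.closedBall θ₀ r)
      ⟨κ / 2, by positivity⟩ := by
    intro θ hθ θ' hθ'
    refine (h2 r (min_le_right _ _) θ hθ θ' hθ').trans ?_
    change _ ≤ κ / 2 * _
    have : K * r ≤ κ / 4 := (mul_le_mul_of_nonneg_left (min_le_right _ _) hK.le).trans h.small
    gcongr
    linarith
  have hs := happ.surjOn_closedBall_of_nonlinearRightInverse Dinv hrpos.le subset_rfl
  obtain ⟨θ, hθ, h0⟩ := hs (a := 0) (by
    rw [Metric.mem_closedBall, dist_comm, dist_zero_right]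
    change _ ≤ ((κ⁻¹)⁻¹ - κ / 2) * r
    rw [inv_inv]
    convert h1 using 2
    ring)
  refine ⟨θ, hr₀Θ (Metric.closedBall_subset_closedBall (min_le_left _ _) hθ), ?_⟩
  have hn' : (n a : ℝ) ≠ 0 := by positivity
  simpa [estMean, hn'] using h0

/-- An estimate with bounded log-likelihood ratio approaches `θ₀` at rate `n^(-1/2)`. -/
theorem exists_rate_of_logRatio_le (h : RegularArray L x g θ₀ S D W ρ K σ κ) {M B : ℝ}
    (hZ : ∀ᶠ a in L, √(n a : ℝ) * ‖estMean g (x a) θ₀‖ ≤ M) {θ : ι → E p}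
    (hball : ∀ᶠ a in L, θ a ∈ Metric.closedBall θ₀ ρ)
    (hpos : ∀ᶠ a in L, 0 < empLik g (x a) (θ a))
    (hB : ∀ᶠ a in L, logRatio g (x a) (θ a) ≤ B) :
    ∃ M', ∀ᶠ a in L, √(n a : ℝ) * ‖θ a - θ₀‖ ≤ M' := by
  have hκ := h.kappa_pos
  have hK := h.K_pos
  refine ⟨2 / κ * (B + 2 * K + M), ?_⟩
  filter_upwards [hZ, hball, hpos, hB, h.eventually_pos, h.max_le (1 / 8) (by norm_num),
    h.sum_sq_le, h.approx (κ / 4) (by positivity)] with a h1 h2 h3 h4 hn h5 h6 h7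
  have hn' : (0 : ℝ) < n a := by exact_mod_cast hn
  have hs : 0 < √(n a : ℝ) := Real.sqrt_pos.2 hn'
  have hss : √(n a : ℝ) * √(n a : ℝ) = n a := Real.mul_self_sqrt hn'.le
  set m := estMean g (x a) (θ a) with hm
  -- A test vector for weak duality, of length `n^(-1/2)` in the direction of the mean (and `0` if
  -- `m = 0`). It yields `√n ‖m‖ - 2 K ≤ B`.
  set l : E p := (√(n a : ℝ))⁻¹ • ((‖m‖)⁻¹ • m) with hl
  have hlnorm : ‖l‖ ≤ (√(n a : ℝ))⁻¹ := by
    rw [hl, norm_smul, norm_smul, norm_inv, norm_inv, norm_norm, Real.norm_of_nonneg hs.le]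
    have : ‖m‖⁻¹ * ‖m‖ ≤ 1 := inv_mul_le_one
    calc _ ≤ (√(n a : ℝ))⁻¹ * 1 := by gcongr
      _ = _ := mul_one _
  have hlm : ⟪l, m⟫_ℝ = (√(n a : ℝ))⁻¹ * ‖m‖ := by
    rw [hl, real_inner_smul_left, real_inner_smul_left, real_inner_self_eq_norm_sq]
    rcases eq_or_ne ‖m‖ 0 with h0 | h0
    · simp [h0]
    · field_simp
  have ht : ∀ i, |⟪l, g (x a i) (θ a)⟫_ℝ| ≤ 1 / 8 := fun i => by
    calc _ ≤ ‖l‖ * ‖g (x a i) (θ a)‖ := abs_real_inner_le_norm _ _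
      _ ≤ (√(n a : ℝ))⁻¹ * (1 / 8 * √(n a : ℝ)) := by
          gcongr
          exact h5 _ h2 i
      _ = 1 / 8 := by field_simp
  have hlow := sum_log_le_logRatio hn h3 (l := l) fun i => by linarith [(abs_le.1 (ht i)).1]
  have hsum : √(n a : ℝ) * ‖m‖ - 2 * K ≤ ∑ i, Real.log (1 + ⟪l, g (x a i) (θ a)⟫_ℝ) := by
    have e1 : ∑ i, ⟪l, g (x a i) (θ a)⟫_ℝ = √(n a : ℝ) * ‖m‖ := by
      have : ∑ i, g (x a i) (θ a) = (n a : ℝ) • m := by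
        rw [hm, estMean, smul_smul, mul_inv_cancel₀ hn'.ne', one_smul]
      rw [← inner_sum, this, real_inner_smul_right, hlm, ← mul_assoc]
      congr 1
      calc (n a : ℝ) * (√(n a : ℝ))⁻¹ = √(n a : ℝ) * √(n a : ℝ) * (√(n a : ℝ))⁻¹ := by rw [hss]
        _ = _ := by field_simp
    have e2 : ∑ i, ⟪l, g (x a i) (θ a)⟫_ℝ ^ 2 ≤ K := by
      calc _ ≤ ∑ i, (n a : ℝ)⁻¹ * ‖g (x a i) (θ a)‖ ^ 2 := by
            refine Finset.sum_le_sum fun i _ => ?_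
            have : (n a : ℝ)⁻¹ = ((√(n a : ℝ))⁻¹) ^ 2 := by
              rw [inv_pow, Real.sq_sqrt hn'.le]
            rw [← sq_abs, this, ← mul_pow]
            gcongr
            exact (abs_real_inner_le_norm _ _).trans (by gcongr)
        _ = (n a : ℝ)⁻¹ * ∑ i, ‖g (x a i) (θ a)‖ ^ 2 := by rw [Finset.mul_sum]
        _ ≤ (n a : ℝ)⁻¹ * (K * n a) := by
            gcongr
            exact h6 _ h2
        _ = K := by field_simp
    calc _ ≤ ∑ i, (⟪l, g (x a i) (θ a)⟫_ℝ - 2 * ⟪l, g (x a i) (θ a)⟫_ℝ ^ 2) := by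
          rw [Finset.sum_sub_distrib, ← Finset.mul_sum, e1]
          linarith
      _ ≤ _ := Finset.sum_le_sum fun i _ => sub_sq_le_log_one_add (ht i)
  have hm1 : √(n a : ℝ) * ‖m‖ ≤ B + 2 * K := by linarith
  have e3 := h7 ρ le_rfl _ h2 θ₀ (Metric.mem_closedBall_self h.rho_pos.le)
  have e4 := h.D_inj (θ a - θ₀)
  have e5 : ‖D (θ a - θ₀)‖ ≤ ‖m‖ + ‖estMean g (x a) θ₀‖ + (κ / 4 + K * ρ) * ‖θ a - θ₀‖ := by
    have e6 : D (θ a - θ₀) = m - estMean g (x a) θ₀ - (m - estMean g (x a) θ₀ - D (θ a - θ₀)) := by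
      abel
    calc ‖D (θ a - θ₀)‖ = ‖m - estMean g (x a) θ₀
          - (m - estMean g (x a) θ₀ - D (θ a - θ₀))‖ := by rw [← e6]
      _ ≤ ‖m - estMean g (x a) θ₀‖ + ‖m - estMean g (x a) θ₀ - D (θ a - θ₀)‖ := norm_sub_le _ _
      _ ≤ _ := add_le_add (norm_sub_le _ _) e3
  -- Of the lower bound `κ` for `D`, one quarter is lost to `ε = κ/4` and at most one quarter to `K
  -- ρ`.
  have e7 : κ / 2 * ‖θ a - θ₀‖ ≤ ‖m‖ + ‖estMean g (x a) θ₀‖ := by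
    have := mul_le_mul_of_nonneg_right h.small (norm_nonneg (θ a - θ₀))
    nlinarith
  calc √(n a : ℝ) * ‖θ a - θ₀‖ = 2 / κ * (√(n a : ℝ) * (κ / 2 * ‖θ a - θ₀‖)) := by field_simp
    _ ≤ 2 / κ * (√(n a : ℝ) * (‖m‖ + ‖estMean g (x a) θ₀‖)) := by gcongr
    _ ≤ 2 / κ * (B + 2 * K + M) := by
        gcongr
        linarith

/-- Parameter values whose rescaled deviation from `θ₀` is asymptotically `v` have the
quadratic form of `Z + D v`. -/
theorem tendsto_norm_sq_of_direction (h : RegularArray L x g θ₀ S D W ρ K σ κ) {M M' B : ℝ}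
    (hZ : ∀ᶠ a in L, √(n a : ℝ) * ‖estMean g (x a) θ₀‖ ≤ M) {θ v : ι → E p}
    (hθ : ∀ᶠ a in L, √(n a : ℝ) * ‖θ a - θ₀‖ ≤ M')
    (hv : ∀ᶠ a in L, ‖v a‖ ≤ B)
    (hdir : Tendsto (fun a => √(n a : ℝ) • (θ a - θ₀) - v a) L (𝓝 0)) :
    Tendsto (fun a => ‖W (√(n a : ℝ) • estMean g (x a) (θ a))‖ ^ 2
      - ‖W (√(n a : ℝ) • estMean g (x a) θ₀ + D (v a))‖ ^ 2) L (𝓝 0) := by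
  refine tendsto_norm_sq_sub (C := ‖W‖ * (M + ‖D‖ * B)) ?_ ?_
  · have h1 := h.tendsto_linearization hθ
    have h2 := (D.continuous.tendsto 0).comp hdir
    rw [map_zero] at h2
    have h3 := (W.continuous.tendsto _).comp (h1.add h2)
    simp only [add_zero, map_zero] at h3
    refine h3.congr fun a => ?_
    simp only [Function.comp_apply, map_sub, map_add]
    abel
  · filter_upwards [hZ, hv] with a h1 h2
    refine (W.le_opNorm _).trans ?_
    gcongr
    refine (norm_add_le _ _).trans (add_le_add ?_ ?_)
    · rwa [norm_smul, Real.norm_of_nonneg (Real.sqrt_nonneg _)]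
    · exact (D.le_opNorm _).trans (by gcongr)

/-- The statistic at the constrained estimate is asymptotically the squared norm of a linear
function of the rescaled sample mean at `θ₀`. -/
theorem tendsto_phiDiv_constrained (h : RegularArray L x g θ₀ S D W ρ K σ κ) {φ : ℝ → ℝ}
    (hφ : IsPhi φ) {M : ℝ} (hZ : ∀ᶠ a in L, √(n a : ℝ) * ‖estMean g (x a) θ₀‖ ≤ M)
    {c : E p → E q} {C₀ : E p →L[ℝ] E q} (hc : HasStrictFDerivAt c C₀ θ₀)
    (hsurj : C₀.range = ⊤) (h0 : c θ₀ = 0) {A : E p →L[ℝ] E q} {T : E p →L[ℝ] C₀.ker}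
    (hA : ∀ z v, C₀ v = 0 → ‖A z‖ ^ 2 ≤ ‖W (z + D v)‖ ^ 2)
    (hT : ∀ z, ‖W (z + D (T z))‖ ^ 2 = ‖A z‖ ^ 2)
    {Θ : Set (E p)} (hΘ : Θ ∈ 𝓝 θ₀) {θ : ι → E p}
    (hθ : ∀ᶠ a in L, IsMELE g (x a) (Θ ∩ {θ | c θ = 0}) (θ a))
    (hball : ∀ᶠ a in L, θ a ∈ Metric.closedBall θ₀ ρ) :
    Tendsto (fun a => 2 * (n a : ℝ) / deriv (deriv φ) 1 *
        phiDiv φ (uniformWeights (n a)) (elWeights g (x a) (θ a))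
      - ‖A (√(n a : ℝ) • estMean g (x a) θ₀)‖ ^ 2) L (𝓝 0) := by
  have hsnorm : ∀ a, ∀ v : E p, ‖√(n a : ℝ) • v‖ = √(n a : ℝ) * ‖v‖ := fun a v => by
    rw [norm_smul, Real.norm_of_nonneg (Real.sqrt_nonneg _)]
  -- the rate of the constrained estimate
  obtain ⟨M', hM'⟩ : ∃ M', ∀ᶠ a in L, √(n a : ℝ) * ‖θ a - θ₀‖ ≤ M' := by
    obtain ⟨h1, h2, -⟩ := h.tendsto_logRatio_and_phiDiv hφ (θ := fun _ => θ₀) (M' := 0) hZ (by simp)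
    refine h.exists_rate_of_logRatio_le hZ hball (hθ.mono fun a ha => ha.2.1)
      (B := ((‖W‖ * M) ^ 2 + 1) / 2) ?_
    -- `θ₀` satisfies the constraint, so its bounded log-likelihood ratio bounds that of the
    -- estimate.
    filter_upwards [hθ, h1, h2.eventually_lt_const one_pos, h.eventually_pos, hZ]
      with a h3 h4 h5 hn h6
    have h7 := logRatio_le_logRatio hn h4 (h3.2.2 θ₀ ⟨mem_of_mem_nhds hΘ, h0⟩)
    have h8 : ‖W (√(n a : ℝ) • estMean g (x a) θ₀)‖ ^ 2 ≤ (‖W‖ * M) ^ 2 := by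
      gcongr
      refine (W.le_opNorm _).trans ?_
      rw [hsnorm]
      gcongr
    linarith
  obtain ⟨-, hlog, hphi⟩ := h.tendsto_logRatio_and_phiDiv hφ hZ hM'
  -- lower bound: the deviation is asymptotically tangent
  have hlow : ∃ f : ι → ℝ, Tendsto f L (𝓝 0) ∧ ∀ᶠ a in L,
      ‖A (√(n a : ℝ) • estMean g (x a) θ₀)‖ ^ 2 + f a
        ≤ ‖W (√(n a : ℝ) • estMean g (x a) (θ a))‖ ^ 2 := by
    -- Subtracting `R (C₀ w)` moves `w` into the kernel. For `w = √n (θ - θ₀)` this correction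
    -- vanishes asymptotically, since `c θ = c θ₀ = 0`.
    obtain ⟨R, hR⟩ := LinearMap.exists_rightInverse_of_surjective (C₀ : E p →ₗ[ℝ] E q) hsurj
    have hR' : ∀ w, C₀ (R w) = w := fun w => LinearMap.congr_fun hR w
    set Rc : E q →L[ℝ] E p := LinearMap.toContinuousLinearMap R with hRc
    have hC : Tendsto (fun a => Rc (C₀ (√(n a : ℝ) • (θ a - θ₀)))) L (𝓝 0) := by
      have h1 := tendsto_smul_of_isLittleO (s := fun a => √(n a : ℝ))
        (fun a => Real.sqrt_nonneg _) hc.hasFDerivAt.isLittleO (h.tendsto_of_sqrt_mul_le hM') hM'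
      have h2 : Tendsto (fun a => C₀ (√(n a : ℝ) • (θ a - θ₀))) L (𝓝 0) := by
        rw [← neg_zero]
        refine h1.neg.congr' ?_
        filter_upwards [hθ] with a ha
        have : c (θ a) = 0 := ha.1.2
        rw [this, h0, sub_self, zero_sub, smul_neg, neg_neg, map_smul]
      have h3 := (Rc.continuous.tendsto 0).comp h2
      rwa [map_zero] at h3
    have hdir : Tendsto (fun a => √(n a : ℝ) • (θ a - θ₀)
        - (√(n a : ℝ) • (θ a - θ₀) - Rc (C₀ (√(n a : ℝ) • (θ a - θ₀))))) L (𝓝 0) := by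
      simpa using hC
    refine ⟨_, h.tendsto_norm_sq_of_direction hZ hM' (B := M' + 1) ?_ hdir, ?_⟩
    · have := hC.norm
      rw [norm_zero] at this
      filter_upwards [hM', this.eventually_lt_const one_pos] with a h1 h2
      refine (norm_sub_le _ _).trans ?_
      rw [hsnorm]
      linarith
    · filter_upwards with a
      have := hA (√(n a : ℝ) • estMean g (x a) θ₀)
        (√(n a : ℝ) • (θ a - θ₀) - Rc (C₀ (√(n a : ℝ) • (θ a - θ₀)))) (by
          rw [map_sub]
          exact sub_eq_zero.2 (hR' _).symm)
      linarith
  -- upper bound: comparison with an almost optimal point of the constraint set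
  have hup : ∃ f : ι → ℝ, Tendsto f L (𝓝 0) ∧ ∀ᶠ a in L,
      ‖W (√(n a : ℝ) • estMean g (x a) (θ a))‖ ^ 2
        ≤ ‖A (√(n a : ℝ) • estMean g (x a) θ₀)‖ ^ 2 + f a := by
    obtain ⟨γ, hγ0, hγ, hγc⟩ := exists_tangent_curve hc hsurj h0
    set v : ι → C₀.ker := fun a => T (√(n a : ℝ) • estMean g (x a) θ₀) with hv
    have hvb : ∀ᶠ a in L, ‖v a‖ ≤ ‖T‖ * M := by
      filter_upwards [hZ] with a ha
      refine (T.le_opNorm _).trans ?_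
      rw [hsnorm]
      gcongr
    -- The competitor is `γ (y a)`: a constrained point whose rescaled deviation is asymptotically
    -- the minimizer `v a` of the limiting quadratic form.
    set y : ι → C₀.ker := fun a => (√(n a : ℝ))⁻¹ • v a with hy
    have hsy : ∀ᶠ a in L, √(n a : ℝ) • y a = v a := by
      filter_upwards [h.tendsto_sqrt.eventually_gt_atTop 0] with a ha
      rw [hy]
      simp only
      rw [smul_smul, mul_inv_cancel₀ ha.ne', one_smul]
    have hyM : ∀ᶠ a in L, √(n a : ℝ) * ‖y a - 0‖ ≤ ‖T‖ * M := by
      filter_upwards [hsy, hvb] with a h1 h2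
      rw [sub_zero]
      calc _ = ‖√(n a : ℝ) • y a‖ := by
            rw [norm_smul (√(n a : ℝ)) (y a), Real.norm_of_nonneg (Real.sqrt_nonneg _)]
        _ ≤ _ := by rwa [h1]
    have hy0 : Tendsto y L (𝓝 0) := by
      rw [tendsto_zero_iff_norm_tendsto_zero]
      refine squeeze_zero' (Eventually.of_forall fun a => norm_nonneg _) ?_
        (h.tendsto_sqrt.const_div_atTop (‖T‖ * M))
      filter_upwards [hyM, h.tendsto_sqrt.eventually_gt_atTop 0] with a ha hpos
      rw [le_div_iff₀ hpos, mul_comm]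
      simpa using ha
    have hdir : Tendsto (fun a => √(n a : ℝ) • (γ (y a) - θ₀) - (v a : E p)) L (𝓝 0) := by
      have h1 := tendsto_smul_of_isLittleO (s := fun a => √(n a : ℝ))
        (fun a => Real.sqrt_nonneg _) hγ.isLittleO hy0 hyM
      refine h1.congr' ?_
      filter_upwards [hsy] with a ha
      rw [hγ0, sub_zero, smul_sub, Submodule.subtypeL_apply, ← Submodule.coe_smul, ha]
    have hγM : ∀ᶠ a in L, √(n a : ℝ) * ‖γ (y a) - θ₀‖ ≤ ‖T‖ * M + 1 := by
      have h1 := hdir.norm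
      rw [norm_zero] at h1
      filter_upwards [h1.eventually_lt_const one_pos, hvb] with a h2 h3
      rw [← hsnorm]
      have := norm_add_le (√(n a : ℝ) • (γ (y a) - θ₀) - (v a : E p)) (v a : E p)
      rw [sub_add_cancel] at this
      have h4 : ‖(v a : E p)‖ = ‖v a‖ := rfl
      linarith
    obtain ⟨hpos', hlog', -⟩ := h.tendsto_logRatio_and_phiDiv hφ hZ hγM
    have hq := h.tendsto_norm_sq_of_direction hZ hγM (v := fun a => (v a : E p)) (B := ‖T‖ * M) hvb hdir
    have hsum := (hlog'.sub hlog).add hq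
    rw [sub_zero, add_zero] at hsum
    refine ⟨_, hsum, ?_⟩
    have hmem := (h.tendsto_of_sqrt_mul_le hγM).eventually hΘ
    filter_upwards [hθ, hpos', h.eventually_pos, hmem, hy0.eventually hγc] with a h1 h2 hn h3 h4
    have h5 := logRatio_le_logRatio hn h2 (h1.2.2 _ ⟨h3, h4⟩)
    have h6 := hT (√(n a : ℝ) • estMean g (x a) θ₀)
    linarith
  obtain ⟨f, hf, hf'⟩ := hlow
  obtain ⟨f', hf₁, hf₂⟩ := hup
  have hQ : Tendsto (fun a => ‖W (√(n a : ℝ) • estMean g (x a) (θ a))‖ ^ 2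
      - ‖A (√(n a : ℝ) • estMean g (x a) θ₀)‖ ^ 2) L (𝓝 0) := by
    refine tendsto_of_tendsto_of_tendsto_of_le_of_le' hf hf₁ ?_ ?_
    · filter_upwards [hf'] with a ha
      linarith
    · filter_upwards [hf₂] with a ha
      linarith
  simpa using hphi.add hQ

end RegularArray

/-! ### Linear algebra of the limiting quadratic form -/

/-- A square root of the inverse of a positive definite operator. -/
theorem exists_sqrt_inverse {p : ℕ} {S : E p →L[ℝ] E p} (hsymm : ∀ u v, ⟪S u, v⟫_ℝ = ⟪u, S v⟫_ℝ)
    (hpos : ∀ u, u ≠ 0 → 0 < ⟪u, S u⟫_ℝ) :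
    ∃ W : E p →L[ℝ] E p, (∀ u v, ⟪W u, v⟫_ℝ = ⟪u, W v⟫_ℝ) ∧ ∀ z, W (S (W z)) = z := by
  have hS : (S : E p →ₗ[ℝ] E p).IsSymmetric := hsymm
  have hfin : Module.finrank ℝ (E p) = p := by simp
  set b := hS.eigenvectorBasis hfin with hb
  set ev := hS.eigenvalues hfin with hev
  have hSb : ∀ i, S (b i) = ev i • b i := fun i => hS.apply_eigenvectorBasis hfin i
  have hevpos : ∀ i, 0 < ev i := by
    intro i
    have := hpos (b i) (b.orthonormal.ne_zero i)
    rw [hSb, real_inner_smul_right, real_inner_self_eq_norm_sq, b.orthonormal.1 i] at this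
    simpa using this
  set W : E p →L[ℝ] E p := ∑ i, (√(ev i))⁻¹ • (innerSL ℝ (b i)).smulRight (b i) with hW
  have hWapp : ∀ z, W z = ∑ i, ((√(ev i))⁻¹ * ⟪b i, z⟫_ℝ) • b i := by
    intro z
    simp [hW, smul_smul]
  refine ⟨W, fun u v => ?_, fun z => ?_⟩
  · rw [hWapp, hWapp, sum_inner, inner_sum]
    refine Finset.sum_congr rfl fun i _ => ?_
    rw [real_inner_smul_left, real_inner_smul_right, real_inner_comm u (b i)]
    ring
  · have hWb : ∀ i, W (b i) = (√(ev i))⁻¹ • b i := by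
      intro i
      rw [hWapp, Finset.sum_eq_single i]
      · rw [real_inner_self_eq_norm_sq, b.orthonormal.1 i]
        simp
      · intro j _ hj
        rw [b.orthonormal.2 hj]
        simp
      · simp
    have key : ((W ∘L S ∘L W : E p →L[ℝ] E p) : E p →ₗ[ℝ] E p) = LinearMap.id := by
      refine b.toBasis.ext fun i => ?_
      have h1 : √(ev i) ≠ 0 := (Real.sqrt_pos.2 (hevpos i)).ne'
      have h2 : (√(ev i))⁻¹ * (ev i * (√(ev i))⁻¹) = 1 := by
        calc _ = (√(ev i))⁻¹ * (√(ev i) * √(ev i) * (√(ev i))⁻¹) := by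
              rw [Real.mul_self_sqrt (hevpos i).le]
          _ = 1 := by field_simp
      simp only [OrthonormalBasis.coe_toBasis, ContinuousLinearMap.coe_coe,
        ContinuousLinearMap.comp_apply, hWb, map_smul, hSb, smul_smul, LinearMap.id_apply]
      rw [mul_assoc, h2, one_smul]
    exact LinearMap.congr_fun key z

/-- The minimum of the quadratic form `‖W (z + D v)‖²` over the kernel of `C₀` is the squared norm
of a linear function of `z` with values in `ℝ^q`. -/
theorem exists_minimizer {p q : ℕ} {S D W : E p →L[ℝ] E p} {C₀ : E p →L[ℝ] E q}
    (hWsymm : ∀ u v, ⟪W u, v⟫_ℝ = ⟪u, W v⟫_ℝ) (hWS : ∀ z, W (S (W z)) = z)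
    (hD : Function.Injective D) (hsurj : C₀.range = ⊤) :
    ∃ (A : E p →L[ℝ] E q) (T : E p →L[ℝ] C₀.ker),
      (∀ z v, C₀ v = 0 → ‖A z‖ ^ 2 ≤ ‖W (z + D v)‖ ^ 2) ∧
      (∀ z, ‖W (z + D (T z))‖ ^ 2 = ‖A z‖ ^ 2) ∧
      ∀ w, ∃ u, (∀ z, ⟪w, A z⟫_ℝ = ⟪u, z⟫_ℝ) ∧ ⟪u, S u⟫_ℝ = ‖w‖ ^ 2 := by
  have hWsurj : Function.Surjective W := fun z => ⟨S (W z), hWS z⟩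
  have hWinj : Function.Injective W :=
    (LinearMap.injective_iff_surjective (f := (W : E p →ₗ[ℝ] E p))).2 hWsurj
  set G : E p →ₗ[ℝ] E p := (W : E p →ₗ[ℝ] E p) ∘ₗ (D : E p →ₗ[ℝ] E p) with hG
  have hGinj : Function.Injective G := hWinj.comp hD
  -- Minimizing `‖W z + G v‖` over the kernel is projecting `W z` onto `V`, of dimension `p - q`.
  -- The residual lies in `Vᗮ`, identified isometrically with `ℝ^q`: `A` reads off the residual, and
  -- `T₀` is minus the preimage of the projection.
  set V : Submodule ℝ (E p) := C₀.ker.map G with hV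
  have hfinV : Module.finrank ℝ V + q = p := by
    have h1 : Module.finrank ℝ V = Module.finrank ℝ C₀.ker :=
      (Submodule.equivMapOfInjective G hGinj C₀.ker).finrank_eq.symm
    have h2 := LinearMap.finrank_range_add_finrank_ker (C₀ : E p →ₗ[ℝ] E q)
    rw [hsurj, finrank_top] at h2
    simp only [finrank_euclideanSpace, Fintype.card_fin] at h2
    rw [h1]
    omega
  have hfin : Module.finrank ℝ Vᗮ = q := by
    have := V.finrank_add_finrank_orthogonal
    simp only [finrank_euclideanSpace, Fintype.card_fin] at this
    omega
  set e : Vᗮ ≃ₗᵢ[ℝ] E q := ((stdOrthonormalBasis ℝ Vᗮ).reindex (finCongr hfin)).repr with he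
  set A : E p →L[ℝ] E q :=
    (e.toContinuousLinearEquiv : Vᗮ →L[ℝ] E q) ∘L Vᗮ.orthogonalProjectionOnto ∘L W with hA
  set T₀ : E p →ₗ[ℝ] C₀.ker :=
    -((Submodule.equivMapOfInjective G hGinj C₀.ker).symm.toLinearMap ∘ₗ
      (V.orthogonalProjectionOnto : E p →ₗ[ℝ] V) ∘ₗ (W : E p →ₗ[ℝ] E p)) with hT₀
  have hAnorm : ∀ z, ‖A z‖ = ‖Vᗮ.orthogonalProjectionOnto (W z)‖ := fun z => by
    change ‖e _‖ = _
    rw [e.norm_map]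
    rfl
  refine ⟨A, LinearMap.toContinuousLinearMap T₀, fun z v hv => ?_, fun z => ?_, fun w => ?_⟩
  · have h1 : W (D v) ∈ V := Submodule.mem_map.2 ⟨v, hv, rfl⟩
    have h2 : Vᗮ.orthogonalProjectionOnto (W (D v)) = 0 :=
      Submodule.orthogonalProjectionOnto_apply_of_mem_orthogonal
        (V.le_orthogonal_orthogonal h1)
    have h3 : Vᗮ.orthogonalProjectionOnto (W z) = Vᗮ.orthogonalProjectionOnto (W (z + D v)) := by
      rw [map_add, map_add, h2, add_zero]
    rw [hAnorm, h3]
    gcongr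
    exact Vᗮ.norm_orthogonalProjectionOnto_apply_le _
  · rw [hAnorm]
    have h1 : W (D (T₀ z)) = -(V.orthogonalProjectionOnto (W z) : E p) := by
      have h2 := (Submodule.equivMapOfInjective G hGinj C₀.ker).apply_symm_apply
        (V.orthogonalProjectionOnto (W z))
      have h3 := congrArg Subtype.val h2
      rw [Submodule.coe_equivMapOfInjective_apply] at h3
      have h4 : ((T₀ z : C₀.ker) : E p) = -((((Submodule.equivMapOfInjective G hGinj C₀.ker).symm
        (V.orthogonalProjectionOnto (W z))) : C₀.ker) : E p) := rfl
      rw [h4, map_neg, map_neg]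
      exact congrArg Neg.neg h3
    have h5 : W (z + D (LinearMap.toContinuousLinearMap T₀ z))
        = (Vᗮ.orthogonalProjectionOnto (W z) : E p) := by
      rw [map_add, LinearMap.coe_toContinuousLinearMap', h1]
      have : (V.orthogonalProjectionOnto (W z) : E p) + (Vᗮ.orthogonalProjectionOnto (W z) : E p)
          = W z := V.starProjection_add_starProjection_orthogonal (W z)
      rw [← sub_eq_add_neg]
      exact (eq_sub_of_add_eq' this).symm
    rw [h5]
    rfl
  -- `u` is the adjoint of `A` applied to `w`; the identity `W S W = 1` says that `A` carries the
  -- covariance `S` to the identity.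
  · refine ⟨W (e.symm w : E p), fun z => ?_, ?_⟩
    · have h1 : ⟪w, A z⟫_ℝ = ⟪e.symm w, Vᗮ.orthogonalProjectionOnto (W z)⟫_ℝ := by
        rw [← e.inner_map_map, e.apply_symm_apply]
        rfl
      rw [h1, hWsymm]
      exact Submodule.inner_orthogonalProjectionOnto_eq_of_mem_left (K := Vᗮ) (e.symm w) (W z)
    · rw [hWsymm, hWS, real_inner_self_eq_norm_sq]
      have : ‖(e.symm w : E p)‖ = ‖e.symm w‖ := rfl
      rw [this, e.symm.norm_map]

/-- A positive definite quadratic form is bounded below. -/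
theorem exists_pos_le_inner {p : ℕ} {S : E p →L[ℝ] E p} (hpos : ∀ u, u ≠ 0 → 0 < ⟪u, S u⟫_ℝ) :
    ∃ σ > 0, ∀ u, σ * ‖u‖ ^ 2 ≤ ⟪u, S u⟫_ℝ := by
  -- The sphere is empty exactly when `p = 0`.
  rcases (Metric.sphere (0 : E p) 1).eq_empty_or_nonempty with hs | hs
  · refine ⟨1, one_pos, fun u => ?_⟩
    have : u = 0 := by
      by_contra hu
      have : (‖u‖)⁻¹ • u ∈ Metric.sphere (0 : E p) 1 := by
        simp [norm_smul, norm_ne_zero_iff.2 hu]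
      rw [hs] at this
      exact this
    simp [this]
  · obtain ⟨v, hv, hmin⟩ := (isCompact_sphere (0 : E p) 1).exists_isMinOn hs
      (f := fun u => ⟪u, S u⟫_ℝ) (by fun_prop)
    have hv0 : v ≠ 0 := by
      rintro rfl
      simp at hv
    refine ⟨_, hpos v hv0, fun u => ?_⟩
    rcases eq_or_ne u 0 with rfl | hu
    · simp
    have hu' : 0 < ‖u‖ := norm_pos_iff.2 hu
    have h1 := hmin (show (‖u‖)⁻¹ • u ∈ Metric.sphere (0 : E p) 1 by
      simp [norm_smul, norm_ne_zero_iff.2 hu])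
    simp only [Set.mem_ofPred_eq, map_smul, real_inner_smul_left, real_inner_smul_right] at h1
    rw [← mul_assoc, ← mul_inv, inv_mul_eq_div, le_div_iff₀ (by positivity)] at h1
    rwa [sq]

theorem exists_pos_le_norm {p : ℕ} {D : E p →L[ℝ] E p} (hD : Function.Injective D) :
    ∃ κ > 0, ∀ u, κ * ‖u‖ ≤ ‖D u‖ := by
  obtain ⟨K, hK, h⟩ := LinearMap.exists_antilipschitzWith (D : E p →ₗ[ℝ] E p)
    (LinearMap.ker_eq_bot.2 hD)
  refine ⟨(K : ℝ)⁻¹, by positivity, fun u => ?_⟩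
  have := h.le_mul_dist u 0
  simp only [dist_zero_right, map_zero, ContinuousLinearMap.coe_coe] at this
  have hK' : (0 : ℝ) < K := hK
  rwa [inv_mul_eq_div, div_le_iff₀ hK', mul_comm]

theorem finrank_range_eq_rank {m p : ℕ} (T : E p →L[ℝ] E m) {J : Matrix (Fin m) (Fin p) ℝ}
    (hJ : ∀ i j, T (EuclideanSpace.single j 1) i = J i j) :
    Module.finrank ℝ T.range = J.rank := by
  have : LinearMap.toMatrix (EuclideanSpace.basisFun (Fin p) ℝ).toBasis
      (EuclideanSpace.basisFun (Fin m) ℝ).toBasis (T : E p →ₗ[ℝ] E m) = J := by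
    ext i j
    simp [LinearMap.toMatrix_apply, hJ]
  rw [Matrix.rank_eq_finrank_range_toLin J (EuclideanSpace.basisFun (Fin m) ℝ).toBasis
    (EuclideanSpace.basisFun (Fin p) ℝ).toBasis, ← this, Matrix.toLin_toMatrix]

theorem range_eq_top_of_rank {m p : ℕ} {T : E p →L[ℝ] E m} {J : Matrix (Fin m) (Fin p) ℝ}
    (hJ : ∀ i j, T (EuclideanSpace.single j 1) i = J i j) (hr : J.rank = m) : T.range = ⊤ := by
  refine Submodule.eq_top_of_finrank_eq ?_
  rw [finrank_range_eq_rank T hJ, hr]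
  simp

/-! ### Convergence in probability as convergence along a filter -/

/-- The filter of the sequences of events whose probability tends to one. -/
def probFilter {Ω : Type*} [MeasurableSpace Ω] (μ : Measure Ω) : Filter (ℕ × Ω) where
  -- No measurability is required: monotonicity and subadditivity of the outer measure suffice, so
  -- estimators may be arbitrary functions.
  sets := {A | Tendsto (fun n => μ {ω | (n, ω) ∉ A}) atTop (𝓝 0)}
  univ_sets := by simp
  sets_of_superset {A B} hA hAB :=
    tendsto_of_tendsto_of_tendsto_of_le_of_le tendsto_const_nhds hA (fun _ => zero_le)
      fun _ => measure_mono fun _ hω hω' => hω (hAB hω')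
  inter_sets {A B} hA hB := by
    have hA' : Tendsto (fun n => μ {ω | (n, ω) ∉ A}) atTop (𝓝 0) := hA
    have h := hA'.add hB
    rw [add_zero] at h
    refine tendsto_of_tendsto_of_tendsto_of_le_of_le tendsto_const_nhds h (fun _ => zero_le)
      fun n => (measure_mono fun ω hω => ?_).trans (measure_union_le _ _)
    by_contra hcon
    simp only [Set.mem_union, Set.mem_ofPred_eq, not_or, not_not] at hcon
    exact hω hcon

section

variable {Ω : Type*} [MeasurableSpace Ω] {μ : Measure Ω}

theorem eventually_probFilter {P : ℕ × Ω → Prop} :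
    (∀ᶠ a in probFilter μ, P a) ↔ Tendsto (fun n => μ {ω | ¬ P (n, ω)}) atTop (𝓝 0) :=
  Iff.rfl

theorem tendsto_fst_probFilter : Tendsto Prod.fst (probFilter μ) atTop := by
  refine tendsto_atTop.2 fun N => eventually_probFilter.2 ?_
  refine tendsto_const_nhds.congr' ?_
  filter_upwards [eventually_ge_atTop N] with n hn
  simp [hn]

theorem eventually_probFilter_of_ae {P : ℕ × Ω → Prop} (h : ∀ n, ∀ᵐ ω ∂μ, P (n, ω)) :
    ∀ᶠ a in probFilter μ, P a := by
  refine eventually_probFilter.2 ?_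
  have : ∀ n, μ {ω | ¬ P (n, ω)} = 0 := fun n => ae_iff.1 (h n)
  simp [this]

theorem tendsto_probFilter_of_ae [IsFiniteMeasure μ] {B : Type*} [NormedAddCommGroup B]
    {Y : ℕ → Ω → B} {b : B} (hm : ∀ n, AEStronglyMeasurable (Y n) μ)
    (h : ∀ᵐ ω ∂μ, Tendsto (fun n => Y n ω) atTop (𝓝 b)) :
    Tendsto (fun a : ℕ × Ω => Y a.1 a.2) (probFilter μ) (𝓝 b) := by
  have h1 := tendstoInMeasure_of_tendsto_ae hm h
  rw [tendstoInMeasure_iff_dist] at h1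
  rw [Metric.tendsto_nhds]
  intro ε hε
  refine eventually_probFilter.2 ((h1 ε hε).congr fun n => ?_)
  simp [not_lt]

theorem tendstoInMeasure_of_tendsto_probFilter {Y : ℕ → Ω → ℝ}
    (h : Tendsto (fun a : ℕ × Ω => Y a.1 a.2) (probFilter μ) (𝓝 0)) :
    TendstoInMeasure μ Y atTop 0 := by
  rw [tendstoInMeasure_iff_dist]
  intro ε hε
  refine (eventually_probFilter.1 (Metric.tendsto_nhds.1 h ε hε)).congr fun n => ?_
  simp [not_lt]

/-- A property which holds with probability tending to one on the events `Y ≤ M`, for every `M`,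
holds with probability tending to one if `Y` is stochastically bounded. -/
theorem eventually_probFilter_of_tight {P : ℕ × Ω → Prop} {Y : ℕ × Ω → ℝ}
    (hY : ∀ δ : ENNReal, 0 < δ → ∃ M, ∀ᶠ n in atTop, μ {ω | ¬ Y (n, ω) ≤ M} ≤ δ)
    (h : ∀ M, ∀ᶠ a in probFilter μ ⊓ 𝓟 {a | Y a ≤ M}, P a) : ∀ᶠ a in probFilter μ, P a := by
  refine eventually_probFilter.2 (ENNReal.tendsto_nhds_zero.2 fun δ hδ => ?_)
  obtain ⟨M, hM⟩ := hY (δ / 2) (ENNReal.half_pos hδ.ne')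
  have h1 := eventually_probFilter.1 (eventually_inf_principal.1 (h M))
  filter_upwards [hM, ENNReal.tendsto_nhds_zero.1 h1 (δ / 2) (ENNReal.half_pos hδ.ne')] with n h2 h3
  calc μ {ω | ¬ P (n, ω)}
      ≤ μ ({ω | ¬ Y (n, ω) ≤ M} ∪ {ω | ¬ ((n, ω) ∈ {a | Y a ≤ M} → P (n, ω))}) := by
        refine measure_mono fun ω hω => ?_
        by_cases hle : Y (n, ω) ≤ M
        · exact Or.inr fun hcon => hω (hcon hle)
        · exact Or.inl hle
    _ ≤ δ / 2 + δ / 2 := (measure_union_le _ _).trans (add_le_add h2 h3)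
    _ = δ := ENNReal.add_halves δ

theorem tendsto_probFilter_of_tight {Y Z : ℕ × Ω → ℝ}
    (hY : ∀ δ : ENNReal, 0 < δ → ∃ M, ∀ᶠ n in atTop, μ {ω | ¬ Y (n, ω) ≤ M} ≤ δ)
    (h : ∀ M, Tendsto Z (probFilter μ ⊓ 𝓟 {a | Y a ≤ M}) (𝓝 0)) :
    Tendsto Z (probFilter μ) (𝓝 0) :=
  Metric.tendsto_nhds.2 fun ε hε =>
    eventually_probFilter_of_tight hY fun M => Metric.tendsto_nhds.1 (h M) ε hε

end

/-! ### Averages over independent observations -/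

section

variable {Ω : Type*} [MeasurableSpace Ω] {μ : Measure Ω} {k : ℕ} {X : ℕ → Ω → E k}
  {F : Measure (E k)}

theorem ae_forall_sample (hXm : ∀ i, AEMeasurable (X i) μ) (hXlaw : ∀ i, μ.map (X i) = F)
    {P : E k → Prop} (h : ∀ᵐ x ∂F, P x) : ∀ᵐ ω ∂μ, ∀ i, P (X i ω) := by
  rw [ae_all_iff]
  intro i
  exact ae_of_ae_map (hXm i) (by rwa [hXlaw i])

theorem identDistrib_comp (hXm : ∀ i, AEMeasurable (X i) μ) (hXlaw : ∀ i, μ.map (X i) = F)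
    {B : Type*} [MeasurableSpace B] {f : E k → B} (hf : AEMeasurable f F) (i : ℕ) :
    IdentDistrib (fun ω => f (X i ω)) (fun ω => f (X 0 ω)) μ μ := by
  have h : IdentDistrib (X i) (X 0) μ μ := ⟨hXm i, hXm 0, by rw [hXlaw, hXlaw]⟩
  exact h.comp_of_aemeasurable (by rwa [hXlaw])

theorem ae_tendsto_avg (hXm : ∀ i, AEMeasurable (X i) μ) (hXind : iIndepFun X μ)
    (hXlaw : ∀ i, μ.map (X i) = F) {B : Type*} [NormedAddCommGroup B] [NormedSpace ℝ B]
    [CompleteSpace B] [MeasurableSpace B] [BorelSpace B] {f : E k → B} (hf : Integrable f F) :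
    ∀ᵐ ω ∂μ, Tendsto (fun n : ℕ => (n : ℝ)⁻¹ • ∑ i, f (sample X n ω i)) atTop
      (𝓝 (∫ x, f x ∂F)) := by
  have hfm : AEMeasurable f F := hf.1.aemeasurable
  have hint : Integrable (fun ω => f (X 0 ω)) μ := by
    have : Integrable f (μ.map (X 0)) := by rwa [hXlaw]
    exact this.comp_aemeasurable (hXm 0)
  have h := strong_law_ae (fun i ω => f (X i ω)) hint
    (fun i j hij => (hXind.indepFun hij).comp₀ (hXm i) (hXm j)
      (by rwa [hXlaw]) (by rwa [hXlaw]))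
    (identDistrib_comp hXm hXlaw hfm)
  have hexp : ∫ ω, f (X 0 ω) ∂μ = ∫ x, f x ∂F := by
    rw [← hXlaw 0, integral_map (hXm 0) (by rw [hXlaw]; exact hf.1)]
  filter_upwards [h] with ω hω
  rw [hexp] at hω
  refine hω.congr fun n => ?_
  rw [Finset.sum_range]
  rfl

variable [IsProbabilityMeasure μ]

theorem tendsto_avg (hXm : ∀ i, AEMeasurable (X i) μ) (hXind : iIndepFun X μ)
    (hXlaw : ∀ i, μ.map (X i) = F) {B : Type*} [NormedAddCommGroup B] [NormedSpace ℝ B]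
    [CompleteSpace B] [MeasurableSpace B] [BorelSpace B] {f : E k → B} (hf : Integrable f F) :
    Tendsto (fun a : ℕ × Ω => (a.1 : ℝ)⁻¹ • ∑ i, f (sample X a.1 a.2 i)) (probFilter μ)
      (𝓝 (∫ x, f x ∂F)) := by
  refine tendsto_probFilter_of_ae (Y := fun n ω => (n : ℝ)⁻¹ • ∑ i, f (sample X n ω i))
    (fun n => ?_) (ae_tendsto_avg hXm hXind hXlaw hf)
  refine AEStronglyMeasurable.const_smul ?_ _
  refine Finset.aestronglyMeasurable_fun_sum _ fun i _ => ?_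
  have : AEStronglyMeasurable f (μ.map (X i)) := by rw [hXlaw]; exact hf.1
  exact this.comp_aemeasurable (hXm i)

/-- The largest term of an i.i.d. sample of integrable variables is of smaller order than the
sample size. -/
theorem eventually_forall_le_mul (hXm : ∀ i, AEMeasurable (X i) μ) (hXind : iIndepFun X μ)
    (hXlaw : ∀ i, μ.map (X i) = F) {H : E k → ℝ} (hH : Integrable H F) {δ : ℝ} (hδ : 0 < δ) :
    ∀ᶠ a in probFilter μ, ∀ i, H (sample X a.1 a.2 i) ≤ δ * a.1 := by
  -- Truncation: each `H(xᵢ)` is at most `m` plus the sum of all excesses over `m`. For large `m`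
  -- the average excess is below `δ/2`, and `m ≤ δ n/2` eventually.
  have hlim : Tendsto (fun m : ℕ => ∫ x, max (H x - m) 0 ∂F) atTop (𝓝 0) := by
    have := tendsto_integral_of_dominated_convergence (μ := F)
      (F := fun (m : ℕ) x => max (H x - m) 0) (f := fun _ => (0 : ℝ)) (fun x => |H x|)
      (fun m => (hH.1.sub aestronglyMeasurable_const).sup aestronglyMeasurable_const)
      hH.abs
      (fun m => Eventually.of_forall fun x => by
        rw [Real.norm_of_nonneg (le_max_right _ _)]
        refine max_le ?_ (abs_nonneg _)
        have : (0 : ℝ) ≤ m := Nat.cast_nonneg m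
        linarith [le_abs_self (H x)])
      (Eventually.of_forall fun x => by
        refine tendsto_const_nhds.congr' ?_
        filter_upwards [tendsto_natCast_atTop_atTop.eventually_ge_atTop (H x)] with m hm
        rw [max_eq_right (by linarith)])
    simpa using this
  obtain ⟨m, hm⟩ := (hlim.eventually_lt_const (by positivity : 0 < δ / 2)).exists
  have hFfin : IsFiniteMeasure F := by
    rw [← hXlaw 0]
    have := Measure.isProbabilityMeasure_map (hXm 0)
    infer_instance
  have hint : Integrable (fun x => max (H x - m) 0) F :=
    (hH.sub (integrable_const (m : ℝ))).sup (integrable_const 0)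
  have hav := (tendsto_avg hXm hXind hXlaw hint).eventually_lt_const hm
  have hsize : ∀ᶠ a in probFilter μ, (m : ℝ) ≤ δ / 2 * a.1 := by
    have : Tendsto (fun a : ℕ × Ω => δ / 2 * (a.1 : ℝ)) (probFilter μ) atTop :=
      (tendsto_natCast_atTop_atTop.comp tendsto_fst_probFilter).const_mul_atTop (by positivity)
    exact this.eventually_ge_atTop m
  filter_upwards [hav, hsize, tendsto_fst_probFilter.eventually_gt_atTop 0] with a h1 h2 hn i
  have hn' : (0 : ℝ) < a.1 := by exact_mod_cast hn
  have h3 := Finset.single_le_sum (f := fun i => max (H (sample X a.1 a.2 i) - m) 0)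
    (fun i _ => le_max_right _ _) (Finset.mem_univ i)
  rw [smul_eq_mul, inv_mul_eq_div, div_lt_iff₀ hn'] at h1
  have h4 := le_max_left (H (sample X a.1 a.2 i) - m) 0
  linarith

end

/-! ### Envelopes and moments -/

/-- `H` dominates the estimating function of the observation `x`, its derivative and the Lipschitz
constant of its derivative on a ball. -/
structure Envelope {k p r : ℕ} (g : E k → E p → E r) (θ₀ : E p) (ρ : ℝ) (H : E k → ℝ) (x : E k) :
    Prop where
  differentiableAt : ∀ θ ∈ Metric.closedBall θ₀ ρ, DifferentiableAt ℝ (g x) θ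
  cube_le : ∀ θ ∈ Metric.closedBall θ₀ ρ, ‖g x θ‖ ^ 3 ≤ H x
  fderiv_le : ∀ θ ∈ Metric.closedBall θ₀ ρ, ‖fderiv ℝ (g x) θ‖ ≤ H x
  fderiv_lip : ∀ θ ∈ Metric.closedBall θ₀ ρ, ∀ θ' ∈ Metric.closedBall θ₀ ρ,
    ‖fderiv ℝ (g x) θ - fderiv ℝ (g x) θ'‖ ≤ H x * ‖θ - θ'‖

theorem Envelope.nonneg {k p r : ℕ} {g : E k → E p → E r} {θ₀ : E p} {ρ : ℝ} {H : E k → ℝ}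
    {x : E k} (h : Envelope g θ₀ ρ H x) (hρ : 0 ≤ ρ) : 0 ≤ H x :=
  (by positivity : 0 ≤ ‖g x θ₀‖ ^ 3).trans (h.cube_le θ₀ (Metric.mem_closedBall_self hρ))

theorem Envelope.mono {k p r : ℕ} {g : E k → E p → E r} {θ₀ : E p} {ρ ρ' : ℝ} {H : E k → ℝ}
    {x : E k} (h : Envelope g θ₀ ρ H x) (hρ : ρ' ≤ ρ) : Envelope g θ₀ ρ' H x :=
  have hs := Metric.closedBall_subset_closedBall (x := θ₀) hρ
  ⟨fun θ hθ => h.1 θ (hs hθ), fun θ hθ => h.2 θ (hs hθ), fun θ hθ => h.3 θ (hs hθ),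
    fun θ hθ θ' hθ' => h.4 θ (hs hθ) θ' (hs hθ')⟩

/-- On a ball, which is convex, the bound on the second derivative becomes a Lipschitz bound for the
first; adding absolute values merges the three dominating functions. -/
theorem RegularAt.exists_envelope {k p r : ℕ} {F : Measure (E k)} {g : E k → E p → E r}
    {θ₀ : E p} (h : RegularAt F g θ₀) :
    ∃ ρ > 0, ∃ H : E k → ℝ, Integrable H F ∧ ∀ᵐ x ∂F, Envelope g θ₀ ρ H x := by
  obtain ⟨U₁, hU₁, H₁, hH₁, h₁⟩ := h.cube_bound
  obtain ⟨U₂, hU₂, H₂, hH₂, h₂⟩ := h.deriv_bound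
  obtain ⟨U₃, hU₃, H₃, hH₃, h₃⟩ := h.deriv_two_bound
  obtain ⟨ρ, hρ, hsub⟩ := Metric.nhds_basis_closedBall.mem_iff.1
    (inter_mem hU₁ (inter_mem hU₂ hU₃))
  refine ⟨ρ, hρ, fun x => |H₁ x| + |H₂ x| + |H₃ x|, (hH₁.abs.add hH₂.abs).add hH₃.abs, ?_⟩
  filter_upwards [h₁, h₂, h₃] with x hx₁ hx₂ hx₃
  have a1 := abs_nonneg (H₁ x)
  have a2 := abs_nonneg (H₂ x)
  have a3 := abs_nonneg (H₃ x)
  refine ⟨fun θ hθ => hx₂.1 θ (hsub hθ).2.1, fun θ hθ => ?_, fun θ hθ => ?_,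
    fun θ hθ θ' hθ' => ?_⟩
  · linarith [hx₁ θ (hsub hθ).1, le_abs_self (H₁ x)]
  · linarith [hx₂.2.2 θ (hsub hθ).2.1, le_abs_self (H₂ x)]
  · refine (convex_closedBall θ₀ ρ).norm_image_sub_le_of_norm_fderiv_le (𝕜 := ℝ)
      (fun ξ hξ => hx₃.1 ξ (hsub hξ).2.2) (fun ξ hξ => ?_) hθ' hθ
    linarith [hx₃.2.2 ξ (hsub hξ).2.2, le_abs_self (H₃ x)]

/-- The operator `v vᵀ`. -/
def outer {p : ℕ} (v : E p) : E p →L[ℝ] E p := (innerSL ℝ v).smulRight v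

theorem outer_apply {p : ℕ} (v u : E p) : outer v u = ⟪u, v⟫_ℝ • v := by
  simp [outer, real_inner_comm]

theorem continuous_outer {p : ℕ} : Continuous (outer : E p → E p →L[ℝ] E p) :=
  ((ContinuousLinearMap.smulRightL ℝ (E p) (E p)).continuous.comp
    (innerSL ℝ).continuous).clm_apply continuous_id

theorem norm_outer {p : ℕ} (v : E p) : ‖outer v‖ ≤ ‖v‖ ^ 2 := by
  rw [outer, ContinuousLinearMap.norm_smulRight_apply, innerSL_apply_norm, sq]

theorem sq_le_one_add_cube {t : ℝ} (ht : 0 ≤ t) : t ^ 2 ≤ 1 + t ^ 3 := by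
  rcases le_total t 1 with h | h
  · have := pow_le_one₀ (n := 2) ht h
    have h3 : 0 ≤ t ^ 3 := by positivity
    linarith
  · have := pow_le_pow_right₀ h (by norm_num : 2 ≤ 3)
    linarith

theorem self_le_one_add_cube {t : ℝ} (ht : 0 ≤ t) : t ≤ 1 + t ^ 3 := by
  have := sq_le_one_add_cube ht
  nlinarith [sq_nonneg (t - 1), pow_nonneg ht 3, sq_nonneg t]

theorem clm_eq_sum_smulRight {m p : ℕ} (T : E p →L[ℝ] E m) :
    T = ∑ j, (EuclideanSpace.proj j : E p →L[ℝ] ℝ).smulRight (T (EuclideanSpace.single j 1)) := by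
  ext1 u
  conv_lhs => rw [← (EuclideanSpace.basisFun (Fin p) ℝ).sum_repr u]
  simp

section

variable {k p : ℕ} {F : Measure (E k)} {g : E k → E p → E p} {θ₀ : E p}
  {ρ : ℝ} {H : E k → ℝ}

theorem integrable_estFun [IsFiniteMeasure F] (hgm : ∀ θ, Measurable fun x => g x θ) (hρ : 0 < ρ)
    (hH : Integrable H F) (henv : ∀ᵐ x ∂F, Envelope g θ₀ ρ H x) :
    Integrable (fun x => g x θ₀) F := by
  refine Integrable.mono' ((integrable_const (1 : ℝ)).add hH) (hgm θ₀).aestronglyMeasurable ?_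
  filter_upwards [henv] with x hx
  exact (self_le_one_add_cube (norm_nonneg _)).trans
    (add_le_add_right (hx.cube_le θ₀ (Metric.mem_closedBall_self hρ.le)) 1)

theorem integrable_outer [IsFiniteMeasure F] (hgm : ∀ θ, Measurable fun x => g x θ) (hρ : 0 < ρ)
    (hH : Integrable H F) (henv : ∀ᵐ x ∂F, Envelope g θ₀ ρ H x) :
    Integrable (fun x => outer (g x θ₀)) F := by
  refine Integrable.mono' ((integrable_const (1 : ℝ)).add hH)
    (continuous_outer.comp_aestronglyMeasurable (hgm θ₀).aestronglyMeasurable) ?_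
  filter_upwards [henv] with x hx
  exact (norm_outer _).trans ((sq_le_one_add_cube (norm_nonneg _)).trans
    (add_le_add_right (hx.cube_le θ₀ (Metric.mem_closedBall_self hρ.le)) 1))

theorem integrable_fderiv (hgm : ∀ θ, Measurable fun x => g x θ) (hρ : 0 < ρ)
    (hH : Integrable H F) (henv : ∀ᵐ x ∂F, Envelope g θ₀ ρ H x) :
    Integrable (fun x => fderiv ℝ (g x) θ₀) F := by
  -- Measurability in `x` is given only at fixed `θ`, so directional derivatives are obtained as
  -- almost everywhere limits of difference quotients, and the derivative is rebuilt from its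
  -- columns.
  have hmeas : ∀ v : E p, AEStronglyMeasurable (fun x => fderiv ℝ (g x) θ₀ v) F := by
    intro v
    refine aestronglyMeasurable_of_tendsto_ae atTop
      (f := fun (m : ℕ) x => (m : ℝ) • (g x (θ₀ + (m : ℝ)⁻¹ • v) - g x θ₀))
      (fun m => (((hgm (θ₀ + (m : ℝ)⁻¹ • v)).sub (hgm θ₀)).const_smul (m : ℝ)).aestronglyMeasurable) ?_
    filter_upwards [henv] with x hx
    refine (hx.differentiableAt θ₀ (Metric.mem_closedBall_self hρ.le)).hasFDerivAt.lim v ?_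
    simpa using tendsto_natCast_atTop_atTop (R := ℝ)
  refine Integrable.mono' hH ?_ ?_
  · have : (fun x => fderiv ℝ (g x) θ₀) = fun x => ∑ j, (ContinuousLinearMap.smulRightL ℝ (E p) (E p)
        (EuclideanSpace.proj j : E p →L[ℝ] ℝ)) (fderiv ℝ (g x) θ₀ (EuclideanSpace.single j 1)) := by
      funext x
      exact clm_eq_sum_smulRight _
    rw [this]
    exact Finset.aestronglyMeasurable_fun_sum _ fun j _ =>
      (ContinuousLinearMap.continuous _).comp_aestronglyMeasurable (hmeas _)
  · filter_upwards [henv] with x hx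
    exact hx.fderiv_le θ₀ (Metric.mem_closedBall_self hρ.le)

theorem inner_integral_outer (hint : Integrable (fun x => outer (g x θ₀)) F) (u v : E p) :
    ⟪v, (∫ x, outer (g x θ₀) ∂F) u⟫_ℝ = ∫ x, ⟪u, g x θ₀⟫_ℝ * ⟪v, g x θ₀⟫_ℝ ∂F := by
  rw [ContinuousLinearMap.integral_apply hint]
  have h1 := ((innerSL ℝ v).integral_comp_comm (hint.apply_continuousLinearMap u)).symm
  simp only [innerSL_apply_apply] at h1
  rw [h1]
  simp only [outer_apply, real_inner_smul_right]

theorem inner_integral_outer_pos (hg : RegularAt F g θ₀)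
    (hint : Integrable (fun x => outer (g x θ₀)) F) (u : E p) (hu : u ≠ 0) :
    0 < ⟪u, (∫ x, outer (g x θ₀) ∂F) u⟫_ℝ := by
  set S := ∫ x, outer (g x θ₀) ∂F with hS
  have hentry : ∀ i j, S (EuclideanSpace.single j 1) i = S11 F g θ₀ i j := by
    intro i j
    have h := inner_integral_outer hint (EuclideanSpace.single j 1) (EuclideanSpace.single i 1)
    simp only [EuclideanSpace.inner_single_left, map_one, one_mul] at h
    rw [hS, h]
    simp [S11, mul_comm]
  have h1 := hg.posDef_S11.dotProduct_mulVec_pos (x := u.ofLp) (by simpa using hu)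
  have h2 : ∀ i, S u i = ∑ j, S11 F g θ₀ i j * u j := by
    intro i
    conv_lhs => rw [clm_eq_sum_smulRight S]
    simp [hentry, mul_comm]
  rw [PiLp.inner_apply]
  simp only [dotProduct, Matrix.mulVec, star_trivial] at h1
  refine h1.trans_eq (Finset.sum_congr rfl fun i _ => ?_)
  rw [h2]
  simp [mul_comm]

theorem injective_integral_fderiv (hg : RegularAt F g θ₀)
    (hint : Integrable (fun x => fderiv ℝ (g x) θ₀) F) :
    Function.Injective (∫ x, fderiv ℝ (g x) θ₀ ∂F : E p →L[ℝ] E p) := by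
  have hr := range_eq_top_of_rank (T := ∫ x, fderiv ℝ (g x) θ₀ ∂F) (J := S12 F g θ₀)
    (fun i j => by
      rw [ContinuousLinearMap.integral_apply hint]
      exact ((EuclideanSpace.proj i : E p →L[ℝ] ℝ).integral_comp_comm
        (hint.apply_continuousLinearMap _)).symm) hg.rank_S12
  exact (LinearMap.injective_iff_surjective (f := ((∫ x, fderiv ℝ (g x) θ₀ ∂F : E p →L[ℝ] E p) :
    E p →ₗ[ℝ] E p))).2 (LinearMap.range_eq_top.1 hr)

end

/-! ### Regularity of arrays of samples -/

/-- Averages at the single point `θ₀` suffice, because the envelope carries them over the ball. The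
constant `B + 1` stems from `‖g‖² ≤ 1 + ‖g‖³ ≤ 1 + H`. -/
theorem regularArray_of_tendsto {ι : Type*} {L : Filter ι} {n : ι → ℕ} {k p : ℕ}
    {x : ∀ a, Fin (n a) → E k} {g : E k → E p → E p} {θ₀ : E p} {S D W : E p →L[ℝ] E p}
    {ρ B σ κ : ℝ} {H : E k → ℝ} (hn : Tendsto n L atTop) (hρ : 0 < ρ) (hB : 0 ≤ B)
    (hσ : 0 < σ) (hκ : 0 < κ) (hsmall : (B + 1) * ρ ≤ κ / 4)
    (henv : ∀ᶠ a in L, ∀ i, Envelope g θ₀ ρ H (x a i))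
    (havg : ∀ᶠ a in L, (n a : ℝ)⁻¹ • ∑ i, H (x a i) ≤ B)
    (hmax : ∀ δ > 0, ∀ᶠ a in L, ∀ i, H (x a i) ≤ δ * n a)
    (hS : Tendsto (fun a => (n a : ℝ)⁻¹ • ∑ i, outer (g (x a i) θ₀)) L (𝓝 S))
    (hD : Tendsto (fun a => (n a : ℝ)⁻¹ • ∑ i, fderiv ℝ (g (x a i)) θ₀) L (𝓝 D))
    (hSpos : ∀ u, σ * ‖u‖ ^ 2 ≤ ⟪u, S u⟫_ℝ) (hDinj : ∀ u, κ * ‖u‖ ≤ ‖D u‖)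
    (hW : ∀ u, ‖W (S u)‖ ^ 2 = ⟪u, S u⟫_ℝ) :
    RegularArray L x g θ₀ S D W ρ (B + 1) σ κ := by
  have hθ₀ : θ₀ ∈ Metric.closedBall θ₀ ρ := Metric.mem_closedBall_self hρ.le
  have hsum : ∀ᶠ a in L, ∑ i, H (x a i) ≤ B * n a := by
    filter_upwards [havg, hn.eventually_gt_atTop 0] with a ha hna
    have hna' : (0 : ℝ) < n a := by exact_mod_cast hna
    rwa [smul_eq_mul, inv_mul_eq_div, div_le_iff₀ hna'] at ha
  refine ⟨hn, hρ, by positivity, hσ, hκ, hsmall, fun ε hε => ?_, ?_, ?_, fun ε hε => ?_,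
    fun ε hε => ?_, hSpos, hDinj, hW⟩
  · filter_upwards [henv, hmax (ε ^ 3) (by positivity), hn.eventually_gt_atTop 0]
      with a h1 h2 hna θ hθ i
    have hna' : (1 : ℝ) ≤ n a := by exact_mod_cast hna
    have hs : 1 ≤ √(n a : ℝ) := Real.one_le_sqrt.2 hna'
    refine le_of_pow_le_pow_left₀ (by norm_num : 3 ≠ 0) (by positivity) ?_
    calc ‖g (x a i) θ‖ ^ 3 ≤ ε ^ 3 * n a := ((h1 i).cube_le θ hθ).trans (h2 i)
      _ = ε ^ 3 * √(n a : ℝ) ^ 2 := by rw [Real.sq_sqrt (by positivity)]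
      _ ≤ ε ^ 3 * √(n a : ℝ) ^ 3 := by
          gcongr
          norm_num
      _ = (ε * √(n a : ℝ)) ^ 3 := by ring
  · filter_upwards [henv, hsum] with a h1 h2 θ hθ
    calc ∑ i, ‖g (x a i) θ‖ ^ 2 ≤ ∑ i, (1 + H (x a i)) := Finset.sum_le_sum fun i _ =>
          (sq_le_one_add_cube (norm_nonneg _)).trans (add_le_add_right ((h1 i).cube_le θ hθ) 1)
      _ = n a + ∑ i, H (x a i) := by simp [Finset.sum_add_distrib]
      _ ≤ (B + 1) * n a := by linarith
  · filter_upwards [henv, hsum] with a h1 h2 θ hθ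
    calc ∑ i, ‖g (x a i) θ - g (x a i) θ₀‖ ≤ ∑ i, H (x a i) * ‖θ - θ₀‖ :=
          Finset.sum_le_sum fun i _ =>
            (convex_closedBall θ₀ ρ).norm_image_sub_le_of_norm_fderiv_le (𝕜 := ℝ)
              (h1 i).differentiableAt (h1 i).fderiv_le hθ₀ hθ
      _ = (∑ i, H (x a i)) * ‖θ - θ₀‖ := by rw [Finset.sum_mul]
      _ ≤ (B + 1) * n a * ‖θ - θ₀‖ := by
          gcongr
          linarith [(Nat.cast_nonneg (n a) : (0 : ℝ) ≤ n a)]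
  · filter_upwards [(tendsto_iff_norm_sub_tendsto_zero.1 hS).eventually_lt_const hε] with a ha u
    have h1 := ContinuousLinearMap.le_opNorm
      ((n a : ℝ)⁻¹ • ∑ i, outer (g (x a i) θ₀) - S) u
    simp only [sub_apply, smul_apply, sum_apply, outer_apply] at h1
    exact h1.trans (by gcongr)
  · filter_upwards [(tendsto_iff_norm_sub_tendsto_zero.1 hD).eventually_lt_const hε, henv, hsum,
      hn.eventually_gt_atTop 0] with a ha h1 h2 hna r hr θ hθ θ' hθ'
    have hna' : (0 : ℝ) < n a := by exact_mod_cast hna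
    have hsub := Metric.closedBall_subset_closedBall (x := θ₀) hr
    have hr0 : 0 ≤ r := dist_nonneg.trans (Metric.mem_closedBall.1 hθ)
    -- The derivative of the sample mean differs from `D` by `ε` at `θ₀` and by a further `B r` on
    -- the ball; the mean value inequality does the rest.
    refine (convex_closedBall θ₀ r).norm_image_sub_le_of_norm_hasFDerivWithin_le'
      (f' := fun ξ => (n a : ℝ)⁻¹ • ∑ i, fderiv ℝ (g (x a i)) ξ) (fun ξ hξ => ?_)
      (fun ξ hξ => ?_) hθ' hθ
    · have : HasFDerivAt (fun ξ => ∑ i, g (x a i) ξ) (∑ i, fderiv ℝ (g (x a i)) ξ) ξ :=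
        HasFDerivAt.fun_sum fun i _ => ((h1 i).differentiableAt ξ (hsub hξ)).hasFDerivAt
      exact (this.const_smul (n a : ℝ)⁻¹).hasFDerivWithinAt
    · have h3 : (n a : ℝ)⁻¹ • ∑ i, fderiv ℝ (g (x a i)) ξ - D
          = ((n a : ℝ)⁻¹ • ∑ i, fderiv ℝ (g (x a i)) θ₀ - D)
            + (n a : ℝ)⁻¹ • ∑ i, (fderiv ℝ (g (x a i)) ξ - fderiv ℝ (g (x a i)) θ₀) := by
        rw [Finset.sum_sub_distrib, smul_sub]
        abel
      have hξr : ‖ξ - θ₀‖ ≤ r := by simpa [dist_eq_norm] using hξ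
      have h4 : ‖∑ i, (fderiv ℝ (g (x a i)) ξ - fderiv ℝ (g (x a i)) θ₀)‖ ≤ B * n a * r := by
        calc _ ≤ ∑ i, ‖fderiv ℝ (g (x a i)) ξ - fderiv ℝ (g (x a i)) θ₀‖ := norm_sum_le _ _
          _ ≤ ∑ i, H (x a i) * r := Finset.sum_le_sum fun i _ =>
              ((h1 i).fderiv_lip ξ (hsub hξ) θ₀ hθ₀).trans
                (mul_le_mul_of_nonneg_left hξr ((h1 i).nonneg hρ.le))
          _ = (∑ i, H (x a i)) * r := by rw [Finset.sum_mul]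
          _ ≤ _ := by gcongr
      rw [h3]
      refine (norm_add_le _ _).trans ?_
      rw [norm_smul, Real.norm_of_nonneg (by positivity)]
      calc _ ≤ ε + (n a : ℝ)⁻¹ * (B * n a * r) := by gcongr
        _ = ε + B * r := by field_simp
        _ ≤ ε + (B + 1) * r := by linarith

/-! ### The central limit theorem in several dimensions -/

section

variable {Ω : Type*} [MeasurableSpace Ω] {μ : Measure Ω} {k q : ℕ}
  {X : ℕ → Ω → E k} {F : Measure (E k)}

theorem aemeasurable_normalized_sum (hXm : ∀ i, AEMeasurable (X i) μ) {Y : E k → E q}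
    (hY : Measurable Y) (n : ℕ) :
    AEMeasurable (fun ω => (√(n : ℝ))⁻¹ • ∑ i ∈ Finset.range n, Y (X i ω)) μ :=
  (Finset.aemeasurable_fun_sum (f := fun i ω => Y (X i ω)) _ fun i _ =>
    hY.comp_aemeasurable (hXm i)).const_smul (√(n : ℝ))⁻¹

variable [IsProbabilityMeasure μ]

/-- The central limit theorem for standardized random vectors. -/
theorem tendstoInDistribution_stdGaussian (hXm : ∀ i, AEMeasurable (X i) μ)
    (hXind : iIndepFun X μ) (hXlaw : ∀ i, μ.map (X i) = F) {Y : E k → E q} (hY : Measurable Y)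
    (hY2 : MemLp Y 2 F) (hmean : ∀ w, ∫ x, ⟪w, Y x⟫_ℝ ∂F = 0)
    (hvar : ∀ w, ∫ x, ⟪w, Y x⟫_ℝ ^ 2 ∂F = ‖w‖ ^ 2) :
    TendstoInDistribution (fun (n : ℕ) ω => (√(n : ℝ))⁻¹ • ∑ i ∈ Finset.range n, Y (X i ω)) atTop
      (id : E q → E q) (fun _ => μ) (stdGaussian (E q)) where
  forall_aemeasurable n := aemeasurable_normalized_sum hXm hY n
  tendsto := by
    -- Cramér–Wold: the characteristic function at `t` is that of the projection on `t` at `1`, and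
    -- the scalar theorem applies with variance `‖t‖²`.
    refine ProbabilityMeasure.tendsto_iff_tendsto_charFun.2 fun t => ?_
    have hYt : Measurable fun x => ⟪t, Y x⟫_ℝ := hY.const_inner
    have htrans : ∀ f : E k → ℝ, Measurable f → ∫ ω, f (X 0 ω) ∂μ = ∫ x, f x ∂F := by
      intro f hf
      rw [← hXlaw 0, integral_map (hXm 0) hf.aestronglyMeasurable]
    have hm0 : ∫ ω, ⟪t, Y (X 0 ω)⟫_ℝ ∂μ = 0 := by
      rw [htrans _ hYt, hmean]
    have hv0 : Var[fun ω => ⟪t, Y (X 0 ω)⟫_ℝ; μ] = ‖t‖ ^ 2 := by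
      rw [variance_of_integral_eq_zero (X := fun ω => ⟪t, Y (X 0 ω)⟫_ℝ)
        (hYt.comp_aemeasurable (hXm 0)) hm0, htrans _ (hYt.pow_const 2), hvar]
    have hL2 : MemLp (fun ω => ⟪t, Y (X 0 ω)⟫_ℝ) 2 μ := by
      have h1 : MemLp (fun x => ⟪t, Y x⟫_ℝ) 2 F := hY2.const_inner t
      rw [← hXlaw 0] at h1
      exact h1.comp_of_map (hXm 0)
    have hclt := tendstoInDistribution_inv_sqrt_mul_sum_sub (P := μ)
      (X := fun i ω => ⟪t, Y (X i ω)⟫_ℝ) (Y := (id : ℝ → ℝ))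
      (P' := gaussianReal 0 (Var[fun ω => ⟪t, Y (X 0 ω)⟫_ℝ; μ]).toNNReal)
      ⟨aemeasurable_id, Measure.map_id⟩ hL2
      (hXind.comp (fun _ x => ⟪t, Y x⟫_ℝ) fun _ => hYt)
      (fun i => identDistrib_comp hXm hXlaw hYt.aemeasurable i)
    have h1 := ProbabilityMeasure.tendsto_iff_tendsto_charFun.1 hclt.tendsto 1
    simp only [ProbabilityMeasure.coe_mk, Measure.map_id, charFun_gaussianReal] at h1 ⊢
    rw [charFun_stdGaussian]
    have hlim : (Complex.exp (((1 : ℝ) : ℂ) * ((0 : ℝ) : ℂ) * Complex.I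
        - ((Var[fun ω => ⟪t, Y (X 0 ω)⟫_ℝ; μ]).toNNReal : ℝ) * ((1 : ℝ) : ℂ) ^ 2 / 2))
        = Complex.exp (-(‖t‖ : ℂ) ^ 2 / 2) := by
      rw [hv0, Real.coe_toNNReal _ (by positivity)]
      congr 1
      push_cast
      ring
    rw [← hlim]
    refine h1.congr fun n => ?_
    rw [charFun_apply, charFun_apply,
      integral_map (aemeasurable_normalized_sum hXm hY n) (by fun_prop),
      integral_map (hclt.forall_aemeasurable n) (by fun_prop)]
    refine integral_congr_ae (Eventually.of_forall fun ω => ?_)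
    simp only [hm0, mul_zero, sub_zero]
    congr 2
    rw [real_inner_smul_left, sum_inner, real_inner_comm]
    simp [real_inner_comm]

/-- A sequence of random vectors which converges in law to the standard normal law is
stochastically bounded. -/
theorem exists_bound_of_tendstoInDistribution {Z : ℕ → Ω → E q}
    (hZ : TendstoInDistribution Z atTop (id : E q → E q) (fun _ => μ) (stdGaussian (E q)))
    {δ : ENNReal} (hδ : 0 < δ) : ∃ M, ∀ᶠ n in atTop, μ {ω | ¬ ‖Z n ω‖ ≤ M} ≤ δ := by
  obtain ⟨δ', hδ'0, hδ'⟩ := exists_between hδ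
  obtain ⟨C, hC, hCδ⟩ := isTightMeasureSet_iff_exists_isCompact_measure_compl_le.1
    (isTightMeasureSet_singleton (μ := stdGaussian (E q))) δ' hδ'0
  obtain ⟨M, hM⟩ := hC.isBounded.exists_norm_le
  refine ⟨M + 1, ?_⟩
  have hclosed : IsClosed {z : E q | M + 1 ≤ ‖z‖} := isClosed_le continuous_const continuous_norm
  -- Portmanteau for a closed set that misses a compact set carrying almost all of the limiting
  -- mass.
  have hlim := ProbabilityMeasure.limsup_measure_closed_le_of_tendsto hZ.tendsto hclosed
  have hlt : stdGaussian (E q) {z : E q | M + 1 ≤ ‖z‖} < δ := by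
    refine ((measure_mono fun z hz => ?_).trans (hCδ _ rfl)).trans_lt hδ'
    intro hzC
    have h1 := hM z hzC
    have h2 : M + 1 ≤ ‖z‖ := hz
    linarith
  simp only [ProbabilityMeasure.coe_mk, Measure.map_id] at hlim
  filter_upwards [eventually_lt_of_limsup_lt (hlim.trans_lt hlt)] with n hn
  rw [Measure.map_apply_of_aemeasurable (hZ.forall_aemeasurable n) hclosed.measurableSet] at hn
  exact (measure_mono fun ω hω => (not_le.1 hω).le).trans hn.le

theorem map_norm_sq_stdGaussian (q : ℕ) :
    (stdGaussian (E q)).map (fun z => ‖z‖ ^ 2) = chiSquared q := by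
  rw [← map_pi_eq_stdGaussian, Measure.map_map (by fun_prop) (by fun_prop), chiSquared]
  congr 1
  funext z
  simp [EuclideanSpace.real_norm_sq_eq]

theorem tendstoInDistribution_norm_sq {Z : ℕ → Ω → E q}
    (hZ : TendstoInDistribution Z atTop (id : E q → E q) (fun _ => μ) (stdGaussian (E q))) :
    TendstoInDistribution (fun n ω => ‖Z n ω‖ ^ 2) atTop (id : ℝ → ℝ) (fun _ => μ)
      (chiSquared q) := by
  have h := hZ.continuous_comp (g := fun z : E q => ‖z‖ ^ 2) (by fun_prop)
  refine ⟨h.forall_aemeasurable, aemeasurable_id, ?_⟩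
  convert! h.tendsto using 2
  refine congrArg 𝓝 (Subtype.ext ?_)
  change (chiSquared q).map id = (stdGaussian (E q)).map (fun z => ‖z‖ ^ 2)
  rw [Measure.map_id, map_norm_sq_stdGaussian]

end

/-! ### Existence of maximum empirical likelihood estimates -/

/-- On a compact set which contains a parameter value of positive likelihood, the empirical
likelihood attains its maximum. -/
theorem exists_isMELE {k p r n : ℕ} (hn : 0 < n) {g : E k → E p → E r} {x : Fin n → E k}
    {A : Set (E p)} (hA : IsCompact A) (hg : ∀ i, ContinuousOn (g (x i)) A) {θ₀ : E p}
    (hθ₀ : θ₀ ∈ A) {w₀ : Fin n → ℝ} (hw₀ : w₀ ∈ feasibleWeights g x θ₀) (hpos : ∀ i, 0 < w₀ i) :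
    ∃ θ, IsMELE g x A θ := by
  -- Maximizing jointly over parameter and weights needs only that the feasible pairs form a compact
  -- set, not continuity of `empLik`.
  set B : Set (E p × (Fin n → ℝ)) := A ×ˢ stdSimplex ℝ (Fin n) with hB
  have hBc : IsCompact B := hA.prod (isCompact_stdSimplex ℝ (Fin n))
  have hcont : ContinuousOn (fun z : E p × (Fin n → ℝ) => ∑ i, z.2 i • g (x i) z.1) B := by
    refine continuousOn_finsetSum _ fun i _ => ?_
    have h2 : Continuous fun z : E p × (Fin n → ℝ) => z.2 i := by fun_prop
    exact h2.continuousOn.smul ((hg i).comp continuousOn_fst fun z hz => hz.1)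
  set P : Set (E p × (Fin n → ℝ)) := B ∩ (fun z => ∑ i, z.2 i • g (x i) z.1) ⁻¹' {0} with hP
  have hPc : IsCompact P := hBc.of_isClosed_subset
    (hcont.preimage_isClosed_of_isClosed hBc.isClosed isClosed_singleton) Set.inter_subset_left
  have hmem : ∀ θ w, (θ, w) ∈ P ↔ θ ∈ A ∧ w ∈ feasibleWeights g x θ := fun θ w =>
    ⟨fun h => ⟨h.1.1, h.1.2.1, h.1.2.2, h.2⟩, fun h => ⟨⟨h.1, h.2.1, h.2.2.1⟩, h.2.2.2⟩⟩
  obtain ⟨⟨θ, w⟩, hθw, hmax⟩ := hPc.exists_isMaxOn ⟨(θ₀, w₀), (hmem _ _).2 ⟨hθ₀, hw₀⟩⟩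
    (f := fun z => ∏ i, z.2 i) (by fun_prop)
  have hle : ∀ θ' ∈ A, ∀ w' ∈ feasibleWeights g x θ', ∏ i, w' i ≤ ∏ i, w i := fun θ' h1 w' h2 =>
    hmax (show (θ', w') ∈ P from (hmem _ _).2 ⟨h1, h2⟩)
  obtain ⟨h1, h2⟩ := (hmem _ _).1 hθw
  have hlik : empLik g x θ = ∏ i, w i := empLik_eq_of_isELWeights ⟨h2, hle θ h1⟩
  have hpos' : 0 < ∏ i, w i :=
    (Finset.prod_pos fun i _ => hpos i).trans_le (hle θ₀ hθ₀ w₀ hw₀)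
  refine ⟨θ, h1, by rwa [hlik], fun θ' h' => ?_⟩
  rcases le_or_gt (empLik g x θ') 0 with h0 | h0
  · exact h0.trans (by rw [hlik]; exact hpos'.le)
  · rw [hlik]
    exact hle θ' h' _ (elWeights_feasible_of_pos hn h0).1

/-- A weighted version of the operator `v vᵀ`, of norm at most `‖v‖`. -/
def dampedOuter {p : ℕ} (v : E p) : E p →L[ℝ] E p := (1 + ‖v‖)⁻¹ • outer v

theorem dampedOuter_apply {p : ℕ} (v u : E p) :
    dampedOuter v u = ((1 + ‖v‖)⁻¹ * ⟪u, v⟫_ℝ) • v := by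
  rw [dampedOuter, smul_apply, outer_apply, smul_smul]

theorem integrable_dampedOuter {k p : ℕ} {F : Measure (E k)} {f : E k → E p}
    (hf : Measurable f) (hint : Integrable (fun x => outer (f x)) F) :
    Integrable (fun x => dampedOuter (f x)) F := by
  refine hint.mono ?_ (Eventually.of_forall fun x => ?_)
  · refine Continuous.comp_aestronglyMeasurable (g := dampedOuter) ?_ hf.aestronglyMeasurable
    have h1 : Continuous fun v : E p => 1 + ‖v‖ := by fun_prop
    exact (h1.inv₀ fun v => by positivity).smul continuous_outer
  · rw [dampedOuter, norm_smul, norm_inv, Real.norm_of_nonneg (by positivity)]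
    have : (1 + ‖f x‖)⁻¹ ≤ 1 := inv_le_one_of_one_le₀ (by linarith [norm_nonneg (f x)])
    exact mul_le_of_le_one_left (norm_nonneg _) this

/-- The damping factor never vanishes, so a zero integral would force `⟪u, f⟫ = 0` almost
everywhere, against the undamped positivity. -/
theorem inner_integral_dampedOuter_pos {k p : ℕ} {F : Measure (E k)} {f : E k → E p}
    (hf : Measurable f) (hint : Integrable (fun x => outer (f x)) F)
    (hpos : ∀ u, u ≠ 0 → 0 < ⟪u, (∫ x, outer (f x) ∂F) u⟫_ℝ) (u : E p) (hu : u ≠ 0) :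
    0 < ⟪u, (∫ x, dampedOuter (f x) ∂F) u⟫_ℝ := by
  have hdi := integrable_dampedOuter hf hint
  have h1 : ⟪u, (∫ x, dampedOuter (f x) ∂F) u⟫_ℝ
      = ∫ x, (1 + ‖f x‖)⁻¹ * ⟪u, f x⟫_ℝ ^ 2 ∂F := by
    rw [ContinuousLinearMap.integral_apply hdi]
    have h := ((innerSL ℝ u).integral_comp_comm (hdi.apply_continuousLinearMap u)).symm
    simp only [innerSL_apply_apply] at h
    rw [h]
    refine integral_congr_ae (Eventually.of_forall fun x => ?_)
    simp only [dampedOuter_apply, real_inner_smul_right]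
    ring
  have hnonneg : ∀ x, 0 ≤ (1 + ‖f x‖)⁻¹ * ⟪u, f x⟫_ℝ ^ 2 := fun x => by positivity
  have hint' : Integrable (fun x => (1 + ‖f x‖)⁻¹ * ⟪u, f x⟫_ℝ ^ 2) F := by
    have h := (innerSL ℝ u).integrable_comp (hdi.apply_continuousLinearMap u)
    refine h.congr (Eventually.of_forall fun x => ?_)
    simp only [innerSL_apply_apply, dampedOuter_apply, real_inner_smul_right]
    ring
  rw [h1]
  refine (integral_nonneg hnonneg).lt_of_ne fun heq => ?_
  have hae := (integral_eq_zero_iff_of_nonneg hnonneg hint').1 heq.symm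
  have h2 := hpos u hu
  have h3 := inner_integral_outer (g := fun x _ => f x) (θ₀ := (0 : E p)) hint u u
  rw [h3, integral_eq_zero_of_ae] at h2
  · exact lt_irrefl _ h2
  · filter_upwards [hae] with x hx
    have h4 : (1 + ‖f x‖)⁻¹ ≠ 0 := by positivity
    have h5 : ⟪u, f x⟫_ℝ = 0 := by
      have := (mul_eq_zero.1 hx).resolve_left h4
      exact pow_eq_zero_iff (two_ne_zero) |>.1 this
    simp [h5]

/-- If the mean of vectors is small in comparison with their damped second moments, then some
strictly positive weights centre them. -/
theorem exists_pos_feasibleWeights {k p n : ℕ} (hn : 0 < n) {g : E k → E p → E p}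
    {x : Fin n → E k} {θ₀ : E p} {σ : ℝ} (hσ : 0 < σ)
    (hd : ∀ u, σ * ‖u‖ ^ 2 ≤ ⟪u, ((n : ℝ)⁻¹ • ∑ i, dampedOuter (g (x i) θ₀)) u⟫_ℝ)
    (hm : ‖estMean g x θ₀‖ ≤ σ / 2) :
    ∃ w ∈ feasibleWeights g x θ₀, ∀ i, 0 < w i := by
  have hn' : (0 : ℝ) < n := by exact_mod_cast hn
  set T : E p →L[ℝ] E p := (n : ℝ)⁻¹ • ∑ i, dampedOuter (g (x i) θ₀) with hT
  have hinj : Function.Injective T := by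
    refine (injective_iff_map_eq_zero T).2 fun u hu => ?_
    have := hd u
    rw [hu, inner_zero_right] at this
    have h2 : ‖u‖ ^ 2 ≤ 0 := by
      by_contra hcon
      nlinarith [not_le.1 hcon]
    have h3 : ‖u‖ ^ 2 = 0 := le_antisymm h2 (sq_nonneg _)
    simpa using h3
  -- Solving `T a = -ḡ` centres the weighted sum, and coercivity gives `‖a‖ ≤ (σ/2)/σ = 1/2`.
  obtain ⟨a, ha⟩ := (LinearMap.injective_iff_surjective (f := (T : E p →ₗ[ℝ] E p))).1 hinj
    (-estMean g x θ₀)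
  have ha' : T a = -estMean g x θ₀ := ha
  have hanorm : ‖a‖ ≤ 1 / 2 := by
    have h1 := hd a
    rw [ha'] at h1
    have h2 := real_inner_le_norm a (-estMean g x θ₀)
    rw [norm_neg] at h2
    rcases (norm_nonneg a).eq_or_lt with h0 | h0
    · rw [← h0]; norm_num
    · have h3 : ‖a‖ * ‖estMean g x θ₀‖ ≤ ‖a‖ * (σ / 2) := by gcongr
      have h4 : σ * ‖a‖ * ‖a‖ ≤ σ * (1 / 2) * ‖a‖ := by nlinarith
      have h5 := le_of_mul_le_mul_right h4 h0
      exact le_of_mul_le_mul_left h5 hσ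
  -- Damping keeps each weight within `‖a‖ ≤ 1/2` of `1`, however large `g` is, so positivity needs
  -- no bound on the largest observation.
  set v : Fin n → ℝ := fun i => 1 + (1 + ‖g (x i) θ₀‖)⁻¹ * ⟪a, g (x i) θ₀⟫_ℝ with hv
  have hvpos : ∀ i, 0 < v i := by
    intro i
    have h1 : |(1 + ‖g (x i) θ₀‖)⁻¹ * ⟪a, g (x i) θ₀⟫_ℝ| ≤ 1 / 2 := by
      rw [abs_mul, abs_of_pos (by positivity), inv_mul_eq_div, div_le_iff₀ (by positivity)]
      refine (abs_real_inner_le_norm _ _).trans ?_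
      gcongr
      linarith
    have := (abs_le.1 h1).1
    simp only [hv]
    linarith
  have hsum : ∑ i, v i • g (x i) θ₀ = 0 := by
    have h1 : ∑ i, v i • g (x i) θ₀ = (n : ℝ) • (estMean g x θ₀ + T a) := by
      rw [estMean, hT, smul_apply, ← smul_add, smul_smul, mul_inv_cancel₀ hn'.ne', one_smul,
        sum_apply, ← Finset.sum_add_distrib]
      refine Finset.sum_congr rfl fun i _ => ?_
      rw [dampedOuter_apply, hv]
      module
    rw [h1, ha', add_neg_cancel, smul_zero]
  have : Nonempty (Fin n) := ⟨⟨0, hn⟩⟩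
  have hV : 0 < ∑ i, v i := Finset.sum_pos (fun i _ => hvpos i) Finset.univ_nonempty
  clear_value v
  refine ⟨fun i => (∑ j, v j)⁻¹ * v i,
    ⟨fun i => mul_nonneg (inv_nonneg.2 hV.le) (hvpos i).le, ?_, ?_⟩,
    fun i => mul_pos (inv_pos.2 hV) (hvpos i)⟩
  · rw [← Finset.mul_sum, inv_mul_cancel₀ hV.ne']
  · simp_rw [mul_smul]
    rw [← Finset.smul_sum, hsum, smul_zero]

/-- Almost surely, all large samples admit strictly positive feasible weights at `θ₀`. -/
theorem ae_eventually_exists_pos_feasibleWeights {Ω : Type*} [MeasurableSpace Ω] {μ : Measure Ω}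
    {k p : ℕ} {X : ℕ → Ω → E k} {F : Measure (E k)}
    (hXm : ∀ i, AEMeasurable (X i) μ) (hXind : iIndepFun X μ) (hXlaw : ∀ i, μ.map (X i) = F)
    {g : E k → E p → E p} (hgm : ∀ θ, Measurable fun x => g x θ) {θ₀ : E p}
    (hθ₀ : ∫ x, g x θ₀ ∂F = 0) (hg : RegularAt F g θ₀)
    (hint : Integrable (fun x => g x θ₀) F) (hout : Integrable (fun x => outer (g x θ₀)) F) :
    ∀ᵐ ω ∂μ, ∀ᶠ n in atTop, ∃ w ∈ feasibleWeights g (sample X n ω) θ₀, ∀ i, 0 < w i := by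
  obtain ⟨σ, hσ, hσ'⟩ := exists_pos_le_inner
    (inner_integral_dampedOuter_pos (hgm θ₀) hout (inner_integral_outer_pos hg hout))
  filter_upwards [ae_tendsto_avg hXm hXind hXlaw hint,
    ae_tendsto_avg hXm hXind hXlaw (integrable_dampedOuter (hgm θ₀) hout)] with ω h1 h2
  rw [hθ₀] at h1
  have h1' := h1.norm
  rw [norm_zero] at h1'
  filter_upwards [h1'.eventually_lt_const (by positivity : 0 < σ / 2 / 2),
    (tendsto_iff_norm_sub_tendsto_zero.1 h2).eventually_lt_const (half_pos hσ),
    eventually_gt_atTop 0] with n h3 h4 hn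
  refine exists_pos_feasibleWeights hn (half_pos hσ) (fun u => ?_) h3.le
  set T := (n : ℝ)⁻¹ • ∑ i, dampedOuter (g (sample X n ω i) θ₀)
  have h5 := hσ' u
  have h6 := real_inner_le_norm u (((∫ x, dampedOuter (g x θ₀) ∂F) - T) u)
  have h7 := ContinuousLinearMap.le_opNorm ((∫ x, dampedOuter (g x θ₀) ∂F) - T) u
  rw [norm_sub_rev] at h4
  rw [sub_apply, inner_sub_right] at h6
  rw [sub_apply] at h7
  have h8 : ‖u‖ * ‖(∫ x, dampedOuter (g x θ₀) ∂F) u - T u‖ ≤ ‖u‖ * (σ / 2 * ‖u‖) := by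
    gcongr
    exact h7.trans (by gcongr)
  nlinarith

/-! ### Asymptotic normality of the rescaled sample mean -/

section

variable {Ω : Type*} [MeasurableSpace Ω] {μ : Measure Ω} [IsProbabilityMeasure μ] {k p q : ℕ}
  {X : ℕ → Ω → E k} {F : Measure (E k)} {g : E k → E p → E p} {θ₀ : E p}

theorem memLp_two_of_integrable_outer {f : E k → E p} (hf : Measurable f)
    (hout : Integrable (fun x => outer (f x)) F) : MemLp f 2 F := by
  rw [memLp_two_iff_integrable_sq_norm hf.aestronglyMeasurable]
  refine hout.norm.congr (Eventually.of_forall fun x => ?_)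
  simp only
  rw [outer, ContinuousLinearMap.norm_smulRight_apply, innerSL_apply_norm, sq]

theorem tendstoInDistribution_of_standardizing (hXm : ∀ i, AEMeasurable (X i) μ)
    (hXind : iIndepFun X μ) (hXlaw : ∀ i, μ.map (X i) = F)
    (hgm : ∀ θ, Measurable fun x => g x θ) (hθ₀ : ∫ x, g x θ₀ ∂F = 0)
    (hint : Integrable (fun x => g x θ₀) F) (hout : Integrable (fun x => outer (g x θ₀)) F)
    {A : E p →L[ℝ] E q} (hA : ∀ w, ∃ u, (∀ z, ⟪w, A z⟫_ℝ = ⟪u, z⟫_ℝ) ∧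
      ⟪u, (∫ x, outer (g x θ₀) ∂F) u⟫_ℝ = ‖w‖ ^ 2) :
    TendstoInDistribution
      (fun (n : ℕ) ω => A (√(n : ℝ) • estMean g (sample X n ω) θ₀)) atTop
      (id : E q → E q) (fun _ => μ) (stdGaussian (E q)) := by
  have h := tendstoInDistribution_stdGaussian hXm hXind hXlaw (Y := fun x => A (g x θ₀))
    (A.continuous.measurable.comp (hgm θ₀))
    (A.comp_memLp' (memLp_two_of_integrable_outer (hgm θ₀) hout))
    (fun w => by
      obtain ⟨u, hu, -⟩ := hA w
      simp_rw [hu]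
      rw [integral_inner hint, hθ₀, inner_zero_right])
    (fun w => by
      obtain ⟨u, hu, hu'⟩ := hA w
      simp_rw [hu]
      rw [← hu', inner_integral_outer hout]
      simp_rw [sq])
  refine h.congr (fun n => Eventually.of_forall fun ω => ?_) (EventuallyEq.refl _ _)
  simp only
  rw [estMean, smul_smul, ← div_eq_mul_inv, Real.sqrt_div_self, map_smul, map_sum, Finset.sum_range]
  rfl

theorem norm_sq_of_sqrt_inverse {S W : E p →L[ℝ] E p}
    (hWsymm : ∀ u v, ⟪W u, v⟫_ℝ = ⟪u, W v⟫_ℝ) (hWS : ∀ z, W (S (W z)) = z) (u : E p) :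
    ‖W (S u)‖ ^ 2 = ⟪u, S u⟫_ℝ := by
  have hWinj : Function.Injective W :=
    (LinearMap.injective_iff_surjective (f := (W : E p →ₗ[ℝ] E p))).2 fun z => ⟨S (W z), hWS z⟩
  have h1 : W (W (S u)) = u := by
    obtain ⟨z, rfl⟩ := (LinearMap.injective_iff_surjective (f := (W : E p →ₗ[ℝ] E p))).1 hWinj u
    exact congrArg W (hWS z)
  rw [← real_inner_self_eq_norm_sq, hWsymm, h1, real_inner_comm]

/-- The rescaled sample mean is stochastically bounded. -/
theorem exists_bound_sqrt_mul_estMean (hXm : ∀ i, AEMeasurable (X i) μ)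
    (hXind : iIndepFun X μ) (hXlaw : ∀ i, μ.map (X i) = F)
    (hgm : ∀ θ, Measurable fun x => g x θ) (hθ₀ : ∫ x, g x θ₀ ∂F = 0)
    (hint : Integrable (fun x => g x θ₀) F) (hout : Integrable (fun x => outer (g x θ₀)) F)
    {S W : E p →L[ℝ] E p} (hS : ∫ x, outer (g x θ₀) ∂F = S)
    (hWsymm : ∀ u v, ⟪W u, v⟫_ℝ = ⟪u, W v⟫_ℝ) (hWS : ∀ z, W (S (W z)) = z) {δ : ENNReal} (hδ : 0 < δ) :
    ∃ M, ∀ᶠ n : ℕ in atTop,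
      μ {ω | ¬ √(n : ℝ) * ‖estMean g (sample X n ω) θ₀‖ ≤ M} ≤ δ := by
  -- `W` standardizes the mean, so its image is tight; `W` is bounded below, so the mean itself is
  -- tight.
  have h := tendstoInDistribution_of_standardizing hXm hXind hXlaw hgm hθ₀ hint hout (A := W)
    (fun w => ⟨W w, fun z => (hWsymm w z).symm, by
      rw [hS, hWsymm, hWS, real_inner_self_eq_norm_sq]⟩)
  obtain ⟨M, hM⟩ := exists_bound_of_tendstoInDistribution h hδ
  have hWinj : Function.Injective W := (LinearMap.injective_iff_surjective
    (f := (W : E p →ₗ[ℝ] E p))).2 fun z => ⟨_, hWS z⟩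
  obtain ⟨κ, hκ, hκ'⟩ := exists_pos_le_norm hWinj
  refine ⟨M / κ, ?_⟩
  filter_upwards [hM] with n hn
  refine (measure_mono fun ω hω => ?_).trans hn
  have hω' : ¬ √(n : ℝ) * ‖estMean g (sample X n ω) θ₀‖ ≤ M / κ := hω
  change ¬ _
  refine fun hle => hω' ?_
  have h1 := (hκ' (√(n : ℝ) • estMean g (sample X n ω) θ₀)).trans hle
  rw [norm_smul, Real.norm_of_nonneg (Real.sqrt_nonneg _)] at h1
  rw [le_div_iff₀ hκ]
  linarith

/-- Samples of independent observations form regular arrays on small balls. -/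
theorem exists_regularArray (hXm : ∀ i, AEMeasurable (X i) μ)
    (hXind : iIndepFun X μ) (hXlaw : ∀ i, μ.map (X i) = F)
    (hg : RegularAt F g θ₀) {R : ℝ} (hR : 0 < R)
    {ρ₁ : ℝ} (hρ₁ : 0 < ρ₁) {H : E k → ℝ} (hH : Integrable H F)
    (henv : ∀ᵐ x ∂F, Envelope g θ₀ ρ₁ H x)
    (hout : Integrable (fun x => outer (g x θ₀)) F)
    (hder : Integrable (fun x => fderiv ℝ (g x) θ₀) F) {S D W : E p →L[ℝ] E p}
    (hS : ∫ x, outer (g x θ₀) ∂F = S) (hD : ∫ x, fderiv ℝ (g x) θ₀ ∂F = D)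
    (hWsymm : ∀ u v, ⟪W u, v⟫_ℝ = ⟪u, W v⟫_ℝ) (hWS : ∀ z, W (S (W z)) = z) :
    ∃ ρ K σ κ, ρ ≤ R ∧ ρ ≤ ρ₁ ∧ RegularArray (n := Prod.fst) (probFilter μ)
      (fun a => sample X a.1 a.2) g θ₀ S D W ρ K σ κ := by
  have hSpos := inner_integral_outer_pos hg hout
  have hDinj := injective_integral_fderiv hg hder
  have hSlim := tendsto_avg hXm hXind hXlaw hout
  have hDlim := tendsto_avg hXm hXind hXlaw hder
  rw [hS] at hSpos hSlim
  rw [hD] at hDinj hDlim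
  obtain ⟨σ, hσ, hσ'⟩ := exists_pos_le_inner hSpos
  obtain ⟨κ, hκ, hκ'⟩ := exists_pos_le_norm hDinj
  set B := ∫ x, H x ∂F + 1 with hB
  have hBpos : 0 ≤ B := by
    have : 0 ≤ ∫ x, H x ∂F :=
      integral_nonneg_of_ae (henv.mono fun x hx => hx.nonneg hρ₁.le)
    linarith
  -- The last term enforces `small` with `K = B + 1`, where `B` exceeds the mean of `H` by `1` so
  -- that it eventually bounds the averages.
  set ρ := min (min R ρ₁) (κ / 4 / (B + 1)) with hρdef
  have hρ : 0 < ρ := lt_min (lt_min hR hρ₁) (by positivity)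
  have hρR : ρ ≤ R := (min_le_left _ _).trans (min_le_left _ _)
  have hρρ₁ : ρ ≤ ρ₁ := (min_le_left _ _).trans (min_le_right _ _)
  refine ⟨ρ, B + 1, σ, κ, hρR, hρρ₁, regularArray_of_tendsto (H := H) tendsto_fst_probFilter hρ
    hBpos hσ hκ ?_ ?_ ?_ (fun δ hδ => eventually_forall_le_mul hXm hXind hXlaw hH hδ)
    hSlim hDlim hσ' hκ'
    (norm_sq_of_sqrt_inverse hWsymm hWS)⟩
  · have : ρ ≤ κ / 4 / (B + 1) := min_le_right _ _
    rwa [le_div_iff₀ (by positivity), mul_comm] at this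
  · refine eventually_probFilter_of_ae fun n => ?_
    filter_upwards [ae_forall_sample hXm hXlaw henv] with ω hω i
    exact (hω i).mono hρρ₁
  · exact (tendsto_avg hXm hXind hXlaw hH).eventually_le_const (by linarith)

end

/-! ### Regularity of the constraint, the statistics at uniform weights, and Slutsky's lemma -/

theorem ConstraintRegularAt.hasStrictFDerivAt {p q : ℕ} {c : E p → E q} {θ₀ : E p}
    (hc : ConstraintRegularAt c θ₀) : HasStrictFDerivAt c (fderiv ℝ c θ₀) θ₀ := by
  obtain ⟨U, hU, hd, hcont⟩ := hc.cont_diff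
  refine hasStrictFDerivAt_of_hasFDerivAt_of_continuousAt ?_ (hcont.continuousAt hU)
  filter_upwards [hU] with θ hθ using (hd θ hθ).hasFDerivAt

theorem ConstraintRegularAt.range_eq_top {p q : ℕ} {c : E p → E q} {θ₀ : E p}
    (hc : ConstraintRegularAt c θ₀) : (fderiv ℝ c θ₀).range = ⊤ :=
  range_eq_top_of_rank (J := jacobian c θ₀) (fun _ _ => rfl) hc.rank_jacobian

theorem phiDiv_uniformWeights_self {φ : ℝ → ℝ} (h : φ 1 = 0) (n : ℕ) :
    phiDiv φ (uniformWeights n) (uniformWeights n) = 0 := by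
  rcases Nat.eq_zero_or_pos n with rfl | hn
  · simp [phiDiv]
  · have : (n : ℝ) ≠ 0 := by positivity
    simp [phiDiv, uniformWeights, this, h]

theorem statT_eq_of_uniform {k p r n : ℕ} {φ : ℝ → ℝ} (h : φ 1 = 0) {g : E k → E p → E r}
    {x : Fin n → E k} {θ₁ : E p} (h₁ : elWeights g x θ₁ = uniformWeights n) (θ₂ : E p) :
    statT φ g x θ₁ θ₂
      = 2 * (n : ℝ) / deriv (deriv φ) 1 * phiDiv φ (uniformWeights n) (elWeights g x θ₂) := by
  rw [statT, h₁, phiDiv_uniformWeights_self h, sub_zero]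

theorem statS_eq_of_uniform {k p r n : ℕ} {φ : ℝ → ℝ} {g : E k → E p → E r}
    {x : Fin n → E k} {θ₁ : E p} (h₁ : elWeights g x θ₁ = uniformWeights n) (θ₂ : E p) :
    statS φ g x θ₁ θ₂
      = 2 * (n : ℝ) / deriv (deriv φ) 1 * phiDiv φ (uniformWeights n) (elWeights g x θ₂) := by
  rw [statS, h₁]

theorem tendstoInDistribution_of_tendsto_probFilter {Ω Ω' : Type*} [MeasurableSpace Ω]
    [MeasurableSpace Ω'] {μ : Measure Ω} [IsProbabilityMeasure μ] {ν : Measure Ω'}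
    [IsProbabilityMeasure ν] {Q Y : ℕ → Ω → ℝ} {Z : Ω' → ℝ}
    (hQ : TendstoInDistribution Q atTop Z (fun _ => μ) ν) (hY : ∀ n, AEMeasurable (Y n) μ)
    (h : Tendsto (fun a : ℕ × Ω => Y a.1 a.2 - Q a.1 a.2) (probFilter μ) (𝓝 0)) :
    TendstoInDistribution Y atTop Z (fun _ => μ) ν :=
  tendstoInDistribution_of_tendstoInMeasure_sub (X := Q) Y Z hQ
    (tendstoInMeasure_of_tendsto_probFilter (Y := Y - Q) h) hY

end EmpiricalPhi

end

open EmpiricalPhi in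
/-- Asymptotic null distribution of the empirical phi-divergence statistics for a composite null
hypothesis `c θ = 0`, with as many estimating functions as parameters. -/
theorem theorem5 {Ω : Type*} [MeasurableSpace Ω] (μ : Measure Ω) [IsProbabilityMeasure μ]
    {k p q : ℕ} (X : ℕ → Ω → EmpiricalPhi.E k) (F : Measure (EmpiricalPhi.E k))
    (hXm : ∀ i, AEMeasurable (X i) μ) (hXind : iIndepFun X μ) (hXlaw : ∀ i, μ.map (X i) = F)
    (g : EmpiricalPhi.E k → EmpiricalPhi.E p → EmpiricalPhi.E p)
    (hgm : ∀ θ, Measurable fun x => g x θ)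
    (c : EmpiricalPhi.E p → EmpiricalPhi.E q) (φ : ℝ → ℝ) (hφ : EmpiricalPhi.IsPhi φ)
    (θ₀ : EmpiricalPhi.E p) (hθ₀ : ∫ x, g x θ₀ ∂F = 0) (hnull : c θ₀ = 0)
    (hg : EmpiricalPhi.RegularAt F g θ₀) (hc : EmpiricalPhi.ConstraintRegularAt c θ₀) :
    ∃ ρ₀ : ℝ, 0 < ρ₀ ∧
      (∀ ρ : ℝ, 0 < ρ → ρ ≤ ρ₀ → ∀ᵐ ω ∂μ, ∀ᶠ n in atTop,
        (∃ θ, EmpiricalPhi.IsMELE g (EmpiricalPhi.sample X n ω) (Metric.closedBall θ₀ ρ) θ) ∧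
        ∃ θ, EmpiricalPhi.IsMELE g (EmpiricalPhi.sample X n ω)
          (Metric.closedBall θ₀ ρ ∩ {θ | c θ = 0}) θ) ∧
      ∀ Θ ∈ 𝓝 θ₀, ∀ θhat θtil : ℕ → Ω → EmpiricalPhi.E p,
        Tendsto (fun n => μ {ω | ¬ EmpiricalPhi.IsMELE g (EmpiricalPhi.sample X n ω) Θ
          (θhat n ω)}) atTop (𝓝 0) →
        Tendsto (fun n => μ {ω | ¬ EmpiricalPhi.IsMELE g (EmpiricalPhi.sample X n ω)
          (Θ ∩ {θ | c θ = 0}) (θtil n ω)}) atTop (𝓝 0) →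
        Tendsto (fun n => μ {ω | θtil n ω ∉ Metric.closedBall θ₀ ρ₀}) atTop (𝓝 0) →
        (∀ n, AEMeasurable (fun ω => EmpiricalPhi.statT φ g (EmpiricalPhi.sample X n ω)
          (θhat n ω) (θtil n ω)) μ) →
        (∀ n, AEMeasurable (fun ω => EmpiricalPhi.statS φ g (EmpiricalPhi.sample X n ω)
          (θhat n ω) (θtil n ω)) μ) →
        Tendsto (fun n => μ {ω |
          EmpiricalPhi.statT φ g (EmpiricalPhi.sample X n ω) (θhat n ω) (θtil n ω) ≠
            EmpiricalPhi.statS φ g (EmpiricalPhi.sample X n ω) (θhat n ω) (θtil n ω)})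
          atTop (𝓝 0) ∧
        TendstoInDistribution (fun n ω => EmpiricalPhi.statT φ g (EmpiricalPhi.sample X n ω)
          (θhat n ω) (θtil n ω)) atTop (id : ℝ → ℝ) (fun _ => μ) (EmpiricalPhi.chiSquared q) ∧
        TendstoInDistribution (fun n ω => EmpiricalPhi.statS φ g (EmpiricalPhi.sample X n ω)
          (θhat n ω) (θtil n ω)) atTop (id : ℝ → ℝ) (fun _ => μ) (EmpiricalPhi.chiSquared q) := by
  have hFp : IsProbabilityMeasure F := by
    rw [← hXlaw 0]
    exact Measure.isProbabilityMeasure_map (hXm 0)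
  obtain ⟨ρ₁, hρ₁, H, hH, henv⟩ := hg.exists_envelope
  have hint := integrable_estFun hgm hρ₁ hH henv
  have hout := integrable_outer hgm hρ₁ hH henv
  have hder := integrable_fderiv hgm hρ₁ hH henv
  obtain ⟨S, hS⟩ : ∃ S, ∫ x, outer (g x θ₀) ∂F = S := ⟨_, rfl⟩
  obtain ⟨D, hD⟩ : ∃ D, ∫ x, fderiv ℝ (g x) θ₀ ∂F = D := ⟨_, rfl⟩
  have hSpos := inner_integral_outer_pos hg hout
  have hDinj := injective_integral_fderiv hg hder
  rw [hS] at hSpos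
  rw [hD] at hDinj
  obtain ⟨W, hWsymm, hWS⟩ := exists_sqrt_inverse (S := S)
    (fun u v => by
      rw [← hS, real_inner_comm, inner_integral_outer hout, inner_integral_outer hout]
      simp_rw [mul_comm]) hSpos
  obtain ⟨U, hU, hcd, -⟩ := hc.cont_diff
  obtain ⟨R, hR, hRU⟩ := Metric.nhds_basis_closedBall.mem_iff.1 hU
  obtain ⟨ρ₀, K, σ, κ, hρR, hρρ₁, harr⟩ := exists_regularArray hXm hXind hXlaw hg hR hρ₁ hH
    henv hout hder hS hD hWsymm hWS
  obtain ⟨A, T, hA, hT, hAvar⟩ := exists_minimizer hWsymm hWS hDinj hc.range_eq_top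
  rw [← hS] at hAvar
  refine ⟨ρ₀, harr.rho_pos, fun ρ hρ hρρ₀ => ?_, fun Θ hΘ θhat θtil hhat htil hball hTm hSm => ?_⟩
  · have hcont : ContinuousOn c (Metric.closedBall θ₀ ρ) := fun θ hθ =>
      (hcd θ (hRU (Metric.closedBall_subset_closedBall (hρρ₀.trans hρR) hθ))).continuousAt
        |>.continuousWithinAt
    have hcomp := isCompact_closedBall θ₀ ρ
    have hcompc : IsCompact (Metric.closedBall θ₀ ρ ∩ {θ | c θ = 0}) :=
      hcomp.of_isClosed_subset
        (hcont.preimage_isClosed_of_isClosed hcomp.isClosed isClosed_singleton)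
        Set.inter_subset_left
    have hmem : θ₀ ∈ Metric.closedBall θ₀ ρ := Metric.mem_closedBall_self hρ.le
    filter_upwards [ae_forall_sample hXm hXlaw henv,
      ae_eventually_exists_pos_feasibleWeights hXm hXind hXlaw hgm hθ₀ hg hint hout] with ω h1 h2
    filter_upwards [h2, eventually_gt_atTop 0] with n ⟨w, hw, hwpos⟩ hn
    have hgc : ∀ i, ContinuousOn (g (sample X n ω i)) (Metric.closedBall θ₀ ρ) := fun i θ hθ =>
      (((h1 i).mono (hρρ₀.trans hρρ₁)).differentiableAt θ hθ).continuousAt.continuousWithinAt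
    exact ⟨exists_isMELE hn hcomp hgc hmem hw hwpos,
      exists_isMELE hn hcompc (fun i => (hgc i).mono Set.inter_subset_left) ⟨hmem, hnull⟩ hw hwpos⟩
  · have htight := fun (δ : ENNReal) (hδ : 0 < δ) =>
      exists_bound_sqrt_mul_estMean hXm hXind hXlaw hgm hθ₀ hint hout hS hWsymm hWS hδ
    have hhat' : ∀ᶠ a in probFilter μ,
        IsMELE g (sample X a.1 a.2) Θ (θhat a.1 a.2) :=
      (eventually_probFilter (P := fun a : ℕ × Ω =>
        IsMELE g (sample X a.1 a.2) Θ (θhat a.1 a.2))).2 hhat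
    have htil' : ∀ᶠ a in probFilter μ,
        IsMELE g (sample X a.1 a.2) (Θ ∩ {θ | c θ = 0}) (θtil a.1 a.2) :=
      (eventually_probFilter (P := fun a : ℕ × Ω =>
        IsMELE g (sample X a.1 a.2) (Θ ∩ {θ | c θ = 0}) (θtil a.1 a.2))).2 htil
    have hball' : ∀ᶠ a in probFilter μ, θtil a.1 a.2 ∈ Metric.closedBall θ₀ ρ₀ :=
      (eventually_probFilter (P := fun a : ℕ × Ω =>
        θtil a.1 a.2 ∈ Metric.closedBall θ₀ ρ₀)).2 hball
    -- A root in `Θ` already forces uniform weights at any maximizer over `Θ`, so `θhat` need not be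
    -- close to `θ₀`.
    have hunif : ∀ᶠ a in probFilter μ,
        elWeights g (sample X a.1 a.2) (θhat a.1 a.2) = uniformWeights a.1 := by
      have hroot : ∀ᶠ a in probFilter μ, ∃ θ ∈ Θ, ∑ i, g (sample X a.1 a.2 i) θ = 0 :=
        eventually_probFilter_of_tight
          (Y := fun a => √(a.1 : ℝ) * ‖estMean g (sample X a.1 a.2) θ₀‖) htight fun M =>
          (harr.mono inf_le_left).eventually_exists_root (M := M)
            (mem_inf_of_right (mem_principal_self _)) hΘ
      filter_upwards [hroot, hhat',
        tendsto_fst_probFilter.eventually_gt_atTop 0] with a ⟨θ, hθ, h0⟩ h2 hn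
      exact IsMELE.elWeights_eq_uniform h2 hn hθ h0
    -- The common value of both statistics under uniform weights, first on the events where the
    -- rescaled mean is at most `M`, then everywhere by tightness.
    have hstat : Tendsto (fun a : ℕ × Ω => 2 * (a.1 : ℝ) / deriv (deriv φ) 1 *
          phiDiv φ (uniformWeights a.1) (elWeights g (sample X a.1 a.2) (θtil a.1 a.2))
        - ‖A (√(a.1 : ℝ) • estMean g (sample X a.1 a.2) θ₀)‖ ^ 2) (probFilter μ) (𝓝 0) :=
      tendsto_probFilter_of_tight
        (Y := fun a => √(a.1 : ℝ) * ‖estMean g (sample X a.1 a.2) θ₀‖) htight fun M =>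
        (harr.mono inf_le_left).tendsto_phiDiv_constrained hφ (M := M)
          (mem_inf_of_right (mem_principal_self _)) hc.hasStrictFDerivAt hc.range_eq_top hnull
          hA hT hΘ (htil'.filter_mono inf_le_left)
          (hball'.filter_mono inf_le_left)
    have hchi := tendstoInDistribution_norm_sq
      (tendstoInDistribution_of_standardizing hXm hXind hXlaw hgm hθ₀ hint hout hAvar)
    refine ⟨?_, tendstoInDistribution_of_tendsto_probFilter hchi hTm (hstat.congr' ?_),
      tendstoInDistribution_of_tendsto_probFilter hchi hSm (hstat.congr' ?_)⟩
    · refine (eventually_probFilter (P := fun a : ℕ × Ω => statT φ g (sample X a.1 a.2) (θhat a.1 a.2)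
        (θtil a.1 a.2) = statS φ g (sample X a.1 a.2) (θhat a.1 a.2) (θtil a.1 a.2))).1 ?_
      filter_upwards [hunif] with a ha
      rw [statT_eq_of_uniform hφ.map_one ha, statS_eq_of_uniform ha]
    · filter_upwards [hunif] with a ha
      rw [statT_eq_of_uniform hφ.map_one ha]
    · filter_upwards [hunif] with a ha
      rw [statS_eq_of_uniform ha]
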